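/- Let $n\ge 2$, $k\in\mathbb R$, and let $M$ be the (complete) simply connected Riemannian manifold of dimension $n$ and constant sectional curvature $k$, with Riemannian distance $\rho_M$; put $\operatorname{diam}M=\pi/\sqrt k$ if $k>0$ and $\operatorname{diam}M=\infty$ if $k\le 0$. Let $\Sigma(M)$ be the space of smooth sections of the spinor bundle of $M$, associated with its unique spin structure and a finite-dimensional complex module over the Clifford algebra of $\mathbb R^n$ (for instance the irreducible spinor module). Clifford multiplication, written as juxtaposition, follows the convention $vw+wv=2g(v,w)$; $\nabla$ is the Levi-Civita spin connection and $D_M\psi=\sum_i e_i\nabla_{e_i}\psi$ (for a local orthonormal frame $e_i$) is the Dirac operator. If $\rho_M(x,x')<\operatorname{diam}M$, let $\Lambda(x,x')$ be the spinor parallel transport from $x'$ to $x$ along the unique minimal geodesic from $x'$ to $x$, and if moreover $x\ne x'$ let $\nu(x,x')\in T_xM$ be the unit tangent vector of this geodesic at $x$. For $0<r<\operatorname{diam}M$ let $S_M(x,r)$ be the geodesic sphere of centre $x$ and radius $r$, $dS$ its induced hypersurface measure, $m_M(r)=|\mathbb S^{n-1}|\big(\sin(\sqrt k\,r)/\sqrt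 k\big)^{n-1}$ its area, $d\mu_M(r)=m_M(r)\,dr$, and $$\mathcal M_r\psi(x)=\frac1{m_M(r)}\int_{S_M(x,r)}\Lambda(x,x')\psi(x')\,dS(x'),\qquad \widehat{\mathcal M}_r\psi(x)=\frac1{m_M(r)}\int_{S_M(x,r)}\nu(x,x')\Lambda(x,x')\psi(x')\,dS(x').$$ Define $$T_Mf=f''+(n-1)\sqrt k\cot(\sqrt k\,r)f'-\frac{k(n-1)}4\Big(\sec^2\frac{\sqrt k\,r}2+n-1\Big)f,$$ $$\widehat T_Mf=f''+(n-1)\sqrt k\cot(\sqrt k\,r)f'-\frac{k(n-1)}4\Big(\csc^2\frac{\sqrt k\,r}2+n-1\Big)f,$$ where for $k<0$ one takes $\sqrt k\in i\mathbb R^+$ and for $k=0$ the coefficients and $m_M$ are understood as their limits as $k\to0$, i.e. $\sin(\sqrt k\,r)/\sqrt k=r$, $\sqrt k\cot(\sqrt k\,r)=1/r$, $\frac k4\csc^2\frac{\sqrt k\,r}2=1/r^2$. Then for all $f,\hat f\in C_0^\infty((0,\operatorname{diam}M))$ (complex-valued) and all $\psi\in\Sigma(M)$, the spinor field $\int_0^\infty\big(f(r)\mathcal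 M_r\psi+\hat f(r)\widehat{\mathcal M}_r\psi\big)\,d\mu_M(r)$ belongs to $\Sigma(M)$ and $$D_M^2\int_0^\infty\big(f(r)\,\mathcal M_r\psi+\hat f(r)\,\widehat{\mathcal M}_r\psi\big)\,d\mu_M(r)=\int_0^\infty\big(T_Mf(r)\,\mathcal M_r\psi+\widehat T_M\hat f(r)\,\widehat{\mathcal M}_r\psi\big)\,d\mu_M(r).$$ -/

import Mathlib

open scoped ContDiff RealInnerProductSpace
open MeasureTheory Set

noncomputable section

namespace SpaceForm

/-! ## The space form as a hyperquadric -/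

/-- Euclidean space `ℝⁿ`: the model tangent space. -/
abbrev E (n : ℕ) : Type := EuclideanSpace ℝ (Fin n)

/-- The ambient space `ℝ × ℝⁿ` of the hyperquadric. -/
abbrev V (n : ℕ) : Type := ℝ × E n

/-- The complete simply connected Riemannian manifold of dimension `n ≥ 2` and constant sectional
curvature `k`, as the hyperquadric `t² + k |y|² = 1` with metric induced by `dt² / k + |dy|²`.
With `s = t / √|k|` this is the round sphere `s² + |y|² = 1 / k` if `k > 0`, and the upper sheet
of the hyperboloid `s² - |y|² = 1 / |k|` in Minkowski space if `k < 0`; for `k = 0` it is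
`{1} × ℝⁿ`. -/
def M (n : ℕ) (k : ℝ) : Set (V n) :=
  {p | p.1 ^ 2 + k * ‖p.2‖ ^ 2 = 1 ∧ (k ≤ 0 → 0 < p.1)}

/-- The tangent space `T_x M`. -/
def tangent {n : ℕ} (k : ℝ) (x : V n) : Set (V n) :=
  {v | x.1 * v.1 + k * ⟪x.2, v.2⟫ = 0}

/-- The bilinear form `dt² / k + |dy|²`, which restricts to the Riemannian metric on tangent
vectors. (For `k = 0` tangent vectors have first component `0`, and the first summand is `0`.) -/
def metric {n : ℕ} (k : ℝ) (v w : V n) : ℝ := v.1 * w.1 / k + ⟪v.2, w.2⟫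

/-- The Riemannian length of a tangent vector. -/
def tnorm {n : ℕ} (k : ℝ) (v : V n) : ℝ := √(metric k v v)

/-- The length of a curve `γ : [0,1] → M`. -/
def length {n : ℕ} (k : ℝ) (γ : ℝ → V n) : ℝ := ∫ t in (0 : ℝ)..1, tnorm k (deriv γ t)

/-- The Riemannian distance `ρ_M`: the infimum of the lengths of the `C¹` curves in `M`
from `x` to `x'`. -/
def rdist {n : ℕ} (k : ℝ) (x x' : V n) : ℝ :=
  sInf {L | ∃ γ : ℝ → V n, ContDiff ℝ 1 γ ∧ (∀ t ∈ Icc (0 : ℝ) 1, γ t ∈ M n k) ∧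
    γ 0 = x ∧ γ 1 = x' ∧ L = length k γ}

/-- Geodesics: curves in `M` whose acceleration in the ambient space has no tangential part. -/
def IsGeodesic {n : ℕ} (k : ℝ) (γ : ℝ → V n) : Prop :=
  ContDiff ℝ ∞ γ ∧ (∀ t, γ t ∈ M n k) ∧
    ∀ t, ∀ w ∈ tangent k (γ t), metric k (deriv (deriv γ) t) w = 0

/-- The exponential map: `exp_x v = γ 1` for the geodesic with `γ 0 = x` and `γ' 0 = v`. -/
def expMap {n : ℕ} (k : ℝ) (x v : V n) : V n :=
  (Classical.epsilon fun γ : ℝ → V n => IsGeodesic k γ ∧ γ 0 = x ∧ deriv γ 0 = v) 1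

/-- `γ` restricted to `[0,1]` is a minimal geodesic from `x'` to `x`. -/
def IsMinimalGeodesic {n : ℕ} (k : ℝ) (x x' : V n) (γ : ℝ → V n) : Prop :=
  IsGeodesic k γ ∧ γ 0 = x' ∧ γ 1 = x ∧ length k γ = rdist k x x'

/-- The minimal geodesic `γ_{x,x'}` from `x'` to `x` (unique if `ρ_M(x,x')` is less than the
diameter). -/
def minGeodesic {n : ℕ} (k : ℝ) (x x' : V n) : ℝ → V n :=
  Classical.epsilon (IsMinimalGeodesic k x x')

/-- `ν(x,x') ∈ T_x M`: the unit tangent vector at `x` of the minimal geodesic from `x'` to `x`. -/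
def nu {n : ℕ} (k : ℝ) (x x' : V n) : V n :=
  (tnorm k (deriv (minGeodesic k x x') 1))⁻¹ • deriv (minGeodesic k x x') 1

/-! ## Orthonormal frames -/

/-- The two local frames: `north` on `M` minus the point `(-1,0)`, and `south` on `M` minus the
point `(1,0)`. The second one is only needed (and has a nonempty domain) if `k > 0`. -/
inductive Chart
  | north
  | south

/-- The domains of the two local frames. -/
def chartDomain (n : ℕ) (k : ℝ) : Chart → Set (V n)
  | .north => {p | p ∈ M n k ∧ -1 < p.1}
  | .south => {p | p ∈ M n k ∧ p.1 < 1}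

/-- The frame used to describe the fibre at a point: `north` wherever it is defined. -/
def chartAt {n : ℕ} (p : V n) : Chart :=
  open Classical in if -1 < p.1 then .north else .south

/-- The `i`-th standard basis vector of `ℝⁿ`. -/
def basisVec {n : ℕ} (i : Fin n) : E n := EuclideanSpace.single i 1

/-- The first standard basis vector of `ℝⁿ`. -/
def firstVec (n : ℕ) : E n := WithLp.toLp 2 fun i => if (i : ℕ) = 0 then 1 else 0

/-- The reflection of `ℝⁿ` in the hyperplane orthogonal to the first basis vector. -/
def flip {n : ℕ} (v : E n) : E n := v - (2 * ⟪firstVec n, v⟫) • firstVec n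

/-- The local orthonormal frames of `M`: at a point `p` of its domain, `frame k α p` is a linear
isometry from `ℝⁿ` onto the tangent space, and the frame vectors are the images of the standard
basis. They are the normalized coordinate frames of the two stereographic projections; the
reflection `flip` makes the two orientations agree. -/
def frame {n : ℕ} (k : ℝ) : Chart → V n → E n → V n
  | .north, p, v => (-(k * ⟪p.2, v⟫), v - (k * ⟪p.2, v⟫ / (1 + p.1)) • p.2)
  | .south, p, v => (k * ⟪p.2, flip v⟫, flip v - (k * ⟪p.2, flip v⟫ / (1 - p.1)) • p.2)

/-- The Levi-Civita connection form `ω_{ij}(X) = g(∇_X b_i, b_j)` of the frame `b`, where `∇_X b_i`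
is the tangential part of the ambient derivative of `b_i` along `X`. -/
def connForm {n : ℕ} (k : ℝ) (α : Chart) (p X : V n) (i j : Fin n) : ℝ :=
  metric k (fderiv ℝ (fun q => frame k α q (basisVec i)) p X) (frame k α p (basisVec j))

/-! ## Spinors -/

/-- The Clifford algebra of Euclidean space with the convention `v v = |v|²`. -/
abbrev Cl (n : ℕ) : Type :=
  CliffordAlgebra (LinearMap.BilinMap.toQuadraticMap (innerₗ (E n)))

/-- A vector of `ℝⁿ` as an element of the Clifford algebra. -/
def vec {n : ℕ} (v : E n) : Cl n := CliffordAlgebra.ι _ v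

section Spinor

variable {n : ℕ} {S : Type*} [NormedAddCommGroup S] [NormedSpace ℂ S]

/-- The transition function of the spin structure. On the overlap of the two domains, with
`u = y / |y|`, the frames are related by the rotation which is the product of the reflections in
the hyperplanes orthogonal to `u` and to the first basis vector `e`; this rotation is lifted to
`u e ∈ Spin(n)`. An element of the fibre of the spinor bundle at `p` is given by its component in
the frame `chartAt p`, and `toChart c α p` is the change from that component to the component in
the frame `α`. -/
def toChart (c : Cl n →ₐ[ℝ] Module.End ℂ S) (α : Chart) (p : V n) (v : S) : S :=
  match chartAt p, α with
  | .north, .south => c (vec (firstVec n) * vec (‖p.2‖⁻¹ • p.2)) v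
  | .south, .north => c (vec (‖p.2‖⁻¹ • p.2) * vec (firstVec n)) v
  | .north, .north => v
  | .south, .south => v

/-- The component of a section of the spinor bundle in the frame `α`. -/
def localRep (c : Cl n →ₐ[ℝ] Module.End ℂ S) (α : Chart) (ψ : V n → S) (p : V n) : S :=
  toChart c α p (ψ p)

/-- `ψ ∈ Σ(M)`: smooth sections of the spinor bundle. Only the values of `ψ` on `M` matter. -/
def IsSmoothSpinor (k : ℝ) (c : Cl n →ₐ[ℝ] Module.End ℂ S) (ψ : V n → S) : Prop :=
  ∀ α, ContDiffOn ℝ ∞ (localRep c α ψ) (chartDomain n k α)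

/-- The spin connection form `¼ ∑ ω_{ij}(X) e_j e_i` of the frame `α`. -/
def spinForm (k : ℝ) (c : Cl n →ₐ[ℝ] Module.End ℂ S) (α : Chart) (p X : V n) :
    Module.End ℂ S :=
  (1 / 4 : ℝ) • ∑ i, ∑ j, connForm k α p X i j • c (vec (basisVec j) * vec (basisVec i))

/-- The component in the frame `α` of the covariant derivative `∇_X ψ` at `p`. The derivative
within `chartDomain n k α`, which is open in `M`, is evaluated on tangent vectors `X` only, where
it does not depend on an extension of the section to the ambient space. -/
def covDeriv (k : ℝ) (c : Cl n →ₐ[ℝ] Module.End ℂ S) (α : Chart) (ψ : V n → S) (p X : V n) : S :=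
  fderivWithin ℝ (localRep c α ψ) (chartDomain n k α) p X
    + spinForm k c α p X (localRep c α ψ p)

/-- The Dirac operator `D_M ψ = ∑ e_i ∇_{e_i} ψ`, computed at `p` in the frame `chartAt p`. -/
def dirac (k : ℝ) (c : Cl n →ₐ[ℝ] Module.End ℂ S) (ψ : V n → S) (p : V n) : S :=
  ∑ i, c (vec (basisVec i))
    (covDeriv k c (chartAt p) ψ p (frame k (chartAt p) p (basisVec i)))

/-- Clifford multiplication by a tangent vector `X ∈ T_p M` on the fibre at `p`. -/
def cliff (k : ℝ) (c : Cl n →ₐ[ℝ] Module.End ℂ S) (p X : V n) (v : S) : S :=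
  ∑ i, metric k X (frame k (chartAt p) p (basisVec i)) • c (vec (basisVec i)) v

/-- `Ψ` is a parallel section of the spinor bundle along `γ : [0,1] → M`. -/
def IsParallel (k : ℝ) (c : Cl n →ₐ[ℝ] Module.End ℂ S) (γ : ℝ → V n) (Ψ : ℝ → S) : Prop :=
  ∀ t ∈ Icc (0 : ℝ) 1, ∀ α, γ t ∈ chartDomain n k α →
    HasDerivWithinAt (fun s => toChart c α (γ s) (Ψ s))
      (-(spinForm k c α (γ t) (deriv γ t) (toChart c α (γ t) (Ψ t)))) (Icc 0 1) t

/-- The spinor parallel transport `Λ(x,x')` along the minimal geodesic from `x'` to `x`. -/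
def transport (k : ℝ) (c : Cl n →ₐ[ℝ] Module.End ℂ S) (x x' : V n) (v : S) : S :=
  (Classical.epsilon fun Ψ : ℝ → S => IsParallel k c (minGeodesic k x x') Ψ ∧ Ψ 0 = v) 1

end Spinor

/-! ## Spherical means -/

/-- The geodesic sphere `S_M(x,r)`. -/
def gsphere {n : ℕ} (k : ℝ) (x : V n) (r : ℝ) : Set (V n) :=
  {x' | x' ∈ M n k ∧ rdist k x x' = r}

/-- The parametrization of `S_M(x,r)` by `θ ↦ exp_x(r θ)`, where the unit sphere of `T_x M` is
identified with the one of `ℝⁿ` by means of the orthonormal frame. -/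
def sphereMap {n : ℕ} (k : ℝ) (x : V n) (r : ℝ) (θ : E n) : V n :=
  expMap k x (r • frame k (chartAt x) x θ)

/-- The Jacobian of `sphereMap` as a map from the unit sphere `𝕊ⁿ⁻¹` into the Riemannian manifold
`M`: the square root of the Gram determinant of the images of an orthonormal basis
of `T_θ 𝕊ⁿ⁻¹ = θᗮ`. -/
def sphereJac {n : ℕ} (k : ℝ) (x : V n) (r : ℝ) (θ : E n) : ℝ :=
  √(Matrix.det (Matrix.of fun i j : Fin (Module.finrank ℝ (ℝ ∙ θ)ᗮ) =>
    metric k (fderiv ℝ (sphereMap k x r) θ (stdOrthonormalBasis ℝ (ℝ ∙ θ)ᗮ i))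
      (fderiv ℝ (sphereMap k x r) θ (stdOrthonormalBasis ℝ (ℝ ∙ θ)ᗮ j))))

/-- The hypersurface measure `dS` on `S_M(x,r)` induced by the Riemannian metric. -/
def surfMeasure {n : ℕ} (k : ℝ) (x : V n) (r : ℝ) : Measure (V n) :=
  ((volume : Measure (E n)).toSphere.withDensity
    fun θ => ENNReal.ofReal (sphereJac k x r θ)).map
      fun θ : Metric.sphere (0 : E n) 1 => sphereMap k x r θ

/-- `sin(√k r) / √k` (equal to `r` if `k = 0`). -/
def sn (k r : ℝ) : ℝ :=
  open Classical in
  if 0 < k then Real.sin (√k * r) / √k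
  else if k < 0 then Real.sinh (√(-k) * r) / √(-k) else r

/-- `cos(√k r)`. -/
def cs (k r : ℝ) : ℝ :=
  open Classical in
  if 0 < k then Real.cos (√k * r) else if k < 0 then Real.cosh (√(-k) * r) else 1

/-- The area `m_M(r) = |𝕊ⁿ⁻¹| (sin(√k r) / √k)ⁿ⁻¹`. -/
def area (n : ℕ) (k r : ℝ) : ℝ :=
  (volume : Measure (E n)).toSphere.real univ * sn k r ^ (n - 1)

/-- The interval `(0, diam M)`, where `diam M` is `π / √k` if `k > 0` and infinite otherwise. -/
def radii (k : ℝ) : Set ℝ := {r | 0 < r ∧ (0 < k → r < Real.pi / √k)}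

/-- `f ∈ C^∞_0((0, diam M))`. -/
def IsRadialTest (k : ℝ) (f : ℝ → ℂ) : Prop :=
  ContDiff ℝ ∞ f ∧ HasCompactSupport f ∧ tsupport f ⊆ radii k

/-- The radial operator
`T_M f = f'' + (n-1) √k cot(√k r) f' - k (n-1)/4 (sec²(√k r / 2) + n - 1) f`. -/
def T (n : ℕ) (k : ℝ) (f : ℝ → ℂ) (r : ℝ) : ℂ :=
  deriv (deriv f) r + (((n : ℝ) - 1) * (cs k r / sn k r)) • deriv f r
    - (k * ((n : ℝ) - 1) / 4 * (1 / cs k (r / 2) ^ 2 + ((n : ℝ) - 1))) • f r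

/-- The radial operator
`T̂_M f = f'' + (n-1) √k cot(√k r) f' - (n-1)/4 (k csc²(√k r / 2) + k (n - 1)) f`. -/
def That (n : ℕ) (k : ℝ) (f : ℝ → ℂ) (r : ℝ) : ℂ :=
  deriv (deriv f) r + (((n : ℝ) - 1) * (cs k r / sn k r)) • deriv f r
    - (((n : ℝ) - 1) / 4 * (1 / sn k (r / 2) ^ 2 + k * ((n : ℝ) - 1))) • f r

section Means

variable {n : ℕ} {S : Type*} [NormedAddCommGroup S] [NormedSpace ℂ S]

/-- The spherical mean `𝓜_r ψ`. -/
def mean (k : ℝ) (c : Cl n →ₐ[ℝ] Module.End ℂ S) (r : ℝ) (ψ : V n → S) (x : V n) : S :=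
  (1 / area n k r) • ∫ x' in gsphere k x r, transport k c x x' (ψ x') ∂(surfMeasure k x r)

/-- The spherical mean `𝓜̂_r ψ`. -/
def meanHat (k : ℝ) (c : Cl n →ₐ[ℝ] Module.End ℂ S) (r : ℝ) (ψ : V n → S) (x : V n) : S :=
  (1 / area n k r) • ∫ x' in gsphere k x r,
    cliff k c x (nu k x x') (transport k c x x' (ψ x')) ∂(surfMeasure k x r)

/-- `∫_0^∞ (f(r) 𝓜_r ψ + f̂(r) 𝓜̂_r ψ) dμ_M(r)` with `dμ_M(r) = m_M(r) dr`. -/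
def superpose (k : ℝ) (c : Cl n →ₐ[ℝ] Module.End ℂ S) (f fhat : ℝ → ℂ) (ψ : V n → S)
    (x : V n) : S :=
  ∫ r in Ioi (0 : ℝ), area n k r • (f r • mean k c r ψ x + fhat r • meanHat k c r ψ x)

end Means

end SpaceForm

end

open scoped ContDiff RealInnerProductSpace
open MeasureTheory Set

noncomputable section

namespace SpaceForm

/-! ## The functions `sn` and `cs` -/

/-! Let σ be a square root of -k (`sig`). The spinor bundle of the quadric has a global
trivialization `tau` by Killing spinors. In it, Clifford multiplication by a tangent vector X at x
becomes `rot c k X x`, an expression in the ambient coordinates that involves no frame (`tau_gam`),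
and ∇_X becomes ∂_X - (σ/2) rot(X,x) (`tau_covDeriv`). Hence D becomes ∑ rot(e_i,x) ∂_{e_i} - nσ/2
(`glob_dirac`).

Along a geodesic rot(γ',γ) is constant (`rot_geo`), so parallel transport is the exponential of a
constant operator whose square is scalar. With q = 4 sn(r/2)² the squared chord between x and x',
and R = rot(x,x'), which satisfies R² = q(1 - kq/4), transport and ν-multiplied transport become
polynomials in q and R up to scalar factors. Putting f = 2 cs(r/2) A(q) and f̂ = 2 sn(r/2) B(q)
absorbs these factors: the integrand is the kernel `ker`, A(q)(2 - kq/2 + σR) + B(q)(R + σq/2)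
(`glob_transport_ker`).

Summing over an orthonormal frame shows that D acts on kernels through their profiles, (A,B) ↦ (nB/2
+ qB', (4 - kq)A' - nkA/2) (`dirac_ker`). So D² acts on A and on B separately, and in the variable r
the two second order operators are T and T̂ (`T_eq`, `That_eq`).

To differentiate under the integral sign, the superposition is written as an integral against a
measure that does not depend on x: Lebesgue measure on the open solid cone over M with a radial
weight (`integral_cone`, `glob_superpose`). All x-dependence then sits in a smooth kernel with
locally uniform compact support, which gives smoothness as well as the formula for D
(`contDiffAt_kerInt`, `dirac_kerInt`).

The geometric objects in the definitions (distance, minimal geodesic, transport) are infima or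
choices. They are identified by solving the geodesic equation (`IsGeodesic.eq_geo`), by a lower
bound for the length of any curve (`arcsn_le_length`) and by solving the transport equation
(`transport_geo`). -/

lemma cs_zero (k : ℝ) : cs k 0 = 1 := by
  unfold cs; split_ifs <;> simp

lemma sn_zero (k : ℝ) : sn k 0 = 0 := by
  unfold sn; split_ifs <;> simp

lemma hasDerivAt_sn (k r : ℝ) : HasDerivAt (sn k) (cs k r) r := by
  rcases lt_trichotomy k 0 with hk | rfl | hk
  · have h : sn k = fun r => Real.sinh (√(-k) * r) / √(-k) := by
      funext r; simp [sn, hk, hk.le.not_gt]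
    have h0 : √(-k) ≠ 0 := (Real.sqrt_pos.2 (by linarith)).ne'
    rw [h]
    have := (((hasDerivAt_id r).const_mul (√(-k))).sinh).div_const (√(-k))
    refine this.congr_deriv ?_
    simp only [cs, hk, hk.le.not_gt, if_true, if_false, id, mul_one]; field_simp
  · have h : sn 0 = fun r => r := by funext r; simp [sn]
    rw [h]; exact (hasDerivAt_id r).congr_deriv (by simp [cs])
  · have h : sn k = fun r => Real.sin (√k * r) / √k := by
      funext r; simp [sn, hk]
    have h0 : √k ≠ 0 := (Real.sqrt_pos.2 hk).ne'
    rw [h]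
    have := (((hasDerivAt_id r).const_mul (√k)).sin).div_const (√k)
    refine this.congr_deriv ?_
    simp only [cs, hk, if_true, id, mul_one]; field_simp

lemma hasDerivAt_cs (k r : ℝ) : HasDerivAt (cs k) (-k * sn k r) r := by
  rcases lt_trichotomy k 0 with hk | rfl | hk
  · have h : cs k = fun r => Real.cosh (√(-k) * r) := by
      funext r; simp [cs, hk, hk.le.not_gt]
    have h0 : √(-k) ≠ 0 := (Real.sqrt_pos.2 (by linarith)).ne'
    have h1 : √(-k) * √(-k) = -k := Real.mul_self_sqrt (by linarith)
    rw [h]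
    have := ((hasDerivAt_id r).const_mul (√(-k))).cosh
    refine this.congr_deriv ?_
    simp only [sn, hk, hk.le.not_gt, if_true, if_false, id, mul_one]
    have h2 : -k * (Real.sinh (√(-k) * r) / √(-k)) = √(-k) * √(-k) * (Real.sinh (√(-k) * r) / √(-k)) := by
      rw [h1]
    rw [h2]; field_simp
  · have h : cs 0 = fun r => 1 := by funext r; simp [cs]
    rw [h]; simpa using hasDerivAt_const r (1 : ℝ)
  · have h : cs k = fun r => Real.cos (√k * r) := by
      funext r; simp [cs, hk]
    have h0 : √k ≠ 0 := (Real.sqrt_pos.2 hk).ne'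
    have h1 : √k * √k = k := Real.mul_self_sqrt hk.le
    rw [h]
    have := ((hasDerivAt_id r).const_mul (√k)).cos
    refine this.congr_deriv ?_
    simp only [sn, hk, if_true, id, mul_one]
    have h2 : -k * (Real.sin (√k * r) / √k) = -(√k * √k) * (Real.sin (√k * r) / √k) := by
      rw [h1]
    rw [h2]; field_simp

lemma cs_sq_add (k r : ℝ) : cs k r ^ 2 + k * sn k r ^ 2 = 1 := by
  rcases lt_trichotomy k 0 with hk | rfl | hk
  · have h1 : √(-k) ^ 2 = -k := Real.sq_sqrt (by linarith)
    have h2 : k ≠ 0 := hk.ne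
    simp only [cs, sn, hk, hk.le.not_gt, if_true, if_false, div_pow, h1]
    have := Real.cosh_sq (√(-k) * r)
    field_simp
    linarith
  · simp [cs, sn]
  · have h1 : √k ^ 2 = k := Real.sq_sqrt hk.le
    have h2 : k ≠ 0 := hk.ne'
    simp only [cs, sn, hk, if_true, div_pow, h1]
    field_simp
    exact Real.cos_sq_add_sin_sq _

lemma sn_eq_half (k r : ℝ) : sn k r = 2 * sn k (r / 2) * cs k (r / 2) := by
  rcases lt_trichotomy k 0 with hk | rfl | hk
  · simp only [cs, sn, hk, hk.le.not_gt, if_true, if_false]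
    rw [show √(-k) * r = 2 * (√(-k) * (r / 2)) by ring, Real.sinh_two_mul]; ring
  · simp [cs, sn]; ring
  · simp only [cs, sn, hk, if_true]
    rw [show √k * r = 2 * (√k * (r / 2)) by ring, Real.sin_two_mul]; ring

lemma cs_eq_half (k r : ℝ) : cs k r = 1 - 2 * k * sn k (r / 2) ^ 2 := by
  have h := cs_sq_add k (r / 2)
  have h3 : cs k r = cs k (r / 2) ^ 2 - k * sn k (r / 2) ^ 2 := by
    rcases lt_trichotomy k 0 with hk | rfl | hk
    · have h1 : √(-k) ^ 2 = -k := Real.sq_sqrt (by linarith)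
      have h2 : k ≠ 0 := hk.ne
      simp only [cs, sn, hk, hk.le.not_gt, if_true, if_false, div_pow, h1]
      rw [show √(-k) * r = 2 * (√(-k) * (r / 2)) by ring, Real.cosh_two_mul]; field_simp; ring
    · simp [cs]
    · have h1 : √k ^ 2 = k := Real.sq_sqrt hk.le
      have h2 : k ≠ 0 := hk.ne'
      simp only [cs, sn, hk, if_true, div_pow, h1]
      rw [show √k * r = 2 * (√k * (r / 2)) by ring, Real.cos_two_mul, Real.sin_sq]; field_simp; ring
  linarith

lemma contDiff_sn (k : ℝ) : ContDiff ℝ ∞ (sn k) := by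
  rcases lt_trichotomy k 0 with hk | rfl | hk
  · have h : sn k = fun r => Real.sinh (√(-k) * r) / √(-k) := by
      funext r; simp [sn, hk, hk.le.not_gt]
    rw [h]; fun_prop
  · have h : sn 0 = fun r => r := by funext r; simp [sn]
    rw [h]; fun_prop
  · have h : sn k = fun r => Real.sin (√k * r) / √k := by
      funext r; simp [sn, hk]
    rw [h]; fun_prop

lemma contDiff_cs (k : ℝ) : ContDiff ℝ ∞ (cs k) := by
  rcases lt_trichotomy k 0 with hk | rfl | hk
  · have h : cs k = fun r => Real.cosh (√(-k) * r) := by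
      funext r; simp [cs, hk, hk.le.not_gt]
    rw [h]; fun_prop
  · have h : cs 0 = fun r => 1 := by funext r; simp [cs]
    rw [h]; fun_prop
  · have h : cs k = fun r => Real.cos (√k * r) := by
      funext r; simp [cs, hk]
    rw [h]; fun_prop

lemma continuous_sn (k : ℝ) : Continuous (sn k) := (contDiff_sn k).continuous

/-- Rescaling the curvature. -/
lemma cs_rescale (k : ℝ) {a : ℝ} (ha : 0 < a) (s : ℝ) : cs (k * a ^ 2) s = cs k (a * s) := by
  have h : 0 < a ^ 2 := by positivity
  have hn : k * a ^ 2 < 0 ↔ k < 0 := ⟨fun h2 => by nlinarith, fun h2 => mul_neg_of_neg_of_pos h2 h⟩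
  have h' : √(k * a ^ 2) = √k * a := by
    rw [Real.sqrt_mul' _ h.le, Real.sqrt_sq ha.le]
  have h'' : √(-(k * a ^ 2)) = √(-k) * a := by
    rw [← neg_mul, Real.sqrt_mul' _ h.le, Real.sqrt_sq ha.le]
  simp only [cs, mul_pos_iff_of_pos_right h, hn, h', h'', mul_assoc]

/-- A geodesic of speed r obeys γ'' = -k r² γ, so it is written with parameter k r²; rescaling
returns to the functions of k. -/
lemma sn_rescale (k : ℝ) {a : ℝ} (ha : 0 < a) (s : ℝ) :
    sn (k * a ^ 2) s = sn k (a * s) / a := by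
  have h : 0 < a ^ 2 := by positivity
  have hn : k * a ^ 2 < 0 ↔ k < 0 := ⟨fun h2 => by nlinarith, fun h2 => mul_neg_of_neg_of_pos h2 h⟩
  have h' : √(k * a ^ 2) = √k * a := by
    rw [Real.sqrt_mul' _ h.le, Real.sqrt_sq ha.le]
  have h'' : √(-(k * a ^ 2)) = √(-k) * a := by
    rw [← neg_mul, Real.sqrt_mul' _ h.le, Real.sqrt_sq ha.le]
  simp only [sn, mul_pos_iff_of_pos_right h, hn, h', h'', mul_assoc]
  split_ifs
  · field_simp
  · field_simp
  · field_simp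

lemma sn_half_pos {k r : ℝ} (hr : r ∈ radii k) : 0 < sn k (r / 2) := by
  obtain ⟨h0, h1⟩ := hr
  rcases lt_trichotomy k 0 with hk | rfl | hk
  · have h2 : 0 < √(-k) := Real.sqrt_pos.2 (by linarith)
    simp only [sn, hk, hk.le.not_gt, if_true, if_false]
    have : 0 < Real.sinh (√(-k) * (r / 2)) := Real.sinh_pos_iff.2 (by positivity)
    positivity
  · simp [sn]; linarith
  · have h2 : 0 < √k := Real.sqrt_pos.2 hk
    have h3 := (lt_div_iff₀ h2).1 (h1 hk)
    simp only [sn, hk, if_true]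
    have : 0 < Real.sin (√k * (r / 2)) :=
      Real.sin_pos_of_pos_of_lt_pi (by positivity) (by nlinarith [Real.pi_pos])
    positivity

lemma cs_half_pos {k r : ℝ} (hr : r ∈ radii k) : 0 < cs k (r / 2) := by
  obtain ⟨h0, h1⟩ := hr
  rcases lt_trichotomy k 0 with hk | rfl | hk
  · simp only [cs, hk, hk.le.not_gt, if_true, if_false]
    exact Real.cosh_pos _
  · simp [cs]
  · have h2 : 0 < √k := Real.sqrt_pos.2 hk
    have h3 := (lt_div_iff₀ h2).1 (h1 hk)
    simp only [cs, hk, if_true]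
    have h4 : 0 < √k * (r / 2) := by positivity
    exact Real.cos_pos_of_mem_Ioo ⟨by linarith [Real.pi_pos], by nlinarith [Real.pi_pos]⟩

lemma sn_pos {k r : ℝ} (hr : r ∈ radii k) : 0 < sn k r := by
  rw [sn_eq_half]
  have := sn_half_pos hr
  have := cs_half_pos hr
  positivity

lemma isOpen_radii (k : ℝ) : IsOpen (radii k) := by
  by_cases hk : 0 < k
  · have : radii k = Ioo 0 (Real.pi / √k) := by ext r; simp [radii, hk]
    rw [this]; exact isOpen_Ioo
  · have : radii k = Ioi 0 := by ext r; simp [radii, hk]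
    rw [this]; exact isOpen_Ioi

/-! ## The inverse function of `sn` -/

/-- The inverse of `sn k`. -/
def arcsn (k z : ℝ) : ℝ :=
  open Classical in
  if 0 < k then Real.arcsin (√k * z) / √k
  else if k < 0 then Real.arsinh (√(-k) * z) / √(-k) else z

lemma continuous_arcsn (k : ℝ) : Continuous (arcsn k) := by
  rcases lt_trichotomy k 0 with hk | rfl | hk
  · have h : arcsn k = fun r => Real.arsinh (√(-k) * r) / √(-k) := by
      funext r; simp [arcsn, hk, hk.le.not_gt]
    rw [h]
    exact (Real.continuous_arsinh.comp (continuous_const.mul continuous_id)).div_const _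
  · have h : arcsn 0 = fun r => r := by funext r; simp [arcsn]
    rw [h]; fun_prop
  · have h : arcsn k = fun r => Real.arcsin (√k * r) / √k := by
      funext r; simp [arcsn, hk]
    rw [h]
    exact (Real.continuous_arcsin.comp (continuous_const.mul continuous_id)).div_const _

lemma arcsn_zero (k : ℝ) : arcsn k 0 = 0 := by
  unfold arcsn; split_ifs <;> simp

/-- The hypothesis is automatic for k ≤ 0; for k > 0 it keeps √k z away from the end points ±1 of
the arcsine. -/
lemma contDiffAt_arcsn {k z : ℝ} (hz : 0 < 1 - k * z ^ 2) : ContDiffAt ℝ ∞ (arcsn k) z := by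
  rcases lt_trichotomy k 0 with hk | rfl | hk
  · have h : arcsn k = fun r => Real.arsinh (√(-k) * r) / √(-k) := by
      funext r; simp [arcsn, hk, hk.le.not_gt]
    rw [h]
    exact ((contDiff_const.mul contDiff_id).arsinh.div_const _).contDiffAt
  · have h : arcsn 0 = fun r => r := by funext r; simp [arcsn]
    rw [h]; fun_prop
  · have h : arcsn k = fun r => Real.arcsin (√k * r) / √k := by
      funext r; simp [arcsn, hk]
    have h1 : √k ^ 2 = k := Real.sq_sqrt hk.le
    have h2 : (√k * z) ^ 2 < 1 := by rw [mul_pow, h1]; linarith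
    rw [h]
    refine ContDiffAt.div_const (ContDiffAt.comp z (g := Real.arcsin) (f := fun r => √k * r)
      (Real.contDiffAt_arcsin ?_ ?_) (by fun_prop)) _ <;> intro h3 <;> rw [h3] at h2 <;> norm_num at h2

lemma hasDerivAt_arcsn {k z : ℝ} (hz : 0 < 1 - k * z ^ 2) :
    HasDerivAt (arcsn k) (1 / √(1 - k * z ^ 2)) z := by
  rcases lt_trichotomy k 0 with hk | rfl | hk
  · have h : arcsn k = fun r => Real.arsinh (√(-k) * r) / √(-k) := by
      funext r; simp [arcsn, hk, hk.le.not_gt]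
    have h0 : √(-k) ≠ 0 := (Real.sqrt_pos.2 (by linarith)).ne'
    have h1 : √(-k) ^ 2 = -k := Real.sq_sqrt (by linarith)
    rw [h]
    have := (((hasDerivAt_id z).const_mul (√(-k))).arsinh).div_const (√(-k))
    refine this.congr_deriv ?_
    simp only [id, mul_pow, h1, mul_one, smul_eq_mul]
    rw [show 1 + -k * z ^ 2 = 1 - k * z ^ 2 by ring]
    have : √(1 - k * z ^ 2) ≠ 0 := (Real.sqrt_pos.2 hz).ne'
    field_simp
  · have h : arcsn 0 = fun r => r := by funext r; simp [arcsn]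
    rw [h]; exact (hasDerivAt_id z).congr_deriv (by simp)
  · have h : arcsn k = fun r => Real.arcsin (√k * r) / √k := by
      funext r; simp [arcsn, hk]
    have h0 : √k ≠ 0 := (Real.sqrt_pos.2 hk).ne'
    have h1 : √k ^ 2 = k := Real.sq_sqrt hk.le
    have h2 : (√k * z) ^ 2 < 1 := by rw [mul_pow, h1]; linarith
    rw [h]
    have h4 : HasDerivAt Real.arcsin (1 / √(1 - (√k * z) ^ 2)) (√k * z) := by
      apply Real.hasDerivAt_arcsin <;> intro h3 <;> rw [h3] at h2 <;> norm_num at h2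
    have := (h4.comp z ((hasDerivAt_id z).const_mul (√k))).div_const (√k)
    refine this.congr_deriv ?_
    rw [mul_pow, h1]
    have : √(1 - k * z ^ 2) ≠ 0 := (Real.sqrt_pos.2 hz).ne'
    field_simp

/-- The halving matters for k > 0: `sn k` increases only up to half the diameter, while r ↦ sn(r/2)
is injective on the whole range of radii. -/
lemma arcsn_sn_half {k r : ℝ} (h0 : 0 ≤ r) (h1 : 0 < k → r ≤ Real.pi / √k) :
    2 * arcsn k (sn k (r / 2)) = r := by
  rcases lt_trichotomy k 0 with hk | rfl | hk
  · have h0 : √(-k) ≠ 0 := (Real.sqrt_pos.2 (by linarith)).ne'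
    simp only [sn, arcsn, hk, hk.le.not_gt, if_true, if_false]
    rw [mul_div_cancel₀ _ h0, Real.arsinh_sinh]; field_simp
  · simp [sn, arcsn]; ring
  · have h2 : 0 < √k := Real.sqrt_pos.2 hk
    have h3 := (le_div_iff₀ h2).1 (h1 hk)
    simp only [sn, arcsn, hk, if_true]
    have h4 : 0 ≤ √k * (r / 2) := by positivity
    rw [mul_div_cancel₀ _ h2.ne', Real.arcsin_sin (by linarith [Real.pi_pos])
      (by nlinarith [Real.pi_pos])]
    field_simp

lemma sn_arcsn {k z : ℝ} (hz : 0 ≤ 1 - k * z ^ 2) : sn k (arcsn k z) = z := by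
  rcases lt_trichotomy k 0 with hk | rfl | hk
  · have h0 : √(-k) ≠ 0 := (Real.sqrt_pos.2 (by linarith)).ne'
    simp only [sn, arcsn, hk, hk.le.not_gt, if_true, if_false]
    rw [mul_div_cancel₀ _ h0, Real.sinh_arsinh]; field_simp
  · simp [sn, arcsn]
  · have h0 : √k ≠ 0 := (Real.sqrt_pos.2 hk).ne'
    have h1 : √k ^ 2 = k := Real.sq_sqrt hk.le
    have h2 : (√k * z) ^ 2 ≤ 1 := by rw [mul_pow, h1]; linarith
    have h3 := abs_le.1 ((sq_le_one_iff_abs_le_one _).1 h2)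
    simp only [sn, arcsn, hk, if_true]
    rw [mul_div_cancel₀ _ h0, Real.sin_arcsin h3.1 h3.2]; field_simp

lemma two_arcsn_mem_radii {k z : ℝ} (h0 : 0 < z) (hz : 0 < 1 - k * z ^ 2) :
    2 * arcsn k z ∈ radii k := by
  rcases lt_trichotomy k 0 with hk | rfl | hk
  · have h1 : 0 < √(-k) := Real.sqrt_pos.2 (by linarith)
    refine ⟨?_, fun h => absurd h hk.le.not_gt⟩
    simp only [arcsn, hk, hk.le.not_gt, if_true, if_false]
    have : 0 < Real.arsinh (√(-k) * z) := Real.arsinh_pos_iff.2 (by positivity)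
    positivity
  · refine ⟨?_, fun h => absurd h (lt_irrefl _)⟩
    simp [arcsn, h0]
  · have h3 : 0 < √k := Real.sqrt_pos.2 hk
    have h1 : √k ^ 2 = k := Real.sq_sqrt hk.le
    have h2 : (√k * z) ^ 2 < 1 := by rw [mul_pow, h1]; linarith
    have h4 := abs_lt.1 ((sq_lt_one_iff_abs_lt_one _).1 h2)
    have h5 : 0 < Real.arcsin (√k * z) := Real.arcsin_pos.2 (by positivity)
    have h6 : Real.arcsin (√k * z) < Real.pi / 2 := Real.arcsin_lt_pi_div_two.2 h4.2
    simp only [radii, arcsn, hk, if_true, mem_ofPred_eq]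
    refine ⟨by positivity, fun _ => ?_⟩
    rw [lt_div_iff₀ h3]
    field_simp
    linarith

/-- If `q` is out of the range of `r ↦ 4 sn(r/2)²` then `2 arcsn(√q/2)` is not in `radii`. -/
lemma of_two_arcsn_mem_radii {k q : ℝ} (h : 2 * arcsn k (√q / 2) ∈ radii k) :
    0 < q ∧ 0 < 4 - k * q := by
  have hq : 0 < q := by
    by_contra hq
    rw [Real.sqrt_eq_zero'.2 (not_lt.1 hq), zero_div, arcsn_zero] at h
    exact absurd h.1 (by simp)
  refine ⟨hq, ?_⟩
  by_contra h1
  have hk : 0 < k := by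
    by_contra hk
    nlinarith
  have h2 := h.2 hk
  have h3 : 0 < √k := Real.sqrt_pos.2 hk
  have h4 : 1 ≤ √k * (√q / 2) := by
    have h5 : √k * √q = √(k * q) := (Real.sqrt_mul hk.le q).symm
    have h6 : 2 ≤ √(k * q) := Real.le_sqrt_of_sq_le (by linarith)
    linarith
  rw [lt_div_iff₀ h3] at h2
  -- Beyond 1 the arcsine is constantly π/2, so the radius would be exactly π/√k, which `radii`
  -- excludes.
  simp only [arcsn, hk, if_true, Real.arcsin_of_one_le h4] at h2
  field_simp at h2
  exact absurd h2 (lt_irrefl _)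

section

variable {n : ℕ} {k : ℝ}

/-! ## The ambient bilinear form -/

/-- The bilinear form of the hyperquadric. -/
def bil (k : ℝ) (p q : V n) : ℝ := p.1 * q.1 + k * ⟪p.2, q.2⟫

lemma bil_comm (p q : V n) : bil k p q = bil k q p := by
  simp only [bil, real_inner_comm p.2 q.2]; ring

lemma bil_add_left (p p' q : V n) : bil k (p + p') q = bil k p q + bil k p' q := by
  simp only [bil, Prod.fst_add, Prod.snd_add, inner_add_left]; ring

lemma bil_smul_left (a : ℝ) (p q : V n) : bil k (a • p) q = a * bil k p q := by
  simp only [bil, Prod.smul_fst, Prod.smul_snd, real_inner_smul_left, smul_eq_mul]; ring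

lemma bil_add_right (p q q' : V n) : bil k p (q + q') = bil k p q + bil k p q' := by
  rw [bil_comm, bil_add_left, bil_comm q, bil_comm q']

lemma bil_smul_right (a : ℝ) (p q : V n) : bil k p (a • q) = a * bil k p q := by
  rw [bil_comm, bil_smul_left, bil_comm q]

lemma bil_neg_left (p q : V n) : bil k (-p) q = -bil k p q := by
  rw [← neg_one_smul ℝ, bil_smul_left]; ring

lemma bil_sub_left (p p' q : V n) : bil k (p - p') q = bil k p q - bil k p' q := by
  rw [sub_eq_add_neg, bil_add_left, bil_neg_left]; ring

lemma bil_sub_right (p q q' : V n) : bil k p (q - q') = bil k p q - bil k p q' := by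
  rw [bil_comm, bil_sub_left, bil_comm q, bil_comm q']

lemma metric_comm (p q : V n) : metric k p q = metric k q p := by
  simp only [metric, real_inner_comm p.2 q.2]; ring

lemma metric_add_left (p p' q : V n) : metric k (p + p') q = metric k p q + metric k p' q := by
  simp only [metric, Prod.fst_add, Prod.snd_add, inner_add_left]; ring

lemma metric_smul_left (a : ℝ) (p q : V n) : metric k (a • p) q = a * metric k p q := by
  simp only [metric, Prod.smul_fst, Prod.smul_snd, real_inner_smul_left, smul_eq_mul]; ring

lemma metric_add_right (p q q' : V n) : metric k p (q + q') = metric k p q + metric k p q' := by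
  rw [metric_comm, metric_add_left, metric_comm q, metric_comm q']

lemma metric_smul_right (a : ℝ) (p q : V n) : metric k p (a • q) = a * metric k p q := by
  rw [metric_comm, metric_smul_left, metric_comm q]

lemma metric_neg_left (p q : V n) : metric k (-p) q = -metric k p q := by
  rw [← neg_one_smul ℝ, metric_smul_left]; ring

lemma metric_sub_left (p p' q : V n) : metric k (p - p') q = metric k p q - metric k p' q := by
  rw [sub_eq_add_neg, metric_add_left, metric_neg_left]; ring

lemma metric_sub_right (p q q' : V n) : metric k p (q - q') = metric k p q - metric k p q' := by
  rw [metric_comm, metric_sub_left, metric_comm q, metric_comm q']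

lemma mul_metric (hk : k ≠ 0) (p q : V n) : k * metric k p q = bil k p q := by
  simp only [metric, bil]; field_simp

lemma mem_tangent {x v : V n} : v ∈ tangent k x ↔ bil k x v = 0 := Iff.rfl

lemma bil_self_of_mem {x : V n} (hx : x ∈ M n k) : bil k x x = 1 := by
  have := hx.1
  simp only [bil, real_inner_self_eq_norm_sq]; linarith

lemma mem_M_iff {x : V n} : x ∈ M n k ↔ bil k x x = 1 ∧ (k ≤ 0 → 0 < x.1) := by
  simp only [bil, real_inner_self_eq_norm_sq, M, mem_ofPred_eq, sq]

lemma fst_eq_one {x : V n} (hx : x ∈ M n 0) : x.1 = 1 := by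
  have h1 := hx.1
  have h2 := hx.2 le_rfl
  nlinarith

lemma fst_eq_zero {x v : V n} (hx : x ∈ M n 0) (hv : v ∈ tangent 0 x) : v.1 = 0 := by
  have h := mem_tangent.1 hv
  simpa [bil, fst_eq_one hx] using h

/-- On tangent vectors the ambient form is `k` times the metric. -/
lemma mul_metric_tangent {x v : V n} (hx : x ∈ M n k) (hv : v ∈ tangent k x) (w : V n) :
    k * metric k v w = bil k v w := by
  by_cases hk : k = 0
  · subst hk; simp [bil, fst_eq_zero hx hv]
  · exact mul_metric hk v w

lemma mul_metric_self_tangent {x v : V n} (hx : x ∈ M n k) (hv : v ∈ tangent k x) :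
    k * metric k x v = 0 := by
  by_cases hk : k = 0
  · subst hk; simp
  · rw [mul_metric hk]; exact hv

lemma smul_mem_tangent {x v : V n} (a : ℝ) (hv : v ∈ tangent k x) : a • v ∈ tangent k x := by
  rw [mem_tangent] at *; rw [bil_smul_right, hv, mul_zero]

/-- The square of the chordal distance. -/
def chord (k : ℝ) (x x' : V n) : ℝ := metric k (x - x') (x - x')

/-- For k ≠ 0 this is polarization of `bil`, which equals 1 on the diagonal of M. For k = 0 both
sides are 1, and `chord` cannot be recovered from `bil`; this is why the flat case is split off
repeatedly. -/
lemma bil_eq_chord {x x' : V n} (hx : x ∈ M n k) (hx' : x' ∈ M n k) :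
    bil k x x' = 1 - k * chord k x x' / 2 := by
  by_cases hk : k = 0
  · subst hk; simp [bil, fst_eq_one hx, fst_eq_one hx']
  · rw [chord, mul_metric hk, bil_sub_left, bil_sub_right, bil_sub_right,
      bil_self_of_mem hx, bil_self_of_mem hx', bil_comm x' x]
    ring

/-! ## The orthonormal frames -/

lemma norm_firstVec (hn : 1 ≤ n) : ‖firstVec n‖ = 1 := by
  have h : firstVec n = EuclideanSpace.single (⟨0, hn⟩ : Fin n) (1 : ℝ) := by
    ext i
    simp [firstVec, Fin.ext_iff]
  rw [h]; simp

lemma inner_flip_flip (hn : 1 ≤ n) (v w : E n) : ⟪flip v, flip w⟫ = ⟪v, w⟫ := by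
  have h : ⟪firstVec n, firstVec n⟫ = (1 : ℝ) := by
    rw [real_inner_self_eq_norm_sq, norm_firstVec hn, one_pow]
  simp only [flip, inner_sub_left, inner_sub_right, real_inner_smul_left, real_inner_smul_right, h,
    real_inner_comm (firstVec n) v]
  ring

lemma flip_flip (hn : 1 ≤ n) (v : E n) : flip (flip v) = v := by
  have h : ⟪firstVec n, firstVec n⟫ = (1 : ℝ) := by
    rw [real_inner_self_eq_norm_sq, norm_firstVec hn, one_pow]
  simp only [flip, inner_sub_right, real_inner_smul_right, h]
  module

lemma flip_add (v w : E n) : flip (v + w) = flip v + flip w := by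
  simp only [flip, inner_add_right]; module

lemma flip_smul (a : ℝ) (v : E n) : flip (a • v) = a • flip v := by
  simp only [flip, real_inner_smul_right]; module

/-- Statements about the south frame are reduced to the north frame at the antipode -p. For this
reason the north lemmas assume only `bil k p p = 1` and `-1 < p.1`, not membership in M. -/
lemma frame_south (p : V n) (v : E n) : frame k .south p v = frame k .north (-p) (flip v) := by
  simp only [frame, Prod.snd_neg, Prod.fst_neg, inner_neg_left]
  refine Prod.ext (by simp) ?_
  simp only [smul_neg, mul_neg, neg_div, neg_smul, neg_neg, sub_eq_add_neg]

lemma frame_add (α : Chart) (p : V n) (v w : E n) :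
    frame k α p (v + w) = frame k α p v + frame k α p w := by
  have h (p : V n) (v w : E n) :
      frame k .north p (v + w) = frame k .north p v + frame k .north p w := by
    simp only [frame, inner_add_right]
    refine Prod.ext (by simp; ring) ?_
    simp only [Prod.snd_add]; module
  cases α
  · exact h p v w
  · simp only [frame_south, flip_add, h]

lemma frame_smul (α : Chart) (p : V n) (a : ℝ) (v : E n) :
    frame k α p (a • v) = a • frame k α p v := by
  have h (p : V n) (v : E n) : frame k .north p (a • v) = a • frame k .north p v := by
    simp only [frame, real_inner_smul_right]
    refine Prod.ext (by simp; ring) ?_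
    simp only [Prod.smul_snd]; module
  cases α
  · exact h p v
  · simp only [frame_south, flip_smul, h]

/-- The frame as a linear map. -/
def frameL (k : ℝ) (α : Chart) (p : V n) : E n →L[ℝ] V n :=
  LinearMap.toContinuousLinearMap
    { toFun := frame k α p, map_add' := frame_add α p, map_smul' := frame_smul α p }

@[simp] lemma frameL_apply (α : Chart) (p : V n) (v : E n) : frameL k α p v = frame k α p v := rfl

lemma frame_north_tangent {p : V n} (hp : bil k p p = 1) (ht : -1 < p.1) (v : E n) :
    bil k p (frame k .north p v) = 0 := by
  have h : (1 : ℝ) + p.1 ≠ 0 := by linarith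
  simp only [bil] at hp
  simp only [bil, frame, inner_sub_right, real_inner_smul_right]
  field_simp
  linear_combination -(k * ⟪p.2, v⟫) * hp

lemma metric_frame_north {p : V n} (hp : bil k p p = 1) (ht : -1 < p.1) (v w : E n) :
    metric k (frame k .north p v) (frame k .north p w) = ⟪v, w⟫ := by
  have h : (1 : ℝ) + p.1 ≠ 0 := by linarith
  simp only [bil] at hp
  simp only [metric, frame, inner_sub_right, inner_sub_left, real_inner_smul_right,
    real_inner_smul_left, real_inner_comm p.2 v]
  rw [show -(k * ⟪p.2, v⟫) * -(k * ⟪p.2, w⟫) / k = k * (⟪p.2, v⟫ * ⟪p.2, w⟫) by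
    by_cases hk : k = 0
    · simp [hk]
    · field_simp]
  field_simp
  linear_combination (k * ⟪p.2, v⟫ * ⟪p.2, w⟫) * hp

/-- The preimage is forced: the first component of the frame gives -k⟪y,v⟫ = X.1, and then the
second one determines v. -/
lemma exists_frame_north {p : V n} (hp : bil k p p = 1) (ht : -1 < p.1) {X : V n}
    (hX : bil k p X = 0) : frame k .north p (X.2 - (X.1 / (1 + p.1)) • p.2) = X := by
  have h : (1 : ℝ) + p.1 ≠ 0 := by linarith
  simp only [bil] at hp hX
  have h2 : -(k * ⟪p.2, X.2 - (X.1 / (1 + p.1)) • p.2⟫) = X.1 := by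
    simp only [inner_sub_right, real_inner_smul_right]
    field_simp
    linear_combination -(1 + p.1) * hX + X.1 * hp
  refine Prod.ext h2 ?_
  simp only [frame]
  rw [neg_eq_iff_eq_neg.1 h2, neg_div]
  module

lemma bil_self_neg {p : V n} (hp : bil k p p = 1) : bil k (-p) (-p) = 1 := by
  simpa [bil] using hp

lemma frame_mem_tangent {α : Chart} {p : V n} (hp : p ∈ chartDomain n k α) (v : E n) :
    frame k α p v ∈ tangent k p := by
  rw [mem_tangent]
  cases α
  · exact frame_north_tangent (bil_self_of_mem hp.1) hp.2 v
  · rw [frame_south]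
    have := frame_north_tangent (bil_self_neg (bil_self_of_mem hp.1))
      (by simpa using hp.2 : -1 < (-p).1) (flip v)
    rw [bil_neg_left] at this
    linarith

lemma metric_frame (hn : 1 ≤ n) {α : Chart} {p : V n} (hp : p ∈ chartDomain n k α) (v w : E n) :
    metric k (frame k α p v) (frame k α p w) = ⟪v, w⟫ := by
  cases α
  · exact metric_frame_north (bil_self_of_mem hp.1) hp.2 v w
  · rw [frame_south, frame_south, metric_frame_north (bil_self_neg (bil_self_of_mem hp.1))
      (by simpa using hp.2 : -1 < (-p).1), inner_flip_flip hn]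

lemma exists_frame_eq (hn : 1 ≤ n) {α : Chart} {p X : V n} (hp : p ∈ chartDomain n k α)
    (hX : X ∈ tangent k p) : ∃ v, frame k α p v = X := by
  rw [mem_tangent] at hX
  cases α
  · exact ⟨_, exists_frame_north (bil_self_of_mem hp.1) hp.2 hX⟩
  · refine ⟨flip (X.2 - (X.1 / (1 + (-p).1)) • (-p).2), ?_⟩
    · rw [frame_south, flip_flip hn, exists_frame_north (bil_self_neg (bil_self_of_mem hp.1))
        (by simpa using hp.2 : -1 < (-p).1) (by rw [bil_neg_left, hX, neg_zero])]

lemma mem_chartDomain_chartAt {p : V n} (hp : p ∈ M n k) : p ∈ chartDomain n k (chartAt p) := by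
  by_cases h : -1 < p.1
  · simp only [chartAt, h, if_true]; exact ⟨hp, h⟩
  · simp only [chartAt, h, if_false]; exact ⟨hp, by linarith [not_lt.1 h]⟩

lemma mem_M_of_mem_chartDomain {α : Chart} {p : V n} (hp : p ∈ chartDomain n k α) : p ∈ M n k := by
  cases α <;> exact hp.1

/-- The metric is positive definite on tangent vectors. -/
lemma metric_self_nonneg (hn : 1 ≤ n) {p X : V n} (hp : p ∈ M n k) (hX : X ∈ tangent k p) :
    0 ≤ metric k X X := by
  obtain ⟨v, rfl⟩ := exists_frame_eq hn (mem_chartDomain_chartAt hp) hX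
  rw [metric_frame hn (mem_chartDomain_chartAt hp)]
  exact real_inner_self_nonneg

lemma eq_zero_of_metric_self (hn : 1 ≤ n) {p X : V n} (hp : p ∈ M n k) (hX : X ∈ tangent k p)
    (h : metric k X X = 0) : X = 0 := by
  obtain ⟨v, rfl⟩ := exists_frame_eq hn (mem_chartDomain_chartAt hp) hX
  rw [metric_frame hn (mem_chartDomain_chartAt hp), inner_self_eq_zero] at h
  rw [h, ← frameL_apply, map_zero]

/-- The Cauchy–Schwarz inequality in a tangent space. -/
lemma metric_sq_le (hn : 1 ≤ n) {p X Y : V n} (hp : p ∈ M n k) (hX : X ∈ tangent k p)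
    (hY : Y ∈ tangent k p) : metric k X Y ^ 2 ≤ metric k X X * metric k Y Y := by
  obtain ⟨v, rfl⟩ := exists_frame_eq hn (mem_chartDomain_chartAt hp) hX
  obtain ⟨w, rfl⟩ := exists_frame_eq hn (mem_chartDomain_chartAt hp) hY
  simp only [metric_frame hn (mem_chartDomain_chartAt hp)]
  rw [sq]
  exact real_inner_mul_inner_self_le v w

/-- The expansion of a tangent vector in the frame. -/
lemma sum_metric_smul_frame (hn : 1 ≤ n) {α : Chart} {p X : V n} (hp : p ∈ chartDomain n k α)
    (hX : X ∈ tangent k p) :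
    ∑ i, metric k (frame k α p (basisVec i)) X • frame k α p (basisVec i) = X := by
  obtain ⟨v, rfl⟩ := exists_frame_eq hn hp hX
  simp only [metric_frame hn hp]
  simp only [← frameL_apply, ← map_smul, ← map_sum]
  congr 1
  have := (EuclideanSpace.basisFun (Fin n) ℝ).sum_repr' v
  simpa [basisVec] using this

/-- The tangential part of the chord at its first end point. -/
lemma chord_tangent {x x' : V n} (hx : x ∈ M n k) (hx' : x' ∈ M n k) :
    (x - x') - (k * chord k x x' / 2) • x ∈ tangent k x := by
  rw [mem_tangent, bil_sub_right, bil_smul_right, bil_sub_right, bil_self_of_mem hx,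
    bil_eq_chord hx hx']
  ring

lemma mul_metric_chord {x x' : V n} (hx : x ∈ M n k) (hx' : x' ∈ M n k) :
    k * metric k x (x - x') = k * chord k x x' / 2 := by
  by_cases hk : k = 0
  · simp [hk]
  · rw [mul_metric hk, bil_sub_right, bil_self_of_mem hx, bil_eq_chord hx hx']
    ring

/-- In terms of the distance r this is 4 sn(r/2)² cs(r/2)² = sn(r)². -/
lemma metric_chord_tangent {x x' : V n} (hx : x ∈ M n k) (hx' : x' ∈ M n k) :
    metric k ((x - x') - (k * chord k x x' / 2) • x) ((x - x') - (k * chord k x x' / 2) • x) =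
      chord k x x' * (1 - k * chord k x x' / 4) := by
  have h1 := mul_metric_chord hx hx'
  have h2 : k * (k * metric k x x) = k := by
    by_cases hk : k = 0
    · simp [hk]
    · rw [mul_metric hk, bil_self_of_mem hx, mul_one]
  have h3 : metric k (x - x') (x - x') = chord k x x' := rfl
  generalize x - x' = d at *
  rw [metric_sub_left, metric_sub_right, metric_sub_right, metric_smul_left, metric_smul_left,
    metric_smul_right, metric_smul_right, metric_comm d x, h3]
  linear_combination -(chord k x x') * h1 + chord k x x' ^ 2 / 4 * h2

/-- Reverse Cauchy–Schwarz inequality on the upper sheet of the hyperboloid. -/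
lemma bil_pos_of_nonpos {x x' : V n} (hk : k ≤ 0) (hx : x ∈ M n k) (hx' : x' ∈ M n k) :
    0 < bil k x x' := by
  have h1 := hx.2 hk
  have h2 := hx'.2 hk
  have h3 := hx.1
  have h4 := hx'.1
  have h5 := real_inner_le_norm x.2 x'.2
  have h6 : -k * (‖x.2‖ * ‖x'.2‖) < x.1 * x'.1 := by
    apply lt_of_pow_lt_pow_left₀ 2 (by positivity)
    have e : (x.1 * x'.1) ^ 2 = (1 - k * ‖x.2‖ ^ 2) * (1 - k * ‖x'.2‖ ^ 2) := by
      rw [mul_pow]; congr 1 <;> linarith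
    rw [e]
    have : 0 ≤ -k * ‖x.2‖ ^ 2 := by nlinarith [sq_nonneg ‖x.2‖]
    have : 0 ≤ -k * ‖x'.2‖ ^ 2 := by nlinarith [sq_nonneg ‖x'.2‖]
    nlinarith
  have h7 : -k * ⟪x.2, x'.2⟫ ≤ -k * (‖x.2‖ * ‖x'.2‖) :=
    mul_le_mul_of_nonneg_left h5 (by linarith)
  simp only [bil]
  linarith

/-- For k > 0 the ambient form is positive. For k ≤ 0 the chord need not be tangent, so positivity
is read off from its tangential part: q(1 - kq/4) ≥ 0 and 1 - kq/2 > 0 together exclude q < 0. -/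
lemma chord_nonneg (hn : 1 ≤ n) {x x' : V n} (hx : x ∈ M n k) (hx' : x' ∈ M n k) :
    0 ≤ chord k x x' := by
  have h1 := metric_self_nonneg hn hx (chord_tangent hx hx')
  rw [metric_chord_tangent hx hx'] at h1
  rcases lt_or_ge 0 k with hk | hk
  · have : 0 ≤ ⟪(x - x').2, (x - x').2⟫ := real_inner_self_nonneg
    unfold chord metric
    have : 0 ≤ (x - x').1 * (x - x').1 / k := by
      have := mul_self_nonneg (x - x').1
      positivity
    linarith
  · have h2 := bil_pos_of_nonpos hk hx hx'
    rw [bil_eq_chord hx hx'] at h2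
    by_contra h3
    nlinarith

lemma chord_le (hn : 1 ≤ n) {x x' : V n} (hx : x ∈ M n k) (hx' : x' ∈ M n k) :
    0 ≤ 1 - k * chord k x x' / 4 := by
  have h1 := metric_self_nonneg hn hx (chord_tangent hx hx')
  rw [metric_chord_tangent hx hx'] at h1
  rcases (chord_nonneg hn hx hx').eq_or_lt with h | h
  · rw [← h]; norm_num
  · exact nonneg_of_mul_nonneg_right h1 h

/-! ## Geodesics -/

lemma hasDerivAt_fst {γ : ℝ → V n} {γ' : V n} {s : ℝ} (hγ : HasDerivAt γ γ' s) :
    HasDerivAt (fun s => (γ s).1) γ'.1 s :=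
  (ContinuousLinearMap.fst ℝ ℝ (E n)).hasFDerivAt.comp_hasDerivAt s hγ

lemma hasDerivAt_snd {γ : ℝ → V n} {γ' : V n} {s : ℝ} (hγ : HasDerivAt γ γ' s) :
    HasDerivAt (fun s => (γ s).2) γ'.2 s :=
  (ContinuousLinearMap.snd ℝ ℝ (E n)).hasFDerivAt.comp_hasDerivAt s hγ

lemma hasDerivAt_bil {γ δ : ℝ → V n} {γ' δ' : V n} {s : ℝ} (hγ : HasDerivAt γ γ' s)
    (hδ : HasDerivAt δ δ' s) :
    HasDerivAt (fun s => bil k (γ s) (δ s)) (bil k γ' (δ s) + bil k (γ s) δ') s := by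
  have h := ((hasDerivAt_fst hγ).mul (hasDerivAt_fst hδ)).add (((hasDerivAt_snd hγ).inner ℝ (hasDerivAt_snd hδ)).const_mul k)
  refine h.congr_deriv ?_
  simp only [bil]; ring

lemma hasDerivAt_metric {γ δ : ℝ → V n} {γ' δ' : V n} {s : ℝ} (hγ : HasDerivAt γ γ' s)
    (hδ : HasDerivAt δ δ' s) :
    HasDerivAt (fun s => metric k (γ s) (δ s)) (metric k γ' (δ s) + metric k (γ s) δ') s := by
  have h := (((hasDerivAt_fst hγ).mul (hasDerivAt_fst hδ)).div_const k).add ((hasDerivAt_snd hγ).inner ℝ (hasDerivAt_snd hδ))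
  refine h.congr_deriv ?_
  simp only [metric]; ring

/-- The geodesic with initial point `x` and initial velocity `v`. -/
def geo (k : ℝ) (x v : V n) (s : ℝ) : V n := cs (bil k v v) s • x + sn (bil k v v) s • v

lemma geo_zero (x v : V n) : geo k x v 0 = x := by simp [geo, cs_zero, sn_zero]

lemma hasDerivAt_geo (x v : V n) (s : ℝ) : HasDerivAt (geo k x v)
    ((-bil k v v * sn (bil k v v) s) • x + cs (bil k v v) s • v) s :=
  ((hasDerivAt_cs _ s).smul_const x).add ((hasDerivAt_sn _ s).smul_const v)

lemma hasDerivAt_geo_zero (x v : V n) : HasDerivAt (geo k x v) v 0 :=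
  (hasDerivAt_geo x v 0).congr_deriv (by simp [sn_zero, cs_zero])

lemma deriv_geo (x v : V n) : deriv (geo k x v) =
    fun s => (-bil k v v * sn (bil k v v) s) • x + cs (bil k v v) s • v :=
  funext fun s => (hasDerivAt_geo x v s).deriv

lemma deriv_deriv_geo (x v : V n) (s : ℝ) :
    deriv (deriv (geo k x v)) s = -bil k v v • geo k x v s := by
  rw [deriv_geo]
  have h := (((hasDerivAt_sn (bil k v v) s).const_mul (-bil k v v)).smul_const x).add
    ((hasDerivAt_cs (bil k v v) s).smul_const v)
  refine h.deriv.trans ?_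
  simp only [geo]; module

lemma contDiff_geo (x v : V n) : ContDiff ℝ ∞ (geo k x v) :=
  ((contDiff_cs _).smul contDiff_const).add ((contDiff_sn _).smul contDiff_const)

lemma geo_mem {x v : V n} (hx : x ∈ M n k) (hv : v ∈ tangent k x) (s : ℝ) :
    geo k x v s ∈ M n k := by
  have key (s : ℝ) : bil k (geo k x v s) (geo k x v s) = 1 := by
    rw [mem_tangent] at hv
    simp only [geo, bil_add_left, bil_add_right, bil_smul_left, bil_smul_right,
      bil_self_of_mem hx, bil_comm v x, hv]
    linear_combination cs_sq_add (bil k v v) s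
  refine mem_M_iff.2 ⟨key s, fun hk => ?_⟩
  by_contra hs
  have hc : Continuous fun s => (geo k x v s).1 := (contDiff_geo x v).continuous.fst
  -- To leave the upper sheet the curve would have to cross t = 0, where for k ≤ 0 the quadratic
  -- form is nonpositive instead of 1.
  obtain ⟨a, ha⟩ := mem_range_of_exists_le_of_exists_ge hc ⟨s, not_lt.1 hs⟩
    ⟨0, by rw [geo_zero]; exact (hx.2 hk).le⟩
  have h := key a
  simp only at ha
  simp only [bil, ha, real_inner_self_eq_norm_sq] at h
  nlinarith [sq_nonneg ‖(geo k x v a).2‖]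

lemma deriv_mem_tangent {γ : ℝ → V n} {γ' : V n} {s : ℝ} (h : HasDerivAt γ γ' s)
    (hM : ∀ᶠ t in nhds s, γ t ∈ M n k) : γ' ∈ tangent k (γ s) := by
  have h1 := hasDerivAt_bil (k := k) h h
  have h2 : (fun s => bil k (γ s) (γ s)) =ᶠ[nhds s] fun _ => 1 :=
    hM.mono fun t ht => bil_self_of_mem ht
  have h3 := h1.unique ((hasDerivAt_const s (1 : ℝ)).congr_of_eventuallyEq h2)
  rw [bil_comm γ'] at h3
  rw [mem_tangent]; linarith

lemma bil_mul_metric {x v w : V n} (hx : x ∈ M n k) (hv : v ∈ tangent k x)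
    {p : V n} (hw : bil k p w = 0) : bil k v v * metric k p w = 0 := by
  by_cases hk : k = 0
  · subst hk; simp [bil, fst_eq_zero hx hv]
  · have : metric k p w = 0 := by
      have := mul_metric hk p w
      rw [hw] at this
      exact (mul_eq_zero.1 this).resolve_left hk
    rw [this, mul_zero]

lemma isGeodesic_geo {x v : V n} (hx : x ∈ M n k) (hv : v ∈ tangent k x) :
    IsGeodesic k (geo k x v) := by
  refine ⟨contDiff_geo x v, geo_mem hx hv, fun s w hw => ?_⟩
  rw [deriv_deriv_geo, metric_smul_left, neg_mul, bil_mul_metric hx hv hw, neg_zero]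

/-- Geodesics are determined by their initial point and velocity. -/
lemma IsGeodesic.eq_geo (hn : 1 ≤ n) {γ : ℝ → V n} (h : IsGeodesic k γ) :
    deriv γ 0 ∈ tangent k (γ 0) ∧ γ = geo k (γ 0) (deriv γ 0) := by
  obtain ⟨hs, hM, hg⟩ := h
  have hd (s : ℝ) : HasDerivAt γ (deriv γ s) s :=
    ((hs.differentiable (by simp)) s).hasDerivAt
  have hs' : ContDiff ℝ ∞ (deriv γ) := ((contDiff_infty_iff_deriv (𝕜 := ℝ)).1 hs).2
  have hd' (s : ℝ) : HasDerivAt (deriv γ) (deriv (deriv γ) s) s :=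
    ((hs'.differentiable (by simp)) s).hasDerivAt
  have ht (s : ℝ) : deriv γ s ∈ tangent k (γ s) :=
    deriv_mem_tangent (hd s) (Filter.Eventually.of_forall hM)
  have h2 (s : ℝ) : bil k (γ s) (deriv (deriv γ) s) = -bil k (deriv γ s) (deriv γ s) := by
    have h3 := hasDerivAt_bil (k := k) (hd s) (hd' s)
    have h4 : (fun s => bil k (γ s) (deriv γ s)) = fun _ => 0 := funext fun t => ht t
    rw [h4] at h3
    have := h3.unique (hasDerivAt_const s (0 : ℝ))
    linarith
  have h3 (s : ℝ) : deriv (deriv γ) s = -bil k (deriv γ s) (deriv γ s) • γ s := by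
    -- The acceleration plus this multiple of the position is tangent; it is also orthogonal to
    -- itself by the geodesic equation, hence zero.
    have hw : deriv (deriv γ) s + bil k (deriv γ s) (deriv γ s) • γ s ∈ tangent k (γ s) := by
      rw [mem_tangent, bil_add_right, bil_smul_right, h2, bil_self_of_mem (hM s)]; ring
    have := eq_zero_of_metric_self hn (hM s) hw (by
      rw [metric_add_left, hg s _ hw, metric_smul_left, bil_mul_metric (hM s) (ht s) hw, add_zero])
    rw [neg_smul]
    exact eq_neg_of_add_eq_zero_left this
  have h4 (s : ℝ) : bil k (deriv γ s) (deriv γ s) = bil k (deriv γ 0) (deriv γ 0) := by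
    refine is_const_of_deriv_eq_zero (f := fun s => bil k (deriv γ s) (deriv γ s))
      (fun t => (hasDerivAt_bil (hd' t) (hd' t)).differentiableAt) (fun t => ?_) s 0
    rw [(hasDerivAt_bil (hd' t) (hd' t)).deriv, h3 t, bil_smul_left, bil_smul_right,
      bil_comm _ (γ t), mem_tangent.1 (ht t)]
    ring
  refine ⟨ht 0, ?_⟩
  set e := bil k (deriv γ 0) (deriv γ 0) with he
  -- The equation is now γ'' = -eγ with constant e. This combination and the one in `hb` are
  -- conserved; solving them for γ by cs² + e sn² = 1 replaces a uniqueness theorem for differential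
  -- equations.
  have ha (s : ℝ) : cs e s • γ s - sn e s • deriv γ s = γ 0 := by
    have hda (t : ℝ) := ((hasDerivAt_cs e t).smul (hd t)).sub ((hasDerivAt_sn e t).smul (hd' t))
    have := is_const_of_deriv_eq_zero (f := fun s => cs e s • γ s - sn e s • deriv γ s)
      (fun t => (hda t).differentiableAt) (fun t => ?_) s 0
    · rw [this]; simp [cs_zero, sn_zero]
    · refine (hda t).deriv.trans ?_
      rw [h3, h4]; module
  have hb (s : ℝ) : (e * sn e s) • γ s + cs e s • deriv γ s = deriv γ 0 := by
    have hda (t : ℝ) := (((hasDerivAt_sn e t).const_mul e).smul (hd t)).add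
      ((hasDerivAt_cs e t).smul (hd' t))
    have := is_const_of_deriv_eq_zero
      (f := fun s => (e * sn e s) • γ s + cs e s • deriv γ s)
      (fun t => (hda t).differentiableAt) (fun t => ?_) s 0
    · rw [this]; simp [cs_zero, sn_zero]
    · refine (hda t).deriv.trans ?_
      rw [h3, h4]; module
  funext s
  rw [geo, ← he]
  nth_rewrite 1 [← ha s]
  nth_rewrite 1 [← hb s]
  have : γ s = (cs e s ^ 2 + e * sn e s ^ 2) • γ s := by rw [cs_sq_add, one_smul]
  nth_rewrite 1 [this]
  module

/-- The chosen geodesic exists and is determined by its initial data, so the choice is harmless. -/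
lemma expMap_eq (hn : 1 ≤ n) {x v : V n} (hx : x ∈ M n k) (hv : v ∈ tangent k x) :
    expMap k x v = geo k x v 1 := by
  have h := Classical.epsilon_spec
    (p := fun γ : ℝ → V n => IsGeodesic k γ ∧ γ 0 = x ∧ deriv γ 0 = v)
    ⟨geo k x v, isGeodesic_geo hx hv, geo_zero x v, (hasDerivAt_geo_zero x v).deriv⟩
  have h2 := (h.1.eq_geo hn).2
  rw [h.2.1, h.2.2] at h2
  rw [expMap, h2]

lemma metric_deriv_geo {x v : V n} (hx : x ∈ M n k) (hv : v ∈ tangent k x) (s : ℝ) :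
    metric k (deriv (geo k x v) s) (deriv (geo k x v) s) = metric k v v := by
  have h1 : bil k v v * metric k x v = 0 := bil_mul_metric hx hv hv
  have h2 : bil k v v * (bil k v v * metric k x x) = bil k v v * metric k v v := by
    by_cases hk : k = 0
    · subst hk; simp [bil, fst_eq_zero hx hv]
    · rw [← mul_metric hk v v]
      have := mul_metric hk x x
      rw [bil_self_of_mem hx] at this
      linear_combination k * metric k v v ^ 2 * this
  rw [deriv_geo]
  simp only [metric_add_left, metric_add_right, metric_smul_left, metric_smul_right,
    metric_comm v x]
  linear_combination (-2 * sn (bil k v v) s * cs (bil k v v) s) * h1 +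
    sn (bil k v v) s ^ 2 * h2 + metric k v v * cs_sq_add (bil k v v) s

lemma length_geo {x v : V n} (hx : x ∈ M n k) (hv : v ∈ tangent k x) :
    length k (geo k x v) = tnorm k v := by
  simp [length, tnorm, metric_deriv_geo hx hv]

end

section

variable {n : ℕ} {k : ℝ}

/-! ## The Riemannian distance -/

lemma chord_comm (x x' : V n) : chord k x x' = chord k x' x := by
  rw [chord, chord, ← neg_sub x x', metric_neg_left, metric_comm _ (-(x - x')), metric_neg_left,
    neg_neg]

/-- First variation of the chord: a tangent vector sees only the tangential part of p - x, and the
Cauchy–Schwarz inequality applies to that part. -/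
lemma abs_metric_chord_le (hn : 1 ≤ n) {p x X : V n} (hp : p ∈ M n k) (hx : x ∈ M n k)
    (hX : X ∈ tangent k p) :
    metric k X (p - x) ≤ tnorm k X * √(chord k p x * (1 - k * chord k p x / 4)) := by
  have h1 : metric k X (p - x) = metric k X ((p - x) - (k * chord k p x / 2) • p) := by
    have := mul_metric_self_tangent hp hX
    rw [metric_sub_right X (p - x), metric_smul_right, metric_comm X p]
    linear_combination (chord k p x / 2) * this
  have h2 := metric_sq_le hn hp hX (chord_tangent hp hx)
  rw [metric_chord_tangent hp hx, ← h1] at h2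
  rw [tnorm, ← Real.sqrt_mul (metric_self_nonneg hn hp hX)]
  exact Real.le_sqrt_of_sq_le h2

lemma continuous_tnorm_deriv {γ : ℝ → V n} (h : ContDiff ℝ 1 γ) :
    Continuous fun t => tnorm k (deriv γ t) := by
  have hd : Continuous (deriv γ) := h.continuous_deriv le_rfl
  unfold tnorm metric
  exact (((hd.fst.mul hd.fst).div_const k).add (hd.snd.inner hd.snd)).sqrt

/-- The function 2 arcsn(√q/2) of the squared chord q is the expected distance, and its derivative
along a curve is at most the speed. It fails to be differentiable at q = 0 and, for k > 0, at the
antipode; adding ε and dividing by 1 + |k|ε avoids both while preserving the bound. -/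
lemma regularized_arcsn_le_length (hn : 1 ≤ n) {γ : ℝ → V n} (h : ContDiff ℝ 1 γ)
    (hM : ∀ t ∈ Icc (0 : ℝ) 1, γ t ∈ M n k) {ε : ℝ} (hε : 0 < ε) :
    2 * arcsn k (√((chord k (γ 1) (γ 0) + ε) / (1 + |k| * ε)) / 2) -
      2 * arcsn k (√((chord k (γ 0) (γ 0) + ε) / (1 + |k| * ε)) / 2) ≤ length k γ := by
  have hx : γ 0 ∈ M n k := hM 0 (by simp)
  set x := γ 0
  have hl : 0 < 1 + |k| * ε := by positivity
  have hd (t : ℝ) : HasDerivAt γ (deriv γ t) t :=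
    ((h.differentiable (by simp)) t).hasDerivAt
  have hq : Continuous fun t => chord k (γ t) x := by
    have := h.continuous
    unfold chord metric
    fun_prop
  -- This form of the fundamental theorem needs only a pointwise bound of the derivative by the
  -- integrable speed.
  refine intervalIntegral.sub_le_integral_of_hasDeriv_right_of_le
    (g := fun t => 2 * arcsn k (√((chord k (γ t) x + ε) / (1 + |k| * ε)) / 2))
    (g' := fun t => 2 * (1 / √(1 - k * (√((chord k (γ t) x + ε) / (1 + |k| * ε)) / 2) ^ 2) *
      ((2 * metric k (deriv γ t) (γ t - x)) / (1 + |k| * ε) /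
        (2 * √((chord k (γ t) x + ε) / (1 + |k| * ε))) / 2)))
    zero_le_one ?_ ?_ (continuous_tnorm_deriv h).integrableOn_Icc ?_
  · have := continuous_arcsn k
    exact Continuous.continuousOn (by fun_prop)
  all_goals
    intro t ht
    have hγ := hM t (Ioo_subset_Icc_self ht)
    have hX : deriv γ t ∈ tangent k (γ t) := by
      refine deriv_mem_tangent (hd t) ?_
      filter_upwards [Icc_mem_nhds ht.1 ht.2] with s hs using hM s hs
    have q0 := chord_nonneg hn hγ hx
    have q1 := chord_le hn hγ hx
    have hz : 0 < (chord k (γ t) x + ε) / (1 + |k| * ε) := by positivity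
    have hle : (1 - k * chord k (γ t) x / 4) / (1 + |k| * ε) ≤
        1 - k * ((chord k (γ t) x + ε) / (1 + |k| * ε)) / 4 := by
      rw [div_le_iff₀ hl]
      have : (1 - k * ((chord k (γ t) x + ε) / (1 + |k| * ε)) / 4) * (1 + |k| * ε) =
        1 + |k| * ε - k * (chord k (γ t) x + ε) / 4 := by field_simp
      rw [this]
      nlinarith [le_abs_self k, abs_nonneg k]
    have hz1 : 0 < 1 - k * (√((chord k (γ t) x + ε) / (1 + |k| * ε)) / 2) ^ 2 := by
      rw [div_pow, Real.sq_sqrt hz.le]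
      have e : 1 - k * ((chord k (γ t) x + ε) / (1 + |k| * ε) / 2 ^ 2) =
        (1 - k * chord k (γ t) x / 4 + (|k| - k / 4) * ε) / (1 + |k| * ε) := by
        field_simp; ring
      rw [e]
      rcases eq_or_ne k 0 with rfl | hk
      · simp
      · have : 0 < |k| - k / 4 := by
          have := abs_pos.2 hk
          nlinarith [le_abs_self k]
        positivity
  · have h2 : HasDerivAt (fun t => chord k (γ t) x) (2 * metric k (deriv γ t) (γ t - x)) t := by
      have := hasDerivAt_metric (k := k) ((hd t).sub_const x) ((hd t).sub_const x)
      refine this.congr_deriv ?_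
      rw [metric_comm (γ t - x)]; ring
    have h3 := (((h2.add_const ε).div_const (1 + |k| * ε)).sqrt hz.ne').div_const 2
    exact (((hasDerivAt_arcsn hz1).comp t h3).const_mul 2).hasDerivWithinAt
  · have h2 := abs_metric_chord_le hn hγ hx hX
    set z := (chord k (γ t) x + ε) / (1 + |k| * ε) with hzd
    set q := chord k (γ t) x with hqd
    have hT : 0 ≤ tnorm k (deriv γ t) := Real.sqrt_nonneg _
    have hzz : (√z / 2) ^ 2 = z / 4 := by rw [div_pow, Real.sq_sqrt hz.le]; norm_num
    rw [hzz] at hz1 ⊢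
    have h4 : √(q * (1 - k * q / 4)) / (1 + |k| * ε) ≤ √z * √(1 - k * (z / 4)) := by
      rw [← Real.sqrt_mul hz.le]
      refine Real.le_sqrt_of_sq_le ?_
      rw [div_pow, Real.sq_sqrt (mul_nonneg q0 q1)]
      calc q * (1 - k * q / 4) / (1 + |k| * ε) ^ 2
          = (q / (1 + |k| * ε)) * ((1 - k * q / 4) / (1 + |k| * ε)) := by field_simp
        _ ≤ z * (1 - k * z / 4) := by
          refine mul_le_mul ?_ hle (by positivity) hz.le
          rw [hzd]; gcongr; linarith
        _ = z * (1 - k * (z / 4)) := by ring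
    have hs1 : 0 < √z := Real.sqrt_pos.2 hz
    have hs2 : 0 < √(1 - k * (z / 4)) := Real.sqrt_pos.2 hz1
    have e : 2 * (1 / √(1 - k * (z / 4)) * (2 * metric k (deriv γ t) (γ t - x) / (1 + |k| * ε) /
        (2 * √z) / 2)) = (metric k (deriv γ t) (γ t - x) / (1 + |k| * ε)) /
          (√z * √(1 - k * (z / 4))) := by
      field_simp
    rw [e, div_le_iff₀ (by positivity)]
    calc metric k (deriv γ t) (γ t - x) / (1 + |k| * ε)
        ≤ tnorm k (deriv γ t) * √(q * (1 - k * q / 4)) / (1 + |k| * ε) := by gcongr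
      _ = tnorm k (deriv γ t) * (√(q * (1 - k * q / 4)) / (1 + |k| * ε)) := by ring
      _ ≤ _ := by gcongr

lemma chord_self (x : V n) : chord k x x = 0 := by simp [chord, metric]

/-- Let ε tend to 0 from the right; the subtracted initial term tends to 0. -/
lemma arcsn_le_length (hn : 1 ≤ n) {γ : ℝ → V n} (h : ContDiff ℝ 1 γ)
    (hM : ∀ t ∈ Icc (0 : ℝ) 1, γ t ∈ M n k) :
    2 * arcsn k (√(chord k (γ 1) (γ 0)) / 2) ≤ length k γ := by
  set q := chord k (γ 1) (γ 0) with hq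
  have hc : ContinuousAt (fun ε : ℝ => 2 * arcsn k (√((q + ε) / (1 + |k| * ε)) / 2) -
      2 * arcsn k (√((chord k (γ 0) (γ 0) + ε) / (1 + |k| * ε)) / 2)) 0 := by
    have h1 : ContinuousAt (fun ε : ℝ => (1 + |k| * ε)⁻¹) 0 :=
      ContinuousAt.inv₀ (by fun_prop) (by simp)
    have h2 := (continuous_arcsn k)
    have h3 (a : ℝ) : ContinuousAt (fun ε : ℝ => 2 * arcsn k (√((a + ε) / (1 + |k| * ε)) / 2)) 0 := by
      have h4 : ContinuousAt (fun ε : ℝ => √((a + ε) / (1 + |k| * ε)) / 2) 0 := by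
        simp only [div_eq_mul_inv]
        exact ((ContinuousAt.mul (by fun_prop) h1).sqrt).mul_const _
      exact (h2.continuousAt.comp h4).const_mul 2
    exact (h3 _).sub (h3 _)
  have ht := hc.tendsto.mono_left (nhdsWithin_le_nhds (s := Ioi 0))
  have := le_of_tendsto ht (Filter.eventually_of_mem self_mem_nhdsWithin
    fun ε hε => regularized_arcsn_le_length hn h hM hε)
  simpa [chord_self, arcsn_zero] using this

/-! ## Geodesic polar coordinates -/

/-- The point at distance `r` from `x` in the direction of the unit tangent vector `u`. -/
def polar (k : ℝ) (x : V n) (r : ℝ) (u : V n) : V n := cs k r • x + sn k r • u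

lemma bil_unit {x u : V n} (hx : x ∈ M n k) (hu : u ∈ tangent k x) (h1 : metric k u u = 1) :
    bil k u u = k := by
  rw [← mul_metric_tangent hx hu, h1, mul_one]

lemma geo_smul {x u : V n} (hx : x ∈ M n k) (hu : u ∈ tangent k x) (h1 : metric k u u = 1)
    {r : ℝ} (hr : 0 < r) (s : ℝ) : geo k x (r • u) s = polar k x (r * s) u := by
  have h : bil k (r • u) (r • u) = k * r ^ 2 := by
    rw [bil_smul_left, bil_smul_right, bil_unit hx hu h1]; ring
  rw [geo, h, cs_rescale k hr, sn_rescale k hr, polar, smul_smul, div_mul_cancel₀ _ hr.ne']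

lemma polar_mem {x u : V n} (hx : x ∈ M n k) (hu : u ∈ tangent k x) (h1 : metric k u u = 1)
    {r : ℝ} (hr : 0 < r) : polar k x r u ∈ M n k := by
  have := geo_mem hx (smul_mem_tangent r hu) 1
  rwa [geo_smul hx hu h1 hr, mul_one] at this

lemma bil_polar {x u : V n} (hx : x ∈ M n k) (hu : u ∈ tangent k x) (r : ℝ) :
    bil k x (polar k x r u) = cs k r := by
  rw [polar, bil_add_right, bil_smul_right, bil_smul_right, bil_self_of_mem hx, mem_tangent.1 hu]
  ring

lemma chord_polar {x u : V n} (hx : x ∈ M n k) (hu : u ∈ tangent k x) (h1 : metric k u u = 1)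
    {r : ℝ} (hr : 0 < r) : chord k x (polar k x r u) = 4 * sn k (r / 2) ^ 2 := by
  by_cases hk : k = 0
  · subst hk
    have : x - polar 0 x r u = (-r) • u := by simp [polar, cs, sn]
    rw [chord, this, metric_smul_left, metric_smul_right, h1]
    simp [sn]; ring
  · have h2 := bil_eq_chord hx (polar_mem hx hu h1 hr)
    rw [bil_polar hx hu, cs_eq_half] at h2
    apply mul_left_cancel₀ hk
    linarith

lemma tnorm_smul_unit {u : V n} (h1 : metric k u u = 1) {r : ℝ} (hr : 0 < r) :
    tnorm k (r • u) = r := by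
  rw [tnorm, metric_smul_left, metric_smul_right, h1, mul_one, Real.sqrt_mul_self hr.le]

/-- The radial geodesic has length r, and `arcsn_le_length` bounds every competitor from below by
the same value. -/
lemma rdist_polar (hn : 1 ≤ n) {x u : V n} (hx : x ∈ M n k) (hu : u ∈ tangent k x)
    (h1 : metric k u u = 1) {r : ℝ} (hr : r ∈ radii k) : rdist k x (polar k x r u) = r := by
  refine IsLeast.csInf_eq ⟨⟨geo k x (r • u), (contDiff_geo _ _).of_le (by simp),
    fun t _ => geo_mem hx (smul_mem_tangent r hu) t, geo_zero _ _, ?_, ?_⟩, ?_⟩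
  · rw [geo_smul hx hu h1 hr.1, mul_one]
  · rw [length_geo hx (smul_mem_tangent r hu), tnorm_smul_unit h1 hr.1]
  · rintro L ⟨γ, h, hM, h0, h2, rfl⟩
    have := arcsn_le_length hn h hM
    rw [h0, h2, chord_comm, chord_polar hx hu h1 hr.1,
      show 4 * sn k (r / 2) ^ 2 = (2 * sn k (r / 2)) ^ 2 by ring,
      Real.sqrt_sq (by linarith [sn_half_pos hr]), mul_div_cancel_left₀ _ two_ne_zero,
      arcsn_sn_half hr.1.le fun hk => (hr.2 hk).le] at this
    exact this

/-- The unit tangent vector at the far end of a geodesic segment, pointing back. -/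
lemma polar_back {x u : V n} (hx : x ∈ M n k) (hu : u ∈ tangent k x) (h1 : metric k u u = 1)
    (r : ℝ) (x' : V n) (hx' : x' = polar k x r u) :
    (k * sn k r) • x - cs k r • u ∈ tangent k x' ∧
      metric k ((k * sn k r) • x - cs k r • u) ((k * sn k r) • x - cs k r • u) = 1 ∧
      polar k x' r ((k * sn k r) • x - cs k r • u) = x := by
  have h := cs_sq_add k r
  have hb := bil_unit hx hu h1
  have hm := mul_metric_self_tangent hx hu
  have h2 : k * (k * metric k x x) = k := by
    by_cases hk : k = 0
    · simp [hk]
    · rw [mul_metric hk, bil_self_of_mem hx, mul_one]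
  subst hx'
  refine ⟨?_, ?_, ?_⟩
  · rw [mem_tangent, polar, bil_add_left, bil_smul_left, bil_smul_left, bil_sub_right,
      bil_sub_right, bil_smul_right, bil_smul_right, bil_smul_right, bil_smul_right,
      bil_self_of_mem hx, bil_comm u x, mem_tangent.1 hu, hb]
    ring
  · rw [metric_sub_left, metric_sub_right, metric_sub_right, metric_smul_left, metric_smul_left,
      metric_smul_left, metric_smul_left, metric_smul_right, metric_smul_right, metric_smul_right,
      metric_smul_right, metric_comm u x, h1]
    linear_combination h + sn k r ^ 2 * h2 - 2 * sn k r * cs k r * hm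
  · have : x = (cs k r ^ 2 + k * sn k r ^ 2) • x := by rw [h, one_smul]
    nth_rewrite 3 [this]
    simp only [polar]
    module

/-- Uniqueness of the minimal geodesic: any candidate starts at x' with speed r, and its end point x
determines its direction because sn(r) ≠ 0 for admissible radii. -/
lemma minGeodesic_polar (hn : 1 ≤ n) {x u : V n} (hx : x ∈ M n k) (hu : u ∈ tangent k x)
    (h1 : metric k u u = 1) {r : ℝ} (hr : r ∈ radii k) :
    minGeodesic k x (polar k x r u) =
      geo k (polar k x r u) (r • ((k * sn k r) • x - cs k r • u)) := by
  have hx' := polar_mem hx hu h1 hr.1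
  obtain ⟨b1, b2, b3⟩ := polar_back hx hu h1 r _ rfl
  set x' := polar k x r u with hxd
  set w := (k * sn k r) • x - cs k r • u
  have hd : rdist k x x' = r := rdist_polar hn hx hu h1 hr
  have hex : IsMinimalGeodesic k x x' (geo k x' (r • w)) :=
    ⟨isGeodesic_geo hx' (smul_mem_tangent r b1), geo_zero _ _,
      by rw [geo_smul hx' b1 b2 hr.1, mul_one, b3],
      by rw [length_geo hx' (smul_mem_tangent r b1), tnorm_smul_unit b2 hr.1, hd]⟩
  obtain ⟨g1, g2, g3, g4⟩ : IsMinimalGeodesic k x x' (minGeodesic k x x') :=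
    Classical.epsilon_spec (p := IsMinimalGeodesic k x x') ⟨_, hex⟩
  obtain ⟨t1, t2⟩ := g1.eq_geo hn
  rw [g2] at t1 t2
  set v := deriv (minGeodesic k x x') 0
  rw [t2, length_geo hx' t1, hd] at g4
  have hv : metric k v v = r ^ 2 := by
    rw [tnorm] at g4
    rw [← g4, Real.sq_sqrt (metric_self_nonneg hn hx' t1)]
  have hu1 : metric k (r⁻¹ • v) (r⁻¹ • v) = 1 := by
    rw [metric_smul_left, metric_smul_right, hv]
    have := hr.1.ne'
    field_simp
  have hvr : v = r • (r⁻¹ • v) := by rw [smul_smul, mul_inv_cancel₀ hr.1.ne', one_smul]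
  rw [t2, hvr, geo_smul hx' (smul_mem_tangent _ t1) hu1 hr.1, mul_one] at g3
  have h5 : polar k x' r (r⁻¹ • v) = polar k x' r w := by rw [g3, b3]
  simp only [polar, add_right_inj] at h5
  have h6 := smul_right_injective _ (sn_pos hr).ne' h5
  rw [t2, hvr, h6]

/-- The sign is negative because the geodesic runs from x' to x, against the outgoing direction u.
-/
lemma nu_polar (hn : 1 ≤ n) {x u : V n} (hx : x ∈ M n k) (hu : u ∈ tangent k x)
    (h1 : metric k u u = 1) {r : ℝ} (hr : r ∈ radii k) :
    nu k x (polar k x r u) = -u := by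
  have hx' := polar_mem hx hu h1 hr.1
  obtain ⟨b1, b2, b3⟩ := polar_back hx hu h1 r _ rfl
  rw [nu, minGeodesic_polar hn hx hu h1 hr]
  set x' := polar k x r u with hxd
  set w := (k * sn k r) • x - cs k r • u with hw
  have hb : bil k (r • w) (r • w) = k * r ^ 2 := by
    rw [bil_smul_left, bil_smul_right, bil_unit hx' b1 b2]; ring
  have hr0 := hr.1.ne'
  have hd : deriv (geo k x' (r • w)) 1 = r • (-u) := by
    rw [deriv_geo]
    simp only [hb, cs_rescale k hr.1, sn_rescale k hr.1, mul_one]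
    have : u = (cs k r ^ 2 + k * sn k r ^ 2) • u := by rw [cs_sq_add, one_smul]
    nth_rewrite 1 [this]
    have e : -(k * r ^ 2) * (sn k r / r) = -(k * r * sn k r) := by field_simp
    rw [e, hxd, hw, polar]
    module
  have h2 : metric k (-u) (-u) = 1 := by
    rw [metric_neg_left, metric_comm, metric_neg_left, h1, neg_neg]
  rw [hd, tnorm_smul_unit h2 hr.1, smul_smul, inv_mul_cancel₀ hr0, one_smul]

/-! ## Geodesic spheres -/

lemma unit_frame (hn : 1 ≤ n) {x : V n} (hx : x ∈ M n k) {θ : E n} (hθ : ‖θ‖ = 1) :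
    metric k (frame k (chartAt x) x θ) (frame k (chartAt x) x θ) = 1 := by
  rw [metric_frame hn (mem_chartDomain_chartAt hx), real_inner_self_eq_norm_sq, hθ, one_pow]

/-- The Jacobian is defined through the derivative in the whole of ℝⁿ, so the map is needed near the
unit sphere and not only on it. -/
lemma sphereMap_eq_of_ne (hn : 1 ≤ n) {x : V n} (hx : x ∈ M n k) {r : ℝ} (hr : 0 < r) {θ : E n}
    (hθ : θ ≠ 0) : sphereMap k x r θ =
      cs k (r * ‖θ‖) • x + (sn k (r * ‖θ‖) / ‖θ‖) • frameL k (chartAt x) x θ := by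
  have hd := mem_chartDomain_chartAt hx
  have h0 : 0 < ‖θ‖ := norm_pos_iff.2 hθ
  have h1 : ‖(‖θ‖⁻¹ • θ)‖ = 1 := by rw [norm_smul, norm_inv, norm_norm, inv_mul_cancel₀ h0.ne']
  have e : r • frame k (chartAt x) x θ =
      (r * ‖θ‖) • frame k (chartAt x) x (‖θ‖⁻¹ • θ) := by
    rw [frame_smul, smul_smul, mul_assoc, mul_inv_cancel₀ h0.ne', mul_one]
  rw [sphereMap, e, expMap_eq hn hx (smul_mem_tangent _ (frame_mem_tangent hd _)),
    geo_smul hx (frame_mem_tangent hd _) (unit_frame hn hx h1) (by positivity), mul_one, polar,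
    frame_smul, smul_smul, div_eq_mul_inv, frameL_apply]

lemma sphereMap_eq (hn : 1 ≤ n) {x : V n} (hx : x ∈ M n k) {r : ℝ} (hr : 0 < r) {θ : E n}
    (hθ : ‖θ‖ = 1) : sphereMap k x r θ = polar k x r (frame k (chartAt x) x θ) := by
  rw [sphereMap_eq_of_ne hn hx hr (norm_ne_zero_iff.1 (by rw [hθ]; exact one_ne_zero)), hθ,
    mul_one, div_one, polar, frameL_apply]

lemma fderiv_sphereMap (hn : 1 ≤ n) {x : V n} (hx : x ∈ M n k) {r : ℝ} (hr : 0 < r) {θ : E n}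
    (hθ : ‖θ‖ = 1) {w : E n} (hw : ⟪θ, w⟫ = 0) :
    fderiv ℝ (sphereMap k x r) θ w = sn k r • frame k (chartAt x) x w := by
  have h0 : θ ≠ 0 := norm_ne_zero_iff.1 (by rw [hθ]; exact one_ne_zero)
  have hN : HasFDerivAt (fun θ : E n => ‖θ‖) (fderiv ℝ (fun θ : E n => ‖θ‖) θ) θ :=
    ((contDiffAt_norm ℝ h0 (n := 1)).differentiableAt (by simp)).hasFDerivAt
  -- Along directions tangent to the sphere the norm is stationary, so only the linear factor of
  -- `sphereMap` contributes.
  have hNw : fderiv ℝ (fun θ : E n => ‖θ‖) θ w = 0 := by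
    have h2 := (hN.pow 2).unique (hasStrictFDerivAt_norm_sq θ).hasFDerivAt
    have h3 := DFunLike.congr_fun h2 w
    simpa [hθ, hw] using h3
  have hd1 := (hasDerivAt_cs k (r * ‖θ‖)).comp_hasFDerivAt θ (hN.const_mul r)
  have hd2 := (hasDerivAt_sn k (r * ‖θ‖)).comp_hasFDerivAt θ (hN.const_mul r)
  have hd3 := hd2.mul (hasDerivAt_inv (norm_ne_zero_iff.2 h0) |>.comp_hasFDerivAt θ hN)
  have hd := (hd1.smul_const x).add (hd3.smul (frameL k (chartAt x) x).hasFDerivAt)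
  have he : sphereMap k x r =ᶠ[nhds θ] fun θ => cs k (r * ‖θ‖) • x +
      (sn k (r * ‖θ‖) * ‖θ‖⁻¹) • frameL k (chartAt x) x θ := by
    filter_upwards [isOpen_ne.mem_nhds h0] with η hη
    rw [sphereMap_eq_of_ne hn hx hr hη, div_eq_mul_inv]
  rw [he.fderiv_eq]
  have := hd.fderiv
  refine (DFunLike.congr_fun this w).trans ?_
  simp [hNw, hθ]

lemma sphereJac_eq (hn : 1 ≤ n) {x : V n} (hx : x ∈ M n k) {r : ℝ} (hr : r ∈ radii k) {θ : E n}
    (hθ : ‖θ‖ = 1) : sphereJac k x r θ = sn k r ^ (n - 1) := by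
  have hd := mem_chartDomain_chartAt hx
  have h0 : θ ≠ 0 := norm_ne_zero_iff.1 (by rw [hθ]; exact one_ne_zero)
  have hfr : Module.finrank ℝ (ℝ ∙ θ)ᗮ = n - 1 := by
    have h1 := Submodule.finrank_add_finrank_orthogonal (ℝ ∙ θ)
    rw [finrank_span_singleton h0, finrank_euclideanSpace_fin] at h1
    omega
  set b := stdOrthonormalBasis ℝ (ℝ ∙ θ)ᗮ
  have hm : (Matrix.of fun i j : Fin (Module.finrank ℝ (ℝ ∙ θ)ᗮ) =>
      metric k (fderiv ℝ (sphereMap k x r) θ (b i)) (fderiv ℝ (sphereMap k x r) θ (b j))) =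
      (sn k r ^ 2) • (1 : Matrix _ _ ℝ) := by
    ext i j
    have hi (i) : ⟪θ, (b i : E n)⟫ = 0 :=
      (Submodule.mem_orthogonal_singleton_iff_inner_right.1 (b i).2)
    rw [Matrix.of_apply, fderiv_sphereMap hn hx hr.1 hθ (hi i), fderiv_sphereMap hn hx hr.1 hθ (hi j),
      metric_smul_left, metric_smul_right, metric_frame hn hd, ← Submodule.coe_inner,
      orthonormal_iff_ite.1 b.orthonormal i j]
    simp [Matrix.one_apply]
    split_ifs <;> ring
  rw [sphereJac, hm, Matrix.det_smul, Matrix.det_one, mul_one, Fintype.card_fin, hfr, ← pow_mul,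
    mul_comm 2, pow_mul, Real.sqrt_sq (pow_nonneg (sn_pos hr).le _)]

/-- Integration over a geodesic sphere. -/
lemma integral_gsphere {F : Type*} [NormedAddCommGroup F] [NormedSpace ℝ F] (hn : 1 ≤ n) {x : V n}
    (hx : x ∈ M n k) {r : ℝ} (hr : r ∈ radii k) (g : V n → F) :
    ∫ x' in gsphere k x r, g x' ∂(surfMeasure k x r) =
      sn k r ^ (n - 1) • ∫ θ : Metric.sphere (0 : E n) 1,
        g (polar k x r (frame k (chartAt x) x θ)) ∂(volume : Measure (E n)).toSphere := by
  have hd := mem_chartDomain_chartAt hx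
  have hθ (θ : Metric.sphere (0 : E n) 1) : ‖(θ : E n)‖ = 1 := by simp
  have hf : (fun θ : Metric.sphere (0 : E n) 1 => sphereMap k x r θ) =
      fun θ : Metric.sphere (0 : E n) 1 => polar k x r (frame k (chartAt x) x θ) :=
    funext fun θ => sphereMap_eq hn hx hr.1 (hθ θ)
  -- With an embedding the push-forward integral can be pulled back for arbitrary `g`, without
  -- measurability.
  have hemb : MeasurableEmbedding
      fun θ : Metric.sphere (0 : E n) 1 => polar k x r (frame k (chartAt x) x θ) := by
    refine (Continuous.isClosedEmbedding ?_ ?_).measurableEmbedding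
    · have := (frameL k (chartAt x) x).continuous.comp
        (continuous_subtype_val (p := fun y : E n => y ∈ Metric.sphere 0 1))
      exact continuous_const.add (this.const_smul (sn k r))
    · intro θ η h
      simp only [polar, add_right_inj] at h
      have h2 := smul_right_injective _ (sn_pos hr).ne' h
      have h3 : frame k (chartAt x) x ((θ : E n) - η) = 0 := by
        rw [← frameL_apply, map_sub, frameL_apply, frameL_apply, h2, sub_self]
      have h4 := metric_frame hn hd ((θ : E n) - η) ((θ : E n) - η)
      rw [h3] at h4
      have h5 : ⟪(θ : E n) - η, (θ : E n) - η⟫ = (0 : ℝ) := by rw [← h4]; simp [metric]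
      exact Subtype.ext (sub_eq_zero.1 (inner_self_eq_zero.1 h5))
  have hdens : (fun θ : Metric.sphere (0 : E n) 1 => ENNReal.ofReal (sphereJac k x r θ)) =
      fun _ => ENNReal.ofReal (sn k r ^ (n - 1)) :=
    funext fun θ => by rw [sphereJac_eq hn hx hr (hθ θ)]
  rw [surfMeasure, hf, hdens, withDensity_const]
  rw [Measure.restrict_eq_self_of_ae_mem, hemb.integral_map, integral_smul_measure,
    ENNReal.toReal_ofReal (pow_nonneg (sn_pos hr).le _)]
  rw [hemb.ae_map_iff]
  refine Filter.Eventually.of_forall fun θ => ?_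
  exact ⟨polar_mem hx (frame_mem_tangent hd _) (unit_frame hn hx (hθ θ)) hr.1,
    rdist_polar hn hx (frame_mem_tangent hd _) (unit_frame hn hx (hθ θ)) hr⟩

end

section

/-! ### Identities for two anticommuting-up-to-scalar elements of an algebra -/

section Algebra

variable {A : Type*} [Ring A] [Algebra ℂ A] {a b : A} {α β m t t' σ k x₀ : ℂ}

/-- Here a and b stand for the Clifford images of two vectors with inner product m. Moving b to the
right of a reduces every word to a combination of 1, a, b, ab, after which coefficients are
compared; the identities below are proved in the same way. -/
lemma rotor_sq (ha : a * a = α • 1) (hb : b * b = β • 1) (hab : b * a = (2 * m) • 1 - a * b) :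
    (t' • a - t • b - (σ / 2) • (a * b - b * a)) * (t' • a - t • b - (σ / 2) • (a * b - b * a)) =
      (t' ^ 2 * α + t ^ 2 * β - 2 * t * t' * m + σ ^ 2 * (m ^ 2 - α * β)) • 1 := by
  have haX (X : A) : a * (a * X) = α • X := by rw [← mul_assoc, ha, smul_mul_assoc, one_mul]
  have habX (X : A) : b * (a * X) = (2 * m) • X - a * (b * X) := by
    rw [← mul_assoc, hab, sub_mul, smul_mul_assoc, one_mul, mul_assoc]
  rw [hab]
  simp only [mul_sub, sub_mul, smul_mul_assoc, mul_smul_comm, one_mul, mul_one,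
    mul_assoc, ha, hb, hab, haX, habX, smul_sub]
  match_scalars <;> ring

/-- The computation behind the covariant derivative in the north frame. -/
lemma connection_inv (ha : a * a = α • 1) (hab : b * a = (2 * m) • 1 - a * b)
    (hσ : σ ^ 2 = -k) (hx : t ^ 2 + k * α = 1) (hX : t * x₀ + k * m = 0) (ht : 1 + t ≠ 0) :
    -(x₀ / (2 * (1 + t))) • ((1 + t) • 1 - σ • a) + (x₀ • 1 - σ • b) +
        ((k / (4 * (1 + t))) • (a * b - b * a)) * ((1 + t) • 1 - σ • a) =
      -((σ / 2) • (((1 + t) • 1 - σ • a) *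
        (t • b - x₀ • a - (σ / 2) • (b * a - a * b)))) := by
  have haX (X : A) : a * (a * X) = α • X := by rw [← mul_assoc, ha, smul_mul_assoc, one_mul]
  rw [hab]
  simp only [mul_sub, sub_mul, smul_mul_assoc, mul_smul_comm, one_mul, mul_one,
    mul_assoc, ha, hab, haX, smul_sub]
  match_scalars <;> field_simp <;> grind

lemma connection_fwd (ha : a * a = α • 1) (hab : b * a = (2 * m) • 1 - a * b)
    (hσ : σ ^ 2 = -k) (hx : t ^ 2 + k * α = 1) (hX : t * x₀ + k * m = 0) (ht : 1 + t ≠ 0) :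
    -(x₀ / (2 * (1 + t))) • ((1 + t) • 1 + σ • a) + (x₀ • 1 + σ • b) =
        ((1 + t) • 1 + σ • a) * ((k / (4 * (1 + t))) • (a * b - b * a)) +
      (σ / 2) • ((t • b - x₀ • a - (σ / 2) • (b * a - a * b)) * ((1 + t) • 1 + σ • a)) := by
  have haX (X : A) : a * (a * X) = α • X := by rw [← mul_assoc, ha, smul_mul_assoc, one_mul]
  rw [hab]
  simp only [mul_add, add_mul, mul_sub, sub_mul, smul_mul_assoc, mul_smul_comm, one_mul, mul_one,
    mul_assoc, ha, hab, haX, smul_sub, smul_add]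
  match_scalars <;> field_simp <;> grind

/-- The unnormalized form of `tauN_gam`: the vector in parentheses paired with b is the north frame
applied to b, and the first factor on the right is its `rot` with the base point. -/
lemma gauge_conj (ha : a * a = α • 1) (hab : b * a = (2 * m) • 1 - a * b)
    (hσ : σ ^ 2 = -k) (hx : t ^ 2 + k * α = 1) (ht : 1 + t ≠ 0) :
    ((1 + t) • 1 + σ • a) * b =
      (t • (b - (k * m / (1 + t)) • a) - (-(k * m)) • a -
        (σ / 2) • ((b - (k * m / (1 + t)) • a) * a - a * (b - (k * m / (1 + t)) • a))) *
        ((1 + t) • 1 + σ • a) := by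
  have haX (X : A) : a * (a * X) = α • X := by rw [← mul_assoc, ha, smul_mul_assoc, one_mul]
  simp only [mul_add, add_mul, mul_sub, sub_mul, smul_mul_assoc, mul_smul_comm, one_mul, mul_one,
    mul_assoc, ha, hab, haX, smul_sub]
  match_scalars <;> field_simp <;> grind

/-- The source of `rot`: the product (t + σy)(t' - σy') has scalar part `bil`, and the rest is σ
times `rot`. -/
lemma rotor_mul (hab : b * a = (2 * m) • 1 - a * b) (hσ : σ ^ 2 = -k) :
    (t • 1 + σ • a) * (t' • 1 - σ • b) =
      (t * t' + k * m) • 1 + σ • (t' • a - t • b - (σ / 2) • (a * b - b * a)) := by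
  simp only [mul_sub, add_mul, smul_mul_assoc, mul_smul_comm, one_mul, mul_one, hab, smul_sub]
  match_scalars <;> grind
end Algebra

variable {n : ℕ} {k : ℝ} {S : Type*} [NormedAddCommGroup S] [NormedSpace ℂ S]
  [FiniteDimensional ℂ S] (c : Cl n →ₐ[ℝ] Module.End ℂ S)

/-! ## Clifford multiplication as a continuous linear map -/

/-- Clifford multiplication by a vector of `ℝⁿ`. -/
def gam : E n →L[ℝ] (S →L[ℂ] S) :=
  LinearMap.toContinuousLinearMap
    { toFun := fun v => LinearMap.toContinuousLinearMap (c (vec v))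
      map_add' := fun v w => by simp [vec]
      map_smul' := fun a v => by
        ext s
        simp [vec] }

lemma gam_apply (v : E n) (s : S) : gam c v s = c (vec v) s := rfl

lemma gam_mul_apply (v w : E n) (s : S) : (gam c v * gam c w) s = c (vec v * vec w) s := by
  rw [map_mul]; rfl

lemma gam_mul_self (v : E n) : gam c v * gam c v = ((‖v‖ ^ 2 : ℝ) : ℂ) • 1 := by
  ext s
  have h : vec v * vec v = algebraMap ℝ (Cl n) (‖v‖ ^ 2) := by
    rw [vec, CliffordAlgebra.ι_sq_scalar]
    simp
  rw [gam_mul_apply, h, AlgHom.commutes, Module.algebraMap_end_apply]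
  simp only [smul_apply, one_apply_eq_self, Complex.coe_smul]

lemma gam_mul_comm (v w : E n) :
    gam c w * gam c v = (2 * ((⟪v, w⟫ : ℝ) : ℂ)) • 1 - gam c v * gam c w := by
  have h1 := gam_mul_self c (v + w)
  rw [map_add, add_mul, mul_add, mul_add, gam_mul_self, gam_mul_self, norm_add_sq_real] at h1
  push_cast at h1
  rw [add_smul, add_smul] at h1
  rw [eq_sub_iff_add_eq]
  have : gam c w * gam c v + gam c v * gam c w =
    ((((‖v‖ : ℂ) ^ 2) • (1 : S →L[ℂ] S) + gam c v * gam c w) +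
      (gam c w * gam c v + ((‖w‖ : ℂ) ^ 2) • (1 : S →L[ℂ] S))) -
      ((‖v‖ : ℂ) ^ 2) • (1 : S →L[ℂ] S) - ((‖w‖ : ℂ) ^ 2) • (1 : S →L[ℂ] S) := by abel
  rw [this]
  rw [h1]; abel

/-- A square root of `-k`. -/
def sig (k : ℝ) : ℂ := open Classical in if 0 < k then Complex.I * √k else √(-k)

lemma sig_sq (k : ℝ) : sig k ^ 2 = -(k : ℂ) := by
  unfold sig
  split_ifs with h
  · rw [mul_pow, Complex.I_sq, ← Complex.ofReal_pow, Real.sq_sqrt h.le]; ring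
  · rw [← Complex.ofReal_pow, Real.sq_sqrt (by linarith)]; simp

/-- The bivector part of the product of two ambient vectors. -/
def rot (k : ℝ) (p q : V n) : S →L[ℂ] S :=
  q.1 • gam c p.2 - p.1 • gam c q.2 - (sig k / 2) • (gam c p.2 * gam c q.2 - gam c q.2 * gam c p.2)

lemma rot_swap (p q : V n) : rot c k q p = -rot c k p q := by
  simp only [rot, smul_sub]; abel

lemma rot_self (p : V n) : rot c k p p = 0 := by
  simp [rot]

lemma rot_add_left (p p' q : V n) : rot c k (p + p') q = rot c k p q + rot c k p' q := by
  simp only [rot, Prod.fst_add, Prod.snd_add, map_add, add_mul, mul_add, smul_add, smul_sub,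
    add_smul]
  abel

lemma rot_smul_left (a : ℝ) (p q : V n) : rot c k (a • p) q = a • rot c k p q := by
  simp only [rot, Prod.smul_fst, Prod.smul_snd, map_smul, smul_mul_assoc, mul_smul_comm, smul_sub,
    smul_eq_mul, mul_smul, smul_comm a]

/-- `rot` as a linear map of its first argument. -/
def rotL (k : ℝ) (q : V n) : V n →L[ℝ] (S →L[ℂ] S) :=
  LinearMap.toContinuousLinearMap
    { toFun := fun p => rot c k p q
      map_add' := fun p p' => rot_add_left c p p' q
      map_smul' := fun a p => rot_smul_left c a p q }

@[simp] lemma rotL_apply (p q : V n) : rotL c k q p = rot c k p q := rfl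

lemma rot_add_right (p q q' : V n) : rot c k p (q + q') = rot c k p q + rot c k p q' := by
  rw [rot_swap, rot_add_left, rot_swap c q p, rot_swap c q' p, rot_swap c p q, rot_swap c p q']
  abel

lemma rot_smul_right (a : ℝ) (p q : V n) : rot c k p (a • q) = a • rot c k p q := by
  rw [rot_swap, rot_smul_left, rot_swap c p q, smul_neg, neg_neg]

lemma rot_neg_neg (p q : V n) : rot c k (-p) (-q) = rot c k p q := by
  rw [← neg_one_smul ℝ p, ← neg_one_smul ℝ q, rot_smul_left, rot_smul_right, smul_smul]
  norm_num

lemma rot_sq (p q : V n) : rot c k p q * rot c k p q =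
    ((q.1 ^ 2 * ‖p.2‖ ^ 2 + p.1 ^ 2 * ‖q.2‖ ^ 2 - 2 * p.1 * q.1 * ⟪p.2, q.2⟫ -
      k * (⟪p.2, q.2⟫ ^ 2 - ‖p.2‖ ^ 2 * ‖q.2‖ ^ 2) : ℝ) : ℂ) • 1 := by
  simp only [rot, ← Complex.coe_smul]
  rw [rotor_sq (gam_mul_self c p.2) (gam_mul_self c q.2) (gam_mul_comm c p.2 q.2), sig_sq]
  congr 1
  push_cast
  ring

/-- Multiplied by k, the square of `rot` is the Gram determinant of `bil`. The factor can be
cancelled only for k ≠ 0, so the flat case is treated directly in the two lemmas that follow. -/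
lemma mul_rot_sq_scalar (p q : V n) : k * (q.1 ^ 2 * ‖p.2‖ ^ 2 + p.1 ^ 2 * ‖q.2‖ ^ 2 -
      2 * p.1 * q.1 * ⟪p.2, q.2⟫ - k * (⟪p.2, q.2⟫ ^ 2 - ‖p.2‖ ^ 2 * ‖q.2‖ ^ 2)) =
    bil k p p * bil k q q - bil k p q ^ 2 := by
  simp only [bil, real_inner_self_eq_norm_sq]; ring

lemma rot_sq_tangent {x X : V n} (hx : x ∈ M n k) (hX : X ∈ tangent k x) :
    rot c k X x * rot c k X x = (metric k X X : ℂ) • 1 := by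
  rw [rot_sq]
  congr 2
  by_cases hk : k = 0
  · subst hk
    simp [fst_eq_one hx, fst_eq_zero hx hX, metric]
  · apply mul_left_cancel₀ hk
    rw [mul_rot_sq_scalar, mul_metric hk, bil_self_of_mem hx, bil_comm X x, mem_tangent.1 hX]
    ring

/-- The relation that keeps kernels linear in R = rot(x,x'): every even power of R is a polynomial
in the squared chord. -/
lemma rot_sq_chord {x x' : V n} (hx : x ∈ M n k) (hx' : x' ∈ M n k) :
    rot c k x x' * rot c k x x' = ((chord k x x' * (1 - k * chord k x x' / 4) : ℝ) : ℂ) • 1 := by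
  rw [rot_sq]
  congr 2
  by_cases hk : k = 0
  · subst hk
    simp only [fst_eq_one hx, fst_eq_one hx', chord, metric, Prod.snd_sub,
      real_inner_self_eq_norm_sq, norm_sub_sq_real, div_zero]
    ring
  · apply mul_left_cancel₀ hk
    rw [mul_rot_sq_scalar, bil_self_of_mem hx, bil_self_of_mem hx', bil_eq_chord hx hx']
    ring

lemma rot_sq_of_tangent {x v : V n} (hx : x ∈ M n k) (hv : v ∈ tangent k x) :
    (sig k • rot c k v x) * (sig k • rot c k v x) = -(bil k v v : ℂ) • 1 := by
  rw [smul_mul_smul_comm, rot_sq_tangent c hx hv, smul_smul, ← sq, sig_sq,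
    ← mul_metric_tangent hx hv]
  push_cast
  ring_nf

/-- The even product of two ambient vectors with one of them conjugated. -/
lemma rot_transfer {x x' X : V n} (hx : x ∈ M n k) (hx' : x' ∈ M n k) (hX : X ∈ tangent k x) :
    rot c k X x' = rot c k X x * ((bil k x x' : ℂ) • 1 + sig k • rot c k x x') -
      (sig k * metric k X (x - x')) • 1 := by
  have hσ := sig_sq k
  by_cases hk : k = 0
  · subst hk
    have h0 : sig 0 = 0 := by simpa using hσ
    simp [h0, rot, bil, fst_eq_one hx, fst_eq_one hx', fst_eq_zero hx hX]
  · have hs : sig k ≠ 0 := by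
      intro h
      rw [h] at hσ
      simp at hσ
      exact hk hσ
    have key (p q : V n) : ((p.1 : ℂ) • 1 + sig k • gam c p.2) * ((q.1 : ℂ) • 1 - sig k • gam c q.2) =
        (bil k p q : ℂ) • 1 + sig k • rot c k p q := by
      rw [rotor_mul (gam_mul_comm c p.2 q.2) hσ]
      simp only [bil, rot, ← Complex.coe_smul]
      push_cast
      rfl
    -- Write p⁺ = t + σy and p⁻ = t - σy. Since x⁻x⁺ = 1, it can be inserted: X⁺x'⁻ = (X⁺x⁻)(x⁺x'⁻),
    -- and the two factors are given by `key`. The final cancellation of σ needs k ≠ 0.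
    have h1 : ((x.1 : ℂ) • 1 - sig k • gam c x.2) * ((x.1 : ℂ) • 1 + sig k • gam c x.2) = 1 := by
      have h2 := key (x.1, -x.2) (x.1, -x.2)
      simp only [map_neg, smul_neg, sub_neg_eq_add, ← sub_eq_add_neg, rot_self, smul_zero,
        add_zero] at h2
      rw [h2]
      have : bil k (x.1, -x.2) (x.1, -x.2) = 1 := by
        have := bil_self_of_mem hx
        simpa [bil] using this
      rw [this]; simp
    have hXx : sig k • rot c k X x =
        ((X.1 : ℂ) • 1 + sig k • gam c X.2) * ((x.1 : ℂ) • 1 - sig k • gam c x.2) := by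
      rw [key, bil_comm, mem_tangent.1 hX]; simp
    have hXx' : sig k • rot c k X x' =
        ((X.1 : ℂ) • 1 + sig k • gam c X.2) * ((x'.1 : ℂ) • 1 - sig k • gam c x'.2) -
          (bil k X x' : ℂ) • 1 := by
      rw [key]; abel
    have hm : k * metric k X (x - x') = -bil k X x' := by
      rw [mul_metric hk, bil_sub_right, bil_comm X x, mem_tangent.1 hX, zero_sub]
    apply smul_right_injective _ hs
    simp only
    rw [hXx', smul_sub, ← smul_mul_assoc, hXx, ← key, mul_assoc, ← mul_assoc (_ - _), h1, one_mul,
      smul_smul, ← mul_assoc, ← sq, hσ]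
    congr 2
    rw [neg_mul, ← Complex.ofReal_mul, hm]
    simp

end

section

lemma I_smul_mul {S : Type*} [NormedAddCommGroup S] [NormedSpace ℂ S] (A B : S →L[ℂ] S) :
    (Complex.I • A) * (-Complex.I • B) = A * B := by
  rw [smul_mul_smul_comm]; simp

lemma neg_I_smul_mul {S : Type*} [NormedAddCommGroup S] [NormedSpace ℂ S] (A B : S →L[ℂ] S) :
    (-Complex.I • A) * (Complex.I • B) = A * B := by
  rw [smul_mul_smul_comm]; simp

variable {n : ℕ} {k : ℝ} {S : Type*} [NormedAddCommGroup S] [NormedSpace ℂ S]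
  [FiniteDimensional ℂ S] (c : Cl n →ₐ[ℝ] Module.End ℂ S)

/-! ## Sums over an orthonormal frame -/

lemma rot_frame_sq (hn : 1 ≤ n) {α : Chart} {x : V n} (hx : x ∈ chartDomain n k α) (i : Fin n) :
    rot c k (frame k α x (basisVec i)) x * rot c k (frame k α x (basisVec i)) x = 1 := by
  rw [rot_sq_tangent c (mem_M_of_mem_chartDomain hx) (frame_mem_tangent hx _), metric_frame hn hx]
  simp [basisVec]

/-- The coefficients expand the tangential part of x - x' in the frame; since rot(x,x) = 0 its
normal part does not matter, and rot(x - x',x) = rot(x,x'). -/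
lemma sum_metric_rot (hn : 1 ≤ n) {α : Chart} {x x' : V n} (hx : x ∈ chartDomain n k α)
    (hx' : x' ∈ M n k) :
    ∑ i, metric k (frame k α x (basisVec i)) (x - x') • rot c k (frame k α x (basisVec i)) x =
      rot c k x x' := by
  have hM := mem_M_of_mem_chartDomain hx
  set w := (x - x') - (k * chord k x x' / 2) • x with hw
  have h1 (i : Fin n) : metric k (frame k α x (basisVec i)) (x - x') =
      metric k (frame k α x (basisVec i)) w := by
    have := mul_metric_self_tangent hM (frame_mem_tangent hx (basisVec i))
    rw [hw, metric_sub_right _ (x - x'), metric_smul_right, metric_comm _ x]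
    linear_combination (chord k x x' / 2) * this
  simp only [h1, ← rot_smul_left]
  simp only [← rotL_apply, ← map_sum]
  rw [sum_metric_smul_frame hn hx (chord_tangent hM hx'), map_sub, map_sub, map_smul]
  simp only [rotL_apply, rot_self, rot_swap c x x']
  simp

/-- `rot_transfer` and rot(e_i,x)² = 1 give n copies of the same operator; the correction terms sum
to one copy of σR by `sum_metric_rot`, whence the coefficient n - 1. -/
lemma sum_rot_rot (hn : 1 ≤ n) {α : Chart} {x x' : V n} (hx : x ∈ chartDomain n k α)
    (hx' : x' ∈ M n k) :
    ∑ i, rot c k (frame k α x (basisVec i)) x * rot c k (frame k α x (basisVec i)) x' =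
      ((n : ℂ) * bil k x x') • 1 + (((n : ℂ) - 1) * sig k) • rot c k x x' := by
  have hM := mem_M_of_mem_chartDomain hx
  have h1 (i : Fin n) :
      rot c k (frame k α x (basisVec i)) x * rot c k (frame k α x (basisVec i)) x' =
      ((bil k x x' : ℂ) • 1 + sig k • rot c k x x') -
        sig k • (metric k (frame k α x (basisVec i)) (x - x') •
          rot c k (frame k α x (basisVec i)) x) := by
    rw [rot_transfer c hM hx' (frame_mem_tangent hx _), mul_sub, ← mul_assoc, rot_frame_sq c hn hx,
      one_mul, mul_smul_comm, mul_one, mul_smul, Complex.coe_smul (metric k _ _)]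
  simp only [h1, Finset.sum_sub_distrib, ← Finset.smul_sum, sum_metric_rot c hn hx hx']
  simp only [Finset.sum_const, Finset.card_univ, Fintype.card_fin, ← Nat.cast_smul_eq_nsmul ℂ]
  module

/-! ## The global trivialization of the spinor bundle -/

/-- The factor `(2 (1 + t))^{-1/2}`. -/
def gaugeScale (p : V n) : ℝ := (√(2 * (1 + p.1)))⁻¹

/-- The trivialization in the north frame. -/
def tauN (k : ℝ) (p : V n) : S →L[ℂ] S :=
  gaugeScale p • ((1 + p.1) • 1 + sig k • gam c p.2)

/-- The inverse of `tauN`. -/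
def tauNInv (k : ℝ) (p : V n) : S →L[ℂ] S :=
  gaugeScale p • ((1 + p.1) • 1 - sig k • gam c p.2)

lemma gaugeScale_sq {p : V n} (ht : -1 < p.1) : gaugeScale p * gaugeScale p = (2 * (1 + p.1))⁻¹ := by
  rw [gaugeScale, ← mul_inv, Real.mul_self_sqrt (by linarith)]

/-- The normalization comes from (1 + t)² + k|y|² = 2(1 + t) on the quadric. The auxiliary identity
is stated for either square root of -k because the inverse is obtained from σ ↦ -σ. -/
lemma tauN_mul_tauNInv {p : V n} (hp : bil k p p = 1) (ht : -1 < p.1) :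
    tauN c k p * tauNInv c k p = 1 ∧ tauNInv c k p * tauN c k p = 1 := by
  have h0 : (1 : ℝ) + p.1 ≠ 0 := by linarith
  have hs := sig_sq k
  have e : (1 + p.1) * (1 + p.1) + k * ‖p.2‖ ^ 2 = 2 * (1 + p.1) := by
    simp only [bil, real_inner_self_eq_norm_sq] at hp
    linarith
  have key (σ : ℂ) (hσ : σ ^ 2 = -k) :
      ((1 + p.1) • (1 : S →L[ℂ] S) + σ • gam c p.2) * ((1 + p.1) • 1 - σ • gam c p.2) =
        (2 * (1 + p.1)) • 1 := by
    have h2 : σ * σ * ((‖p.2‖ ^ 2 : ℝ) : ℂ) = ((-(k * ‖p.2‖ ^ 2) : ℝ) : ℂ) := by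
      rw [← sq, hσ]; push_cast; ring
    simp only [mul_sub, add_mul, smul_mul_assoc, mul_smul_comm, one_mul, mul_one, gam_mul_self,
      smul_smul]
    have h4 : (σ * σ * ((‖p.2‖ ^ 2 : ℝ) : ℂ)) • (1 : S →L[ℂ] S) = (-(k * ‖p.2‖ ^ 2)) • 1 := by
      rw [h2, Complex.coe_smul]
    rw [← e, smul_add σ, smul_smul σ, ← mul_assoc, h4, smul_comm σ]
    module
  have h3 : gaugeScale p * gaugeScale p * (2 * (1 + p.1)) = 1 := by
    rw [gaugeScale_sq ht, inv_mul_cancel₀ (by linarith)]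
  constructor
  · rw [tauN, tauNInv, smul_mul_smul_comm, key _ hs, smul_smul, h3, one_smul]
  · have := key (-sig k) (by rw [neg_sq, hs])
    rw [neg_smul, sub_neg_eq_add, ← sub_eq_add_neg] at this
    rw [tauN, tauNInv, smul_mul_smul_comm, this, smul_smul, h3, one_smul]

/-- This is what the trivialization is made for: it turns the constant Clifford action of the frame
components into `rot` with the position vector. -/
lemma tauN_gam {p : V n} (hp : bil k p p = 1) (ht : -1 < p.1) (v : E n) :
    tauN c k p * gam c v = rot c k (frame k .north p v) p * tauN c k p := by
  have h0 : (1 : ℂ) + p.1 ≠ 0 := by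
    rw [← Complex.ofReal_one, ← Complex.ofReal_add, Complex.ofReal_ne_zero]; linarith
  have hx : (p.1 : ℂ) ^ 2 + k * ((‖p.2‖ ^ 2 : ℝ) : ℂ) = 1 := by
    simp only [bil, real_inner_self_eq_norm_sq] at hp
    have := congrArg (fun x : ℝ => (x : ℂ)) hp
    push_cast at this ⊢
    rw [← this]; ring
  have := gauge_conj (gam_mul_self c p.2) (gam_mul_comm c p.2 v) (sig_sq k) hx h0
  rw [tauN, smul_mul_assoc, mul_smul_comm]
  congr 1
  simp only [rot, frame, map_sub, map_smul, ← Complex.coe_smul]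
  push_cast
  exact this

/-- The derivative of `tauN`. -/
def dtauN (k : ℝ) (p X : V n) : S →L[ℂ] S :=
  (-(X.1 / (2 * (1 + p.1))) * gaugeScale p) • ((1 + p.1) • 1 + sig k • gam c p.2) +
    gaugeScale p • (X.1 • 1 + sig k • gam c X.2)

/-- The derivative of `tauNInv`. -/
def dtauNInv (k : ℝ) (p X : V n) : S →L[ℂ] S :=
  (-(X.1 / (2 * (1 + p.1))) * gaugeScale p) • ((1 + p.1) • 1 - sig k • gam c p.2) +
    gaugeScale p • (X.1 • 1 - sig k • gam c X.2)

lemma hasDerivAt_gaugeScale {γ : ℝ → V n} {X : V n} {s : ℝ} (h : HasDerivAt γ X s)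
    (ht : -1 < (γ s).1) : HasDerivAt (fun s => gaugeScale (γ s))
      (-(X.1 / (2 * (1 + (γ s).1))) * gaugeScale (γ s)) s := by
  have h1 : 0 < 2 * (1 + (γ s).1) := by linarith
  have h2 := ((((hasDerivAt_fst h).const_add 1).const_mul 2).sqrt h1.ne').inv
    (Real.sqrt_pos.2 h1).ne'
  refine h2.congr_deriv ?_
  simp only [gaugeScale]
  have h3 := Real.sq_sqrt h1.le
  have h4 : √(2 * (1 + (γ s).1)) ≠ 0 := (Real.sqrt_pos.2 h1).ne'
  have h5 : (1 + (γ s).1) ≠ 0 := by linarith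
  rw [h3]
  field_simp

lemma hasDerivAt_tauN {γ : ℝ → V n} {X : V n} {s : ℝ} (h : HasDerivAt γ X s)
    (ht : -1 < (γ s).1) : HasDerivAt (fun s => tauN c k (γ s)) (dtauN c k (γ s) X) s := by
  have h1 := (gam c).hasFDerivAt.comp_hasDerivAt s (hasDerivAt_snd h)
  have h2 := (hasDerivAt_gaugeScale h ht).smul
    ((((hasDerivAt_fst h).const_add 1).smul_const (1 : S →L[ℂ] S)).add (h1.const_smul (sig k)))
  exact h2.congr_deriv (by rw [dtauN, add_comm]; rfl)

lemma hasDerivAt_tauNInv {γ : ℝ → V n} {X : V n} {s : ℝ} (h : HasDerivAt γ X s)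
    (ht : -1 < (γ s).1) : HasDerivAt (fun s => tauNInv c k (γ s)) (dtauNInv c k (γ s) X) s := by
  have h1 := (gam c).hasFDerivAt.comp_hasDerivAt s (hasDerivAt_snd h)
  have h2 := (hasDerivAt_gaugeScale h ht).smul
    ((((hasDerivAt_fst h).const_add 1).smul_const (1 : S →L[ℂ] S)).sub (h1.const_smul (sig k)))
  exact h2.congr_deriv (by rw [dtauNInv, add_comm]; rfl)

/-- The spin connection form of the north frame. -/
def spinN (k : ℝ) (p X : V n) : S →L[ℂ] S :=
  (k / (4 * (1 + p.1))) • (gam c p.2 * gam c X.2 - gam c X.2 * gam c p.2)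

lemma connection_scalars {p X : V n} (hp : bil k p p = 1) (hX : bil k p X = 0) (ht : -1 < p.1) :
    (p.1 : ℂ) ^ 2 + k * ((‖p.2‖ ^ 2 : ℝ) : ℂ) = 1 ∧ (p.1 : ℂ) * X.1 + k * (⟪p.2, X.2⟫ : ℝ) = 0 ∧
      (1 : ℂ) + p.1 ≠ 0 := by
  refine ⟨?_, ?_, ?_⟩
  · simp only [bil, real_inner_self_eq_norm_sq] at hp
    have := congrArg (fun x : ℝ => (x : ℂ)) hp
    push_cast at this ⊢
    rw [← this]; ring
  · have := congrArg (fun x : ℝ => (x : ℂ)) hX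
    simp only [bil] at this
    push_cast at this
    exact this
  · rw [← Complex.ofReal_one, ← Complex.ofReal_add, Complex.ofReal_ne_zero]; linarith

/-- The Killing equation: the columns of the inverse trivialization satisfy ∇_X s = -(σ/2) X·s. -/
lemma dtauNInv_add {p X : V n} (hp : bil k p p = 1) (hX : bil k p X = 0) (ht : -1 < p.1) :
    dtauNInv c k p X + spinN c k p X * tauNInv c k p =
      -((sig k / 2) • (tauNInv c k p * rot c k X p)) := by
  obtain ⟨h1, h2, h3⟩ := connection_scalars hp hX ht
  have := connection_inv (gam_mul_self c p.2) (gam_mul_comm c p.2 X.2) (sig_sq k) h1 h2 h3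
  rw [dtauNInv, spinN, tauNInv, mul_smul_comm, mul_comm _ (gaugeScale p), mul_smul, ← smul_add,
    ← smul_add, smul_mul_assoc (gaugeScale p), smul_comm (sig k / 2), ← smul_neg]
  congr 1
  simp only [rot, ← Complex.coe_smul]
  push_cast
  exact this

lemma dtauN_eq {p X : V n} (hp : bil k p p = 1) (hX : bil k p X = 0) (ht : -1 < p.1) :
    dtauN c k p X = tauN c k p * spinN c k p X + (sig k / 2) • (rot c k X p * tauN c k p) := by
  obtain ⟨h1, h2, h3⟩ := connection_scalars hp hX ht
  have := connection_fwd (gam_mul_self c p.2) (gam_mul_comm c p.2 X.2) (sig_sq k) h1 h2 h3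
  rw [dtauN, spinN, tauN, mul_smul_comm, mul_comm _ (gaugeScale p), mul_smul, ← smul_add,
    smul_mul_assoc, mul_smul_comm (gaugeScale p) (rot c k X p), smul_comm (sig k / 2),
    smul_comm (k / _) (gaugeScale p), ← smul_add]
  congr 1
  simp only [rot, ← Complex.coe_smul]
  push_cast
  rw [this, mul_smul_comm]

lemma contDiffAt_gaugeScale {p : V n} (ht : -1 < p.1) : ContDiffAt ℝ ∞ gaugeScale p := by
  have h1 : 0 < 2 * (1 + p.1) := by linarith
  refine ContDiffAt.inv (ContDiffAt.sqrt ?_ h1.ne') (Real.sqrt_pos.2 h1).ne'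
  exact contDiffAt_const.mul (contDiffAt_const.add contDiffAt_fst)

lemma contDiffAt_tauN {p : V n} (ht : -1 < p.1) : ContDiffAt ℝ ∞ (tauN c k) p := by
  refine (contDiffAt_gaugeScale ht).smul (ContDiffAt.add ?_ ?_)
  · exact (contDiffAt_const.add contDiffAt_fst).smul contDiffAt_const
  · exact ((gam c).contDiff.contDiffAt.comp p contDiffAt_snd).const_smul _

lemma contDiffAt_tauNInv {p : V n} (ht : -1 < p.1) : ContDiffAt ℝ ∞ (tauNInv c k) p := by
  refine (contDiffAt_gaugeScale ht).smul (ContDiffAt.sub ?_ ?_)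
  · exact (contDiffAt_const.add contDiffAt_fst).smul contDiffAt_const
  · exact ((gam c).contDiff.contDiffAt.comp p contDiffAt_snd).const_smul _

/-- The global trivialization of the spinor bundle in the frame `α`. -/
def tau (k : ℝ) : Chart → V n → S →L[ℂ] S
  | .north, p => tauN c k p
  | .south, p => Complex.I • (tauN c k (-p) * gam c (firstVec n))

/-- The inverse of `tau`. -/
def tauInv (k : ℝ) : Chart → V n → S →L[ℂ] S
  | .north, p => tauNInv c k p
  | .south, p => -Complex.I • (gam c (firstVec n) * tauNInv c k (-p))

lemma gam_firstVec (hn : 1 ≤ n) : gam c (firstVec n) * gam c (firstVec n) = 1 := by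
  rw [gam_mul_self, norm_firstVec hn]; simp

lemma gam_flip (v : E n) (hn : 1 ≤ n) :
    gam c (flip v) * gam c (firstVec n) = -(gam c (firstVec n) * gam c v) := by
  rw [flip, map_sub, map_smul, sub_mul, gam_mul_comm c (firstVec n) v, smul_mul_assoc,
    gam_firstVec c hn, ← Complex.coe_smul]
  push_cast
  abel

lemma neg_mem_north_of_mem_south {p : V n} (hp : p ∈ chartDomain n k .south) :
    bil k (-p) (-p) = 1 ∧ -1 < (-p).1 :=
  ⟨bil_self_neg (bil_self_of_mem hp.1), by simpa using hp.2⟩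

lemma tau_mul_tauInv (hn : 1 ≤ n) {α : Chart} {p : V n} (hp : p ∈ chartDomain n k α) :
    tau c k α p * tauInv c k α p = 1 ∧ tauInv c k α p * tau c k α p = 1 := by
  cases α
  · exact tauN_mul_tauNInv c (bil_self_of_mem hp.1) hp.2
  · obtain ⟨h1, h2⟩ := neg_mem_north_of_mem_south hp
    obtain ⟨h3, h4⟩ := tauN_mul_tauNInv c h1 h2
    simp only [tau, tauInv]
    constructor
    · rw [I_smul_mul, mul_assoc, ← mul_assoc (gam c _), gam_firstVec c hn, one_mul, h3]
    · rw [neg_I_smul_mul, mul_assoc, ← mul_assoc (tauNInv c k _), h4, one_mul, gam_firstVec c hn]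

lemma tau_gam (hn : 1 ≤ n) {α : Chart} {p : V n} (hp : p ∈ chartDomain n k α) (v : E n) :
    tau c k α p * gam c v = rot c k (frame k α p v) p * tau c k α p := by
  cases α
  · exact tauN_gam c (bil_self_of_mem hp.1) hp.2 v
  · obtain ⟨h1, h2⟩ := neg_mem_north_of_mem_south hp
    simp only [tau]
    have h := tauN_gam c h1 h2 (flip v)
    have h3 := gam_flip c v hn
    rw [frame_south, smul_mul_assoc, mul_assoc, ← neg_eq_iff_eq_neg.2 h3, mul_neg, ← mul_assoc, h,
      mul_smul_comm, ← neg_one_smul ℝ p, rot_smul_right, mul_assoc]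
    simp

/-! ## The spin connection -/

/-- The spin connection form of the frame `α`. -/
def spinA (k : ℝ) : Chart → V n → V n → S →L[ℂ] S
  | .north, p, X => spinN c k p X
  | .south, p, X => gam c (firstVec n) * spinN c k (-p) (-X) * gam c (firstVec n)

lemma fderiv_frame_north {p X : V n} (ht : -1 < p.1) (v : E n) :
    fderiv ℝ (fun q => frame k .north q v) p X =
      (-(k * ⟪X.2, v⟫), -(((k * ⟪X.2, v⟫) * (1 + p.1) - k * ⟪p.2, v⟫ * X.1) / (1 + p.1) ^ 2) • p.2 -
        (k * ⟪p.2, v⟫ / (1 + p.1)) • X.2) := by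
  have h0 : (1 : ℝ) + p.1 ≠ 0 := by linarith
  have hd : DifferentiableAt ℝ (fun q : V n => frame k .north q v) p := by
    simp only [frame]
    have h1 : DifferentiableAt ℝ (fun q : V n => ⟪q.2, v⟫) p :=
      differentiableAt_snd.inner ℝ (differentiableAt_const v)
    have h2 : DifferentiableAt ℝ (fun q : V n => (1 + q.1)) p :=
      (differentiableAt_const _).add differentiableAt_fst
    have h3 : DifferentiableAt ℝ (fun q : V n => (k * ⟪q.2, v⟫ / (1 + q.1)) • q.2) p :=
      (((h1.const_mul k).mul (h2.inv h0)).smul differentiableAt_snd :)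
    exact (h1.const_mul k).neg.prodMk ((differentiableAt_const v).sub h3)
  have hγ : HasDerivAt (fun s : ℝ => p + s • X) X 0 := by
    simpa using ((hasDerivAt_id (0 : ℝ)).smul_const X).const_add p
  have h1 := hd.hasFDerivAt.comp_hasDerivAt_of_eq (0 : ℝ) hγ (by simp)
  refine h1.unique ?_
  have i1 : HasDerivAt (fun s : ℝ => k * ⟪(p + s • X).2, v⟫) (k * ⟪X.2, v⟫) 0 := by
    have := ((hasDerivAt_snd hγ).inner ℝ (hasDerivAt_const (0 : ℝ) v)).const_mul k
    exact this.congr_deriv (by simp)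
  have i2 : HasDerivAt (fun s : ℝ => 1 + (p + s • X).1) X.1 0 := (hasDerivAt_fst hγ).const_add 1
  have i3 := i1.neg.prodMk (((i1.div i2 (by simpa using h0)).smul (hasDerivAt_snd hγ)).const_sub v)
  refine i3.congr_deriv (Prod.ext rfl ?_)
  simp only [zero_smul, add_zero, Pi.div_apply]
  module

lemma connForm_north {p X : V n} (hp : bil k p p = 1) (hX : bil k p X = 0) (ht : -1 < p.1)
    (v w : E n) :
    metric k (fderiv ℝ (fun q => frame k .north q v) p X) (frame k .north p w) =
      k / (1 + p.1) * (⟪X.2, v⟫ * ⟪p.2, w⟫ - ⟪p.2, v⟫ * ⟪X.2, w⟫) := by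
  have h0 : (1 : ℝ) + p.1 ≠ 0 := by linarith
  rw [fderiv_frame_north ht]
  simp only [bil] at hp hX
  simp only [metric, frame, inner_sub_right, inner_sub_left, inner_neg_left, neg_smul,
    real_inner_smul_right, real_inner_smul_left, real_inner_comm p.2 X.2]
  rw [show -(k * ⟪X.2, v⟫) * -(k * ⟪p.2, w⟫) / k = k * (⟪X.2, v⟫ * ⟪p.2, w⟫) by
    by_cases hk : k = 0
    · simp [hk]
    · field_simp]
  field_simp
  linear_combination k * ⟪p.2, w⟫ * (⟪X.2, v⟫ * (1 + p.1) - ⟪p.2, v⟫ * X.1) * hp +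
    k * ⟪p.2, w⟫ * (1 + p.1) * ⟪p.2, v⟫ * hX

/-- Chain rule along p ↦ -p; the signs of p and X are kept so that the north formula applies
verbatim. -/
lemma connForm_south {p X : V n} (hp : bil k (-p) (-p) = 1) (hX : bil k p X = 0)
    (ht : -1 < (-p).1) (v w : E n) :
    metric k (fderiv ℝ (fun q => frame k .south q v) p X) (frame k .south p w) =
      k / (1 + (-p).1) * (⟪(-X).2, flip v⟫ * ⟪(-p).2, flip w⟫ -
        ⟪(-p).2, flip v⟫ * ⟪(-X).2, flip w⟫) := by
  have h : fderiv ℝ (fun q => frame k .south q v) p X =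
      fderiv ℝ (fun q => frame k .north q (flip v)) (-p) (-X) := by
    simp only [frame_south]
    have := fderiv_comp_smul (𝕜 := ℝ) (f := fun q : V n => frame k .north q (flip v)) (-1) (x := p)
    simp only [neg_smul, one_smul] at this
    rw [this]
    simp
  rw [h, frame_south, connForm_north hp (by rw [bil_neg_left, ← neg_one_smul ℝ X, bil_smul_right, hX]; simp) ht]

lemma flip_adjoint (v w : E n) : ⟪v, flip w⟫ = ⟪flip v, w⟫ := by
  simp only [flip, inner_sub_left, inner_sub_right, real_inner_smul_left, real_inner_smul_right,
    real_inner_comm (firstVec n) v]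
  ring

/-- Expanding both vectors in the standard basis; this collapses the double sum in `spinForm` to a
commutator. -/
lemma sum_bivector (u v : E n) :
    ∑ i, ∑ j, (⟪v, basisVec i⟫ * ⟪u, basisVec j⟫ - ⟪u, basisVec i⟫ * ⟪v, basisVec j⟫) •
      (gam c (basisVec j) * gam c (basisVec i)) = gam c u * gam c v - gam c v * gam c u := by
  have h (u : E n) : gam c u = ∑ i, ⟪u, basisVec i⟫ • gam c (basisVec i) := by
    have := (EuclideanSpace.basisFun (Fin n) ℝ).sum_repr' u
    simp only [EuclideanSpace.basisFun_apply] at this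
    conv_lhs => rw [← this]
    simp only [map_sum, map_smul, basisVec, real_inner_comm]
  conv_rhs => rw [h u, h v]
  simp only [Finset.sum_mul_sum, smul_mul_smul_comm, sub_smul, Finset.sum_sub_distrib]
  congr 1
  · rw [Finset.sum_comm]
    simp only [mul_comm]
  · rw [Finset.sum_comm]
    simp only [mul_comm]

/-- In the north frame the connection form is the bivector of y and X. In the south frame both
vectors are reflected by `flip`, which on products of two vectors is conjugation by the first basis
vector. -/
lemma spinForm_apply {α : Chart} {p X : V n} (hp : p ∈ chartDomain n k α) (hX : X ∈ tangent k p)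
    (hn : 1 ≤ n) (s : S) : spinForm k c α p X s = spinA c k α p X s := by
  have h0 (a : Fin n → Fin n → ℝ) : ((1 / 4 : ℝ) • ∑ i, ∑ j,
      a i j • c (vec (basisVec j) * vec (basisVec i))) s =
      ((1 / 4 : ℝ) • ∑ i, ∑ j, a i j • (gam c (basisVec j) * gam c (basisVec i))) s := by
    simp only [LinearMap.smul_apply, LinearMap.sum_apply, smul_apply, sum_apply, gam_mul_apply]
  rw [spinForm, h0]
  congr 1
  rw [mem_tangent] at hX
  cases α
  · simp only [connForm, connForm_north (bil_self_of_mem hp.1) hX hp.2, mul_smul, ← Finset.smul_sum,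
      sum_bivector, spinA, spinN]
    rw [smul_smul, div_mul_div_comm, one_mul]
  · obtain ⟨h1, h2⟩ := neg_mem_north_of_mem_south hp
    simp only [connForm, connForm_south h1 hX h2, mul_smul, ← Finset.smul_sum, flip_adjoint,
      sum_bivector, spinA, spinN]
    have key (v w : E n) : gam c (flip v) * gam c (flip w) =
        gam c (firstVec n) * (gam c v * gam c w) * gam c (firstVec n) := by
      have e1 := gam_flip c v hn
      have e2 := gam_flip c w hn
      have e3 := gam_firstVec c hn
      calc gam c (flip v) * gam c (flip w)
          = (gam c (flip v) * gam c (firstVec n)) * (gam c (firstVec n) *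
            (gam c (flip w) * gam c (firstVec n)) * gam c (firstVec n)) := by
              rw [mul_assoc, mul_assoc, mul_assoc, ← mul_assoc (gam c (firstVec n)) (gam c (firstVec n)),
                e3, one_mul, mul_one]
        _ = _ := by
              rw [e1, e2]
              simp only [mul_neg, neg_mul, neg_neg, mul_assoc]
              rw [← mul_assoc (gam c (firstVec n)) (gam c (firstVec n)), e3, one_mul]
    rw [smul_smul, div_mul_div_comm, one_mul, key, key, mul_smul_comm, smul_mul_assoc, mul_sub,
      sub_mul]

end

section

/-! ## Calculus of operator-valued functions -/

section Calculus

variable {S : Type*} [NormedAddCommGroup S] [NormedSpace ℂ S]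

lemma clm_mul_apply (A B : S →L[ℂ] S) (s : S) : (A * B) s = A (B s) := rfl

/-- The operators are ℂ-linear but are differentiated over ℝ, so scalars are restricted before the
product rule is applied. -/
lemma hasDerivWithinAt_apply {T : ℝ → S →L[ℂ] S} {T' : S →L[ℂ] S} {u : ℝ → S} {u' : S}
    {s : Set ℝ} {t : ℝ} (hT : HasDerivWithinAt T T' s t) (hu : HasDerivWithinAt u u' s t) :
    HasDerivWithinAt (fun t => T t (u t)) (T' (u t) + T t u') s t := by
  have h := (ContinuousLinearMap.restrictScalarsL ℂ S S ℝ ℝ).hasFDerivAt.comp_hasDerivWithinAt t hT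
  exact h.clm_apply hu

lemma contDiffAt_apply {E : Type*} [NormedAddCommGroup E] [NormedSpace ℝ E] {T : E → S →L[ℂ] S}
    {u : E → S} {x : E} {m : WithTop ℕ∞} (hT : ContDiffAt ℝ m T x) (hu : ContDiffAt ℝ m u x) :
    ContDiffAt ℝ m (fun x => T x (u x)) x := by
  have h := (ContinuousLinearMap.restrictScalarsL ℂ S S ℝ ℝ).contDiff.contDiffAt.comp x hT
  exact h.clm_apply hu

end Calculus

variable {n : ℕ} {k : ℝ} {S : Type*} [NormedAddCommGroup S] [NormedSpace ℂ S]
  [FiniteDimensional ℂ S] (c : Cl n →ₐ[ℝ] Module.End ℂ S)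

/-! ## Differentiation in the global trivialization -/

lemma bil_neg_neg (p X : V n) : bil k (-p) (-X) = bil k p X := by
  simp [bil]

lemma hasDerivAt_tauInv (hn : 1 ≤ n) {α : Chart} {γ : ℝ → V n} {X : V n} {s : ℝ}
    (h : HasDerivAt γ X s) (hγ : γ s ∈ chartDomain n k α) (hX : X ∈ tangent k (γ s)) :
    HasDerivAt (fun s => tauInv c k α (γ s))
      (-((sig k / 2) • (tauInv c k α (γ s) * rot c k X (γ s))) -
        spinA c k α (γ s) X * tauInv c k α (γ s)) s := by
  cases α
  · refine (hasDerivAt_tauNInv c h hγ.2).congr_deriv ?_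
    exact eq_sub_of_add_eq (dtauNInv_add c (bil_self_of_mem hγ.1) hX hγ.2)
  · obtain ⟨h1, h2⟩ := neg_mem_north_of_mem_south hγ
    have h3 := (hasDerivAt_tauNInv c (k := k) h.neg h2).const_mul (gam c (firstVec n))
    have h4 := eq_sub_of_add_eq (dtauNInv_add c h1 ((bil_neg_neg (γ s) X).trans hX) h2)
    refine (h3.const_smul (-Complex.I)).congr_deriv ?_
    simp only [tauInv, spinA]
    rw [Pi.neg_apply, h4, rot_neg_neg, mul_sub, smul_sub, mul_neg, smul_neg, mul_smul_comm,
      smul_mul_assoc, mul_smul_comm, smul_comm (sig k / 2), mul_assoc (gam c _) (tauNInv c k _)]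
    congr 2
    rw [mul_assoc, mul_assoc, ← mul_assoc (gam c (firstVec n)) (gam c (firstVec n)),
      gam_firstVec c hn, one_mul]

lemma hasDerivAt_tau (hn : 1 ≤ n) {α : Chart} {γ : ℝ → V n} {X : V n} {s : ℝ}
    (h : HasDerivAt γ X s) (hγ : γ s ∈ chartDomain n k α) (hX : X ∈ tangent k (γ s)) :
    HasDerivAt (fun s => tau c k α (γ s))
      (tau c k α (γ s) * spinA c k α (γ s) X +
        (sig k / 2) • (rot c k X (γ s) * tau c k α (γ s))) s := by
  cases α
  · exact (hasDerivAt_tauN c h hγ.2).congr_deriv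
      (dtauN_eq c (bil_self_of_mem hγ.1) hX hγ.2)
  · obtain ⟨h1, h2⟩ := neg_mem_north_of_mem_south hγ
    have h3 := (hasDerivAt_tauN c (k := k) h.neg h2).mul_const (gam c (firstVec n))
    have h4 := dtauN_eq c h1 ((bil_neg_neg (γ s) X).trans hX) h2
    refine (h3.const_smul Complex.I).congr_deriv ?_
    simp only [tau, spinA]
    rw [Pi.neg_apply, h4, rot_neg_neg, add_mul, smul_add, smul_mul_assoc, mul_smul_comm,
      smul_mul_assoc, smul_comm (sig k / 2), mul_assoc (rot c k X _)]
    congr 2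
    rw [mul_assoc, mul_assoc, mul_assoc, ← mul_assoc (gam c (firstVec n)) (gam c (firstVec n)),
      gam_firstVec c hn, one_mul]

lemma contDiffAt_tau {α : Chart} {p : V n} (hp : p ∈ chartDomain n k α) :
    ContDiffAt ℝ ∞ (tau c k α) p := by
  cases α
  · exact contDiffAt_tauN c hp.2
  · have h := (contDiffAt_tauN c (k := k) (neg_mem_north_of_mem_south hp).2).comp p contDiff_neg.contDiffAt
    exact (h.mul contDiffAt_const).const_smul _

lemma contDiffAt_tauInv {α : Chart} {p : V n} (hp : p ∈ chartDomain n k α) :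
    ContDiffAt ℝ ∞ (tauInv c k α) p := by
  cases α
  · exact contDiffAt_tauNInv c hp.2
  · have h := (contDiffAt_tauNInv c (k := k) (neg_mem_north_of_mem_south hp).2).comp p contDiff_neg.contDiffAt
    exact (contDiffAt_const.mul h).const_smul _

lemma pos_of_mem_south {p : V n} (hp : p ∈ chartDomain n k .south) : 0 < k := by
  by_contra hk
  have h1 := hp.1.1
  have h2 := hp.1.2 (not_lt.1 hk)
  have h3 : p.1 < 1 := hp.2
  nlinarith [sq_nonneg ‖p.2‖]

/-- The transition function relates the two trivializations. -/
lemma tau_transition (hn : 1 ≤ n) {p : V n} (hp : p ∈ chartDomain n k .south) (ht : -1 < p.1) :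
    tau c k .south p * (gam c (firstVec n) * gam c (‖p.2‖⁻¹ • p.2)) = tau c k .north p := by
  have hk := pos_of_mem_south hp
  have ht' : p.1 < 1 := hp.2
  have h1 : p.1 ^ 2 + k * ‖p.2‖ ^ 2 = 1 := hp.1.1
  have hy : 0 < ‖p.2‖ := by
    rcases (norm_nonneg p.2).eq_or_lt with h | h
    · rw [← h] at h1; nlinarith
    · exact h
  have hA : 0 < √(2 * (1 + p.1)) := Real.sqrt_pos.2 (by linarith)
  have hB : 0 < √(2 * (1 + (-p).1)) := Real.sqrt_pos.2 (by simp; linarith)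
  have hA2 : √(2 * (1 + p.1)) ^ 2 = 2 * (1 + p.1) := Real.sq_sqrt (by linarith)
  have hB2 : √(2 * (1 + (-p).1)) ^ 2 = 2 * (1 - p.1) := by
    rw [Real.sq_sqrt (by simp; linarith)]; simp; ring
  have hAB : √(2 * (1 + p.1)) * √(2 * (1 + (-p).1)) = 2 * (√k * ‖p.2‖) := by
    rw [← Real.sqrt_mul (by linarith), show 2 * (1 + p.1) * (2 * (1 + (-p).1)) =
      k * (2 * ‖p.2‖) ^ 2 by simp; linarith, Real.sqrt_mul hk.le, Real.sqrt_sq (by positivity)]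
    ring
  set A := √(2 * (1 + p.1)) with hAd
  set B := √(2 * (1 + (-p).1)) with hBd
  -- Half-angle formulas: for t = cos ϑ the numbers A and B are 2cos(ϑ/2) and 2sin(ϑ/2).
  have e1 : B⁻¹ * (√k * ‖p.2‖) = A⁻¹ * (1 + p.1) := by
    field_simp
    linear_combination B / 2 * hA2 - A / 2 * hAB
  have e2 : B⁻¹ * ‖p.2‖⁻¹ * (1 - p.1) = A⁻¹ * √k := by
    field_simp
    linear_combination B / 2 * hAB - A / 2 * hB2
  -- The south chart occurs only for k > 0, where σ = i√k; the factor i in the south case of `tau`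
  -- is there to match it.
  have hσ : sig k = Complex.I * (√k : ℂ) := by simp [sig, hk]
  simp only [tau]
  rw [smul_mul_assoc, mul_assoc, ← mul_assoc (gam c (firstVec n)), gam_firstVec c hn, one_mul,
    map_smul, tauN, tauN, gaugeScale, gaugeScale, ← hAd, ← hBd, mul_smul_comm, smul_mul_assoc, add_mul,
    smul_mul_assoc, smul_mul_assoc, Prod.snd_neg, map_neg, neg_mul, gam_mul_self, one_mul, hσ]
  simp only [← Complex.coe_smul, smul_smul, smul_add, smul_neg]
  have e1' := congrArg (fun x : ℝ => (x : ℂ)) e1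
  have e2' := congrArg (fun x : ℝ => (x : ℂ)) e2
  have hy' : (‖p.2‖ : ℂ) ≠ 0 := by exact_mod_cast hy.ne'
  push_cast at e1' e2'
  have f1 : Complex.I * ((‖p.2‖⁻¹ : ℝ) : ℂ) * ((B⁻¹ : ℝ) : ℂ) * (Complex.I * (√k : ℂ) * ((‖p.2‖ ^ 2 : ℝ) : ℂ))
      = -(((A⁻¹ : ℝ) : ℂ) * ((1 + p.1 : ℝ) : ℂ)) := by
    push_cast
    rw [← e1']
    field_simp
    rw [Complex.I_sq]; ring
  have f2 : Complex.I * ((‖p.2‖⁻¹ : ℝ) : ℂ) * ((B⁻¹ : ℝ) : ℂ) * ((1 + (-p).1 : ℝ) : ℂ) =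
      ((A⁻¹ : ℝ) : ℂ) * (Complex.I * (√k : ℂ)) := by
    push_cast
    simp only [Prod.fst_neg, Complex.ofReal_neg]
    linear_combination Complex.I * e2'
  simp only [← mul_assoc] at f1 f2 ⊢
  rw [f1, f2]
  module

lemma chartAt_of_lt {p : V n} (h : -1 < p.1) : chartAt p = .north := by simp [chartAt, h]

lemma chartAt_of_not_lt {p : V n} (h : ¬ -1 < p.1) : chartAt p = .south := by simp [chartAt, h]

/-- Independence of the chart, so `glob` is one function on all of M and chart changes disappear
from the computation. -/
lemma tau_toChart (hn : 1 ≤ n) {α : Chart} {p : V n} (hp : p ∈ chartDomain n k α) (v : S) :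
    tau c k α p (toChart c α p v) = tau c k (chartAt p) p v := by
  by_cases h : -1 < p.1
  · have hc := chartAt_of_lt h
    cases α
    · simp only [toChart, hc]
    · simp only [toChart, hc]
      rw [← gam_mul_apply, ← clm_mul_apply, tau_transition c hn hp h]
  · have hc := chartAt_of_not_lt h
    cases α
    · exact absurd hp.2 h
    · simp only [toChart, hc]

lemma tauInv_tau (hn : 1 ≤ n) {α : Chart} {p : V n} (hp : p ∈ chartDomain n k α) (v : S) :
    tauInv c k α p (tau c k α p v) = v := by
  rw [← clm_mul_apply, (tau_mul_tauInv c hn hp).2]; rfl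

lemma tau_tauInv (hn : 1 ≤ n) {α : Chart} {p : V n} (hp : p ∈ chartDomain n k α) (v : S) :
    tau c k α p (tauInv c k α p v) = v := by
  rw [← clm_mul_apply, (tau_mul_tauInv c hn hp).1]; rfl

/-- A spinor in the global trivialization. -/
def glob (k : ℝ) (ψ : V n → S) (p : V n) : S := tau c k (chartAt p) p (ψ p)

lemma localRep_eq (hn : 1 ≤ n) {α : Chart} {p : V n} (hp : p ∈ chartDomain n k α) (ψ : V n → S) :
    localRep c α ψ p = tauInv c k α p (glob c k ψ p) := by
  rw [glob, ← tau_toChart c hn hp, tauInv_tau c hn hp, localRep]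

lemma glob_eq_localRep (hn : 1 ≤ n) {α : Chart} {p : V n} (hp : p ∈ chartDomain n k α)
    (ψ : V n → S) : glob c k ψ p = tau c k α p (localRep c α ψ p) := by
  rw [localRep, tau_toChart c hn hp, glob]

lemma eventually_mem_chartDomain {γ : ℝ → V n} {s : ℝ} {α : Chart} (hc : ContinuousAt γ s)
    (hM : ∀ t, γ t ∈ M n k) (hs : γ s ∈ chartDomain n k α) :
    ∀ᶠ t in nhds s, γ t ∈ chartDomain n k α := by
  cases α
  · filter_upwards [hc.fst.eventually (lt_mem_nhds hs.2)] with t ht using ⟨hM t, ht⟩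
  · filter_upwards [hc.fst.eventually (gt_mem_nhds hs.2)] with t ht using ⟨hM t, ht⟩

/-- The derivative of the inverse trivialization cancels the spin connection form and leaves only
the Killing term. -/
lemma tau_covDeriv (hn : 1 ≤ n) {ψ φ : V n → S} (hφ : ∀ x ∈ M n k, glob c k ψ x = φ x)
    {α : Chart} {x : V n} (hx : x ∈ chartDomain n k α) (hd : DifferentiableAt ℝ φ x)
    {X : V n} (hX : X ∈ tangent k x) :
    tau c k α x (covDeriv k c α ψ x X) =
      fderiv ℝ φ x X - (sig k / 2) • rot c k X x (φ x) := by
  have hM := mem_M_of_mem_chartDomain hx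
  have hloc {q : V n} (hq : q ∈ chartDomain n k α) :
      localRep c α ψ q = tauInv c k α q (φ q) := by
    rw [localRep_eq c hn hq, hφ q (mem_M_of_mem_chartDomain hq)]
  have hdiff : DifferentiableWithinAt ℝ (localRep c α ψ) (chartDomain n k α) x := by
    have h1 : DifferentiableAt ℝ (fun q => (ContinuousLinearMap.restrictScalarsL ℂ S S ℝ ℝ)
        (tauInv c k α q) (φ q)) x :=
      (((ContinuousLinearMap.restrictScalarsL ℂ S S ℝ ℝ).differentiableAt.comp x
        ((contDiffAt_tauInv c hx).differentiableAt (by simp))).clm_apply hd)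
    exact h1.differentiableWithinAt.congr (fun q hq => hloc hq) (hloc hx)
  -- The chart domain is thin in the ambient space, so the derivative within it is evaluated along a
  -- geodesic that stays in M and has velocity X.
  have hg := hasDerivAt_geo_zero (k := k) x X
  have hmem := geo_mem hM hX
  have hev : ∀ᶠ t in nhds (0 : ℝ), geo k x X t ∈ chartDomain n k α :=
    eventually_mem_chartDomain hg.continuousAt hmem (by rw [geo_zero]; exact hx)
  have h1 : HasDerivAt (fun s => localRep c α ψ (geo k x X s))
      (fderivWithin ℝ (localRep c α ψ) (chartDomain n k α) x X) 0 := by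
    have hw := hdiff.hasFDerivWithinAt
    have h0 := geo_zero (k := k) x X
    rw [← h0] at hw
    have h2 := hw.comp_hasDerivWithinAt (s := {t | geo k x X t ∈ chartDomain n k α}) (0 : ℝ)
      hg.hasDerivWithinAt (fun t ht => ht)
    have h3 := h2.hasDerivAt hev
    rw [h0] at h3
    exact h3
  have hT := hasDerivAt_tauInv c hn (s := 0) hg (by rw [geo_zero]; exact hx)
    (by rw [geo_zero]; exact hX)
  have hu : HasDerivAt (fun s => φ (geo k x X s)) (fderiv ℝ φ x X) 0 :=
    hd.hasFDerivAt.comp_hasDerivAt_of_eq 0 hg (geo_zero x X).symm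
  have h2 := (hasDerivWithinAt_apply (hT.hasDerivWithinAt (s := univ)) hu.hasDerivWithinAt)
  rw [hasDerivWithinAt_univ] at h2
  have h3 := h1.unique (h2.congr_of_eventuallyEq (hev.mono fun t ht => hloc ht))
  rw [geo_zero] at h3
  rw [covDeriv, h3, spinForm_apply c hx hX hn, hloc hx, map_add, map_add, tau_tauInv c hn hx]
  have e : (-((sig k / 2) • (tauInv c k α x * rot c k X x)) -
      spinA c k α x X * tauInv c k α x) (φ x) =
      -((sig k / 2) • tauInv c k α x (rot c k X x (φ x))) - spinA c k α x X (tauInv c k α x (φ x)) :=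
    rfl
  rw [e, map_sub, map_neg, map_smul, tau_tauInv c hn hx]
  abel

/-- The Dirac operator in the global trivialization. -/
lemma glob_dirac (hn : 1 ≤ n) {ψ φ : V n → S} (hφ : ∀ x ∈ M n k, glob c k ψ x = φ x)
    {x : V n} (hx : x ∈ M n k) (hd : DifferentiableAt ℝ φ x) :
    glob c k (dirac k c ψ) x =
      ∑ i, rot c k (frame k (chartAt x) x (basisVec i)) x
        (fderiv ℝ φ x (frame k (chartAt x) x (basisVec i))) - ((n : ℂ) * sig k / 2) • φ x := by
  have hc := mem_chartDomain_chartAt hx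
  rw [glob, dirac, map_sum]
  have h (i : Fin n) : tau c k (chartAt x) x (c (vec (basisVec i))
      (covDeriv k c (chartAt x) ψ x (frame k (chartAt x) x (basisVec i)))) =
      rot c k (frame k (chartAt x) x (basisVec i)) x
        (fderiv ℝ φ x (frame k (chartAt x) x (basisVec i))) - (sig k / 2) • φ x := by
    rw [← gam_apply, ← clm_mul_apply, tau_gam c hn hc,
      clm_mul_apply, tau_covDeriv c hn hφ hc hd (frame_mem_tangent hc _), map_sub,
      map_smul, ← clm_mul_apply (rot c k _ _), rot_frame_sq c hn hc]
    rfl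
  simp only [h, Finset.sum_sub_distrib, Finset.sum_const, Finset.card_univ, Fintype.card_fin,
    ← Nat.cast_smul_eq_nsmul ℂ, smul_smul, mul_div_assoc]

lemma glob_cliff (hn : 1 ≤ n) {x : V n} (hx : x ∈ M n k) (θ : E n) (v : S) :
    tau c k (chartAt x) x (cliff k c x (-frame k (chartAt x) x θ) v) =
      -rot c k (frame k (chartAt x) x θ) x (tau c k (chartAt x) x v) := by
  have hc := mem_chartDomain_chartAt hx
  have h : cliff k c x (-frame k (chartAt x) x θ) v = -gam c θ v := by
    have e : θ = ∑ i, ⟪θ, basisVec i⟫ • basisVec i := by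
      have := (EuclideanSpace.basisFun (Fin n) ℝ).sum_repr' θ
      simp only [EuclideanSpace.basisFun_apply] at this
      conv_lhs => rw [← this]
      simp only [basisVec, real_inner_comm]
    conv_rhs => rw [e]
    simp only [cliff, metric_neg_left, metric_frame hn hc, neg_smul, Finset.sum_neg_distrib, map_sum,
      map_smul, sum_apply, smul_apply, gam_apply]
  rw [h, map_neg, ← clm_mul_apply, tau_gam c hn hc, clm_mul_apply]

end

section

variable {n : ℕ} {k : ℝ} {S : Type*} [NormedAddCommGroup S] [NormedSpace ℂ S]
  [FiniteDimensional ℂ S] (c : Cl n →ₐ[ℝ] Module.End ℂ S)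

/-! ## Parallel transport -/

/-- The conditions in all charts amount to one linear differential equation φ' = (σ/2) rot(γ',γ) φ
in the global trivialization. -/
lemma isParallel_iff (hn : 1 ≤ n) {γ : ℝ → V n} (hγ : Differentiable ℝ γ)
    (hM : ∀ t, γ t ∈ M n k) (Ψ : ℝ → S) :
    IsParallel k c γ Ψ ↔ ∀ t ∈ Icc (0 : ℝ) 1,
      HasDerivWithinAt (fun s => tau c k (chartAt (γ s)) (γ s) (Ψ s))
        ((sig k / 2) • rot c k (deriv γ t) (γ t) (tau c k (chartAt (γ t)) (γ t) (Ψ t)))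
        (Icc 0 1) t := by
  have hX (t : ℝ) : deriv γ t ∈ tangent k (γ t) :=
    deriv_mem_tangent (hγ t).hasDerivAt (Filter.Eventually.of_forall hM)
  constructor
  · intro h t ht
    have hc := mem_chartDomain_chartAt (hM t)
    have hev := eventually_mem_chartDomain (hγ t).continuousAt hM hc
    have h1 := hasDerivWithinAt_apply
      ((hasDerivAt_tau c hn (hγ t).hasDerivAt hc (hX t)).hasDerivWithinAt) (h t ht _ hc)
    have h2 := h1.congr_of_eventuallyEq
      (f₁ := fun s => tau c k (chartAt (γ s)) (γ s) (Ψ s))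
      (nhdsWithin_le_nhds (hev.mono fun s hs => (tau_toChart c hn hs (Ψ s)).symm))
      (tau_toChart c hn hc (Ψ t)).symm
    refine h2.congr_deriv ?_
    conv_rhs => rw [← tau_toChart c hn hc (Ψ t)]
    rw [spinForm_apply c hc (hX t) hn]
    rw [add_apply, smul_apply, clm_mul_apply, clm_mul_apply, map_neg]
    abel
  · intro h t ht α hc
    have hev := eventually_mem_chartDomain (hγ t).continuousAt hM hc
    have h1 := hasDerivWithinAt_apply
      ((hasDerivAt_tauInv c hn (hγ t).hasDerivAt hc (hX t)).hasDerivWithinAt) (h t ht)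
    have e {s : ℝ} (hs : γ s ∈ chartDomain n k α) : toChart c α (γ s) (Ψ s) =
        tauInv c k α (γ s) (tau c k (chartAt (γ s)) (γ s) (Ψ s)) := by
      rw [← tau_toChart c hn hs, tauInv_tau c hn hs]
    have h2 := h1.congr_of_eventuallyEq
      (f₁ := fun s => toChart c α (γ s) (Ψ s))
      (nhdsWithin_le_nhds (hev.mono fun s hs => e hs)) (e hc)
    refine h2.congr_deriv ?_
    rw [spinForm_apply c hc (hX t) hn, e hc]
    rw [sub_apply, neg_apply, smul_apply, clm_mul_apply, clm_mul_apply, map_smul]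
    abel

/-- Position and velocity move inside the plane of x and v by a map of determinant cs² + e sn² = 1,
and `rot` is alternating. The transport equation therefore has constant coefficients. -/
lemma rot_geo (x v : V n) (s : ℝ) :
    rot c k (deriv (geo k x v) s) (geo k x v s) = rot c k v x := by
  rw [deriv_geo, geo]
  simp only [rot_add_left, rot_add_right, rot_smul_left, rot_smul_right, rot_self, rot_swap c v x]
  have h := cs_sq_add (bil k v v) s
  have : rot c k v x = (cs (bil k v v) s ^ 2 + bil k v v * sn (bil k v v) s ^ 2) • rot c k v x := by
    rw [h, one_smul]
  conv_rhs => rw [this]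
  module

/-- The parallel transport along a geodesic in the global trivialization. -/
def geoTransport (k : ℝ) (x v : V n) (s : ℝ) : S →L[ℂ] S :=
  cs (bil k v v) (s / 2) • 1 + sn (bil k v v) (s / 2) • (sig k • rot c k v x)

lemma hasDerivAt_half {f : ℝ → ℝ} {f' s : ℝ} (h : HasDerivAt f f' (s / 2)) :
    HasDerivAt (fun s => f (s / 2)) (f' / 2) s := by
  have := h.comp s ((hasDerivAt_id s).div_const 2)
  exact this.congr_deriv (by ring)

lemma transport_geo (hn : 1 ≤ n) {x v : V n} (hx : x ∈ M n k) (hv : v ∈ tangent k x) (u : S)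
    {Ψ : ℝ → S} (hΨ : IsParallel k c (geo k x v) Ψ) (h0 : Ψ 0 = u) :
    tau c k (chartAt (geo k x v 1)) (geo k x v 1) (Ψ 1) =
      geoTransport c k x v 1 (tau c k (chartAt x) x u) := by
  have hdiff : Differentiable ℝ (geo k x v) := (contDiff_geo x v).differentiable (by simp)
  rw [isParallel_iff c hn hdiff (geo_mem hx hv)] at hΨ
  set φ : ℝ → S := fun s => tau c k (chartAt (geo k x v s)) (geo k x v s) (Ψ s) with hφ
  have hW := rot_sq_of_tangent c hx hv
  set W := sig k • rot c k v x with hWd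
  set e := bil k v v
  -- T s is the inverse of `geoTransport` at time s, because W² = -e; uniqueness follows from T s (φ
  -- s) being constant.
  let T : ℝ → S →L[ℂ] S := fun s => cs e (s / 2) • 1 - sn e (s / 2) • W
  have hT (s : ℝ) : HasDerivAt T ((-e * sn e (s / 2) / 2) • 1 - (cs e (s / 2) / 2) • W) s :=
    ((hasDerivAt_half (hasDerivAt_cs e (s / 2))).smul_const (1 : S →L[ℂ] S)).sub
      ((hasDerivAt_half (hasDerivAt_sn e (s / 2))).smul_const W)
  have hWW (u : S) : W (W u) = -e • u := by
    rw [← clm_mul_apply, hW, smul_apply, one_apply_eq_self, ← Complex.ofReal_neg, Complex.coe_smul]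
  have hd (t : ℝ) (ht : t ∈ Icc (0 : ℝ) 1) :
      HasDerivWithinAt (fun s => T s (φ s)) 0 (Icc 0 1) t := by
    have h1 := hasDerivWithinAt_apply (hT t).hasDerivWithinAt (hΨ t ht)
    refine h1.congr_deriv ?_
    rw [rot_geo]
    have h2 : (sig k / 2) • rot c k v x (φ t) = (1 / 2 : ℝ) • W (φ t) := by
      rw [hWd, smul_apply, ← Complex.coe_smul, smul_smul]
      congr 1
      push_cast
      ring
    change _ + T t ((sig k / 2) • rot c k v x (φ t)) = 0
    rw [h2]
    simp only [T, sub_apply, smul_apply, one_apply_eq_self, ContinuousLinearMap.map_smul_of_tower, hWW]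
    module
  have hconst := constant_of_derivWithin_zero
    (fun t ht => (hd t ht).differentiableWithinAt)
    (fun t ht => (hd t (Ico_subset_Icc_self ht)).derivWithin
      (uniqueDiffOn_Icc zero_lt_one t (Ico_subset_Icc_self ht))) 1 (by simp)
  have hT0 : T 0 (φ 0) = tau c k (chartAt x) x u := by
    simp only [T, zero_div, cs_zero, sn_zero, zero_smul, sub_zero, one_smul, hφ, geo_zero, h0]
    rfl
  rw [hT0] at hconst
  rw [← hconst]
  change φ 1 = (cs e (1 / 2) • 1 + sn e (1 / 2) • W) ((cs e (1 / 2) • 1 - sn e (1 / 2) • W) (φ 1))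
  simp only [add_apply, sub_apply, smul_apply, one_apply_eq_self, map_sub, ContinuousLinearMap.map_smul_of_tower, hWW]
  have h := cs_sq_add e (1 / 2)
  have : φ 1 = (cs e (1 / 2) ^ 2 + e * sn e (1 / 2) ^ 2) • φ 1 := by rw [h, one_smul]
  conv_lhs => rw [this]
  module

lemma exists_parallel (hn : 1 ≤ n) {x v : V n} (hx : x ∈ M n k) (hv : v ∈ tangent k x) (u : S) :
    ∃ Ψ : ℝ → S, IsParallel k c (geo k x v) Ψ ∧ Ψ 0 = u := by
  have hdiff : Differentiable ℝ (geo k x v) := (contDiff_geo x v).differentiable (by simp)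
  have hm (s : ℝ) := mem_chartDomain_chartAt (geo_mem hx hv s)
  refine ⟨fun s => tauInv c k (chartAt (geo k x v s)) (geo k x v s)
    (geoTransport c k x v s (tau c k (chartAt x) x u)), ?_, ?_⟩
  · rw [isParallel_iff c hn hdiff (geo_mem hx hv)]
    intro t _
    simp only [tau_tauInv c hn (hm _)]
    rw [rot_geo]
    have hW := rot_sq_of_tangent c hx hv
    have h1 : HasDerivAt (geoTransport c k x v) _ t :=
      ((hasDerivAt_half (hasDerivAt_cs (bil k v v) (t / 2))).smul_const _).add
      ((hasDerivAt_half (hasDerivAt_sn (bil k v v) (t / 2))).smul_const (sig k • rot c k v x))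
    have h2 := hasDerivWithinAt_apply h1.hasDerivWithinAt
      (hasDerivWithinAt_const t (Icc 0 1) (tau c k (chartAt x) x u))
    refine h2.congr_deriv ?_
    set w := tau c k (chartAt x) x u
    have hWW : (sig k • rot c k v x) ((sig k • rot c k v x) w) = -bil k v v • w := by
      rw [← clm_mul_apply, hW, smul_apply, one_apply_eq_self, ← Complex.ofReal_neg,
        Complex.coe_smul]
    have h3 (z : S) : (sig k / 2) • rot c k v x z = (1 / 2 : ℝ) • (sig k • rot c k v x) z := by
      rw [smul_apply, ← Complex.coe_smul, smul_smul]
      congr 1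
      push_cast
      ring
    rw [h3, map_zero, add_zero, geoTransport]
    generalize sig k • rot c k v x = W at *
    simp only [add_apply, smul_apply, one_apply_eq_self, map_add, ContinuousLinearMap.map_smul_of_tower, hWW]
    module
  · simp only [geoTransport, zero_div, cs_zero, sn_zero, geo_zero]
    simp [tauInv_tau c hn (mem_chartDomain_chartAt hx)]

/-- Along the unit direction w at x' one has rot(x,x') = sn(r) rot(w,x'), and sn(r) = 2 sn(r/2)
cs(r/2); this turns the coefficient sn(r/2) into 1/(2cs(r/2)). -/
lemma glob_transport (hn : 1 ≤ n) {x u : V n} (hx : x ∈ M n k) (hu : u ∈ tangent k x)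
    (h1 : metric k u u = 1) {r : ℝ} (hr : r ∈ radii k) (v : S) :
    tau c k (chartAt x) x (transport k c x (polar k x r u) v) =
      (cs k (r / 2) • 1 + (1 / (2 * cs k (r / 2))) • (sig k • rot c k x (polar k x r u)))
        (tau c k (chartAt (polar k x r u)) (polar k x r u) v) := by
  have hx' := polar_mem hx hu h1 hr.1
  obtain ⟨b1, b2, b3⟩ := polar_back hx hu h1 r _ rfl
  have hgeo := minGeodesic_polar hn hx hu h1 hr
  set x' := polar k x r u with hxd
  set w := (k * sn k r) • x - cs k r • u
  have hend : geo k x' (r • w) 1 = x := by rw [geo_smul hx' b1 b2 hr.1, mul_one, b3]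
  have hspec := Classical.epsilon_spec (exists_parallel c hn hx' (smul_mem_tangent r b1) v)
  have h2 := transport_geo c hn hx' (smul_mem_tangent r b1) v hspec.1 hspec.2
  rw [hend] at h2
  rw [transport, hgeo]
  refine h2.trans ?_
  congr 1
  have hb : bil k (r • w) (r • w) = k * r ^ 2 := by
    rw [bil_smul_left, bil_smul_right, bil_unit hx' b1 b2]; ring
  have hrot : rot c k x x' = sn k r • rot c k w x' := by
    conv_lhs => rw [← b3]
    rw [polar, rot_add_left, rot_smul_left, rot_smul_left, rot_self, smul_zero, zero_add]
  rw [geoTransport, hb, cs_rescale k hr.1, sn_rescale k hr.1, hrot, rot_smul_left,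
    show r * (1 / 2) = r / 2 by ring, sn_eq_half k r, smul_comm (sig k) r,
    smul_comm (sig k) (2 * _ * _), smul_smul, smul_smul]
  have := hr.1.ne'
  have := (cs_half_pos hr).ne'
  congr 2
  field_simp

/-! ## The integral kernels -/

/-- The kernel `A(q) (2 - k q / 2 + σ R) + B(q) (R + σ q / 2)`, where `q` is the square of the
chordal distance. -/
def ker (k : ℝ) (A B : ℝ → ℂ) (x x' : V n) : S →L[ℂ] S :=
  A (chord k x x') • ((2 - k * chord k x x' / 2) • 1 + sig k • rot c k x x') +
    B (chord k x x') • (rot c k x x' + chord k x x' • (sig k / 2) • 1)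

/-- The prefactors clear the denominators. For the second summand ν acts as R/sn(r), and R² = sn(r)²
produces the scalar σq/2. -/
lemma glob_transport_ker (hn : 1 ≤ n) {x : V n} (hx : x ∈ M n k) {θ : E n} (hθ : ‖θ‖ = 1)
    {r : ℝ} (hr : r ∈ radii k) (A B : ℝ → ℂ) (v : S) {x' : V n}
    (hx' : x' = polar k x r (frame k (chartAt x) x θ)) :
    tau c k (chartAt x) x ((2 * cs k (r / 2) * A (4 * sn k (r / 2) ^ 2)) • transport k c x x' v +
        (2 * sn k (r / 2) * B (4 * sn k (r / 2) ^ 2)) •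
          cliff k c x (nu k x x') (transport k c x x' v)) =
      ker c k A B x x' (tau c k (chartAt x') x' v) := by
  have hc := mem_chartDomain_chartAt hx
  have hu := frame_mem_tangent hc θ
  have h1 := unit_frame hn hx hθ
  have hM := polar_mem hx hu h1 hr.1
  have hq := chord_polar hx hu h1 hr.1
  have hnu := nu_polar hn hx hu h1 hr
  have ht := glob_transport c hn hx hu h1 hr v
  have hrot : rot c k (frame k (chartAt x) x θ) x =
      -((1 / sn k r) • rot c k x (polar k x r (frame k (chartAt x) x θ))) := by
    rw [rot_swap c (polar k x r _) x, polar, rot_add_left, rot_smul_left, rot_smul_left, rot_self,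
      smul_zero, zero_add, smul_neg, neg_neg, smul_smul, one_div_mul_cancel (sn_pos hr).ne',
      one_smul]
  rw [← hx'] at hq hnu ht hrot hM
  have hsq := rot_sq_chord c hx hM
  rw [map_add, map_smul, map_smul, hnu, glob_cliff c hn hx, ht, ker, hq, hrot]
  set w := tau c k (chartAt x') x' v
  set R := rot c k x x' with hR
  have hcs := (cs_half_pos hr).ne'
  have hsn := (sn_half_pos hr).ne'
  have hRR : R (R w) = ((2 * sn k (r / 2) * cs k (r / 2)) ^ 2 : ℝ) • w := by
    rw [← clm_mul_apply, hsq, smul_apply, one_apply_eq_self, Complex.coe_smul, hq]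
    congr 1
    linear_combination (-4 * sn k (r / 2) ^ 2) * cs_sq_add k (r / 2)
  simp only [add_apply, smul_apply, neg_apply, one_apply_eq_self, map_add, map_smul,
    ContinuousLinearMap.map_smul_of_tower, hRR]
  rw [sn_eq_half k r]
  have hk : 2 - k * (4 * sn k (r / 2) ^ 2) / 2 = 2 * cs k (r / 2) ^ 2 := by
    linear_combination (-2) * cs_sq_add k (r / 2)
  rw [hk]
  have hcs' : (cs k (r / 2) : ℂ) ≠ 0 := by exact_mod_cast hcs
  have hsn' : (sn k (r / 2) : ℂ) ≠ 0 := by exact_mod_cast hsn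
  simp only [← Complex.coe_smul]
  push_cast
  (match_scalars <;> field_simp); ring

/-- The directional derivative of the kernel in its first argument. -/
def dker (k : ℝ) (A B : ℝ → ℂ) (x x' X : V n) : S →L[ℂ] S :=
  (2 * metric k X (x - x')) • (deriv A (chord k x x') •
      ((2 - k * chord k x x' / 2) • 1 + sig k • rot c k x x')) +
    A (chord k x x') • (-(k * metric k X (x - x')) • 1 + sig k • rot c k X x') +
    ((2 * metric k X (x - x')) • (deriv B (chord k x x') •
      (rot c k x x' + chord k x x' • (sig k / 2) • 1)) +
    B (chord k x x') • (rot c k X x' + (2 * metric k X (x - x')) • (sig k / 2) • 1))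

lemma hasDerivAt_ker {A B : ℝ → ℂ} (hA : Differentiable ℝ A) (hB : Differentiable ℝ B)
    {γ : ℝ → V n} {X : V n} {s : ℝ} (h : HasDerivAt γ X s) (x' : V n) :
    HasDerivAt (fun s => ker c k A B (γ s) x') (dker c k A B (γ s) x' X) s := by
  have hq : HasDerivAt (fun s => chord k (γ s) x') (2 * metric k X (γ s - x')) s := by
    have := hasDerivAt_metric (k := k) (h.sub_const x') (h.sub_const x')
    refine this.congr_deriv ?_
    rw [metric_comm (γ s - x')]; ring
  have hR : HasDerivAt (fun s => rot c k (γ s) x') (rot c k X x') s :=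
    (rotL c k x').hasFDerivAt.comp_hasDerivAt s h
  have hA' := (hA (chord k (γ s) x')).hasDerivAt.scomp s hq
  have hB' := (hB (chord k (γ s) x')).hasDerivAt.scomp s hq
  have h1 := ((((hq.const_mul k).div_const 2).const_sub 2).smul_const (1 : S →L[ℂ] S)).add
    (hR.const_smul (sig k))
  have h2 := hR.add (hq.smul_const ((sig k / 2) • (1 : S →L[ℂ] S)))
  have h3 := (hA'.smul h1).add (hB'.smul h2)
  refine h3.congr_deriv ?_
  simp only [dker, Function.comp, Pi.add_apply, Pi.smul_apply]
  rw [smul_assoc, smul_assoc, add_comm (A _ • _), add_comm (B _ • (_ + _))]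
  congr 4
  ring_nf

/-- The Dirac operator maps kernels to kernels. -/
lemma dirac_ker (hn : 1 ≤ n) (A B : ℝ → ℂ) {α : Chart} {x x' : V n} (hx : x ∈ chartDomain n k α)
    (hx' : x' ∈ M n k) :
    ∑ i, rot c k (frame k α x (basisVec i)) x * dker c k A B x x' (frame k α x (basisVec i)) -
        ((n : ℂ) * sig k / 2) • ker c k A B x x' =
      ker c k (fun q => n / 2 * B q + q * deriv B q)
        (fun q => (4 - k * q) * deriv A q - n * k / 2 * A q) x x' := by
  have hM := mem_M_of_mem_chartDomain hx
  have h1 := sum_metric_rot c hn hx hx'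
  have h2 := sum_rot_rot c hn hx hx'
  have h3 := rot_sq_chord c hM hx'
  rw [bil_eq_chord hM hx'] at h2
  set R := rot c k x x'
  set q := chord k x x'
  -- Each term is split into the two shapes that `sum_metric_rot` and `sum_rot_rot` can sum, times a
  -- factor independent of i. Afterwards only 1, R and R² occur, and `rot_sq_chord` removes R².
  have e (i : Fin n) : rot c k (frame k α x (basisVec i)) x *
      dker c k A B x x' (frame k α x (basisVec i)) =
      (metric k (frame k α x (basisVec i)) (x - x') • rot c k (frame k α x (basisVec i)) x) *
        ((2 * deriv A q) • ((2 - k * q / 2) • 1 + sig k • R) - (k * A q) • 1 +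
          (2 * deriv B q) • (R + q • (sig k / 2) • 1) + (sig k * B q) • 1) +
      (rot c k (frame k α x (basisVec i)) x * rot c k (frame k α x (basisVec i)) x') *
        ((sig k * A q + B q) • 1) := by
    simp only [dker, mul_add, mul_sub, mul_smul_comm, smul_mul_assoc, mul_one, ← Complex.coe_smul]
    push_cast
    module
  simp only [e, Finset.sum_add_distrib, ← Finset.sum_mul, h1, h2]
  simp only [ker, mul_add, mul_sub, mul_smul_comm,
    mul_one, h3, ← Complex.coe_smul]
  push_cast
  have hσ := sig_sq k
  match_scalars <;> grind

end

section

/-! ## Polar coordinates on the solid cone over the space form -/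

section PlanePolar

variable {k : ℝ}

lemma cs_half_sq (k r : ℝ) : 2 * cs k (r / 2) ^ 2 = 1 + cs k r := by
  have := cs_sq_add k (r / 2)
  have := cs_eq_half k r
  linarith

/-- Polar coordinates `(s,r) ↦ (s cs(r), s sn(r))` in the plane. -/
def planePolar (k : ℝ) (z : ℝ × ℝ) : ℝ × ℝ := (z.1 * cs k z.2, z.1 * sn k z.2)

/-- The image of `planePolar`. -/
def planeCone (k : ℝ) : Set (ℝ × ℝ) :=
  {z | 0 < z.2 ∧ 0 < z.1 ^ 2 + k * z.2 ^ 2 ∧ (k ≤ 0 → 0 < z.1)}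

lemma planePolar_sq (k : ℝ) (z : ℝ × ℝ) :
    (planePolar k z).1 ^ 2 + k * (planePolar k z).2 ^ 2 = z.1 ^ 2 := by
  have := cs_sq_add k z.2
  simp only [planePolar]
  linear_combination z.1 ^ 2 * this

lemma eq_of_cs_eq_of_sn_eq {r r' : ℝ} (hr : r ∈ radii k) (hr' : r' ∈ radii k)
    (hc : cs k r = cs k r') (hs : sn k r = sn k r') : r = r' := by
  have h1 := cs_half_pos hr
  have h2 := cs_half_pos hr'
  have h3 : cs k (r / 2) = cs k (r' / 2) := by
    have := cs_half_sq k r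
    have := cs_half_sq k r'
    nlinarith
  have h4 : sn k (r / 2) = sn k (r' / 2) := by
    rw [sn_eq_half k r, sn_eq_half k r', h3] at hs
    have := mul_right_cancel₀ h2.ne' hs
    linarith
  rw [← arcsn_sn_half hr.1.le fun h => (hr.2 h).le, ← arcsn_sn_half hr'.1.le fun h => (hr'.2 h).le,
    h4]

lemma exists_cs_sn {t ρ : ℝ} (hρ : 0 < ρ) (h : t ^ 2 + k * ρ ^ 2 = 1) (ht : k ≤ 0 → 0 < t) :
    ∃ r ∈ radii k, cs k r = t ∧ sn k r = ρ := by
  have ht1 : 0 < 1 + t := by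
    by_cases hk : 0 < k
    · have : 0 < k * ρ ^ 2 := by positivity
      nlinarith
    · linarith [ht (not_lt.1 hk)]
  -- This is sn(r/2) = sn(r)/(2cs(r/2)) for the radius to be found, since 4cs(r/2)² = 2(1 + cs r).
  set z := ρ / √(2 * (1 + t)) with hz
  have hq : 0 < √(2 * (1 + t)) := Real.sqrt_pos.2 (by linarith)
  have hz0 : 0 < z := by positivity
  have hz2 : z ^ 2 * (2 * (1 + t)) = ρ ^ 2 := by
    rw [hz, div_pow, Real.sq_sqrt (by linarith), div_mul_cancel₀ _ (by linarith)]
  have hkz : 1 - k * z ^ 2 = (1 + t) / 2 := by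
    have : (1 - k * z ^ 2 - (1 + t) / 2) * (2 * (1 + t)) = 0 := by
      linear_combination -k * hz2 - h
    rcases mul_eq_zero.1 this with h | h <;> linarith
  have hz1 : 0 < 1 - k * z ^ 2 := by rw [hkz]; linarith
  have hr := two_arcsn_mem_radii hz0 hz1
  have hs : sn k (2 * arcsn k z / 2) = z := by
    rw [mul_div_cancel_left₀ _ two_ne_zero, sn_arcsn hz1.le]
  have hc : cs k (2 * arcsn k z) = t := by
    rw [cs_eq_half, hs]; linarith
  refine ⟨_, hr, hc, ?_⟩
  have h1 : sn k (2 * arcsn k z) ^ 2 = ρ ^ 2 := by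
    rw [sn_eq_half, hs, mul_pow, mul_pow, ← hz2, ← hc, ← cs_half_sq]; ring
  exact (pow_left_inj₀ (sn_pos hr).le hρ.le two_ne_zero).1 h1

lemma injOn_planePolar (k : ℝ) : InjOn (planePolar k) (Ioi 0 ×ˢ radii k) := by
  rintro ⟨s, r⟩ ⟨hs, hr⟩ ⟨s', r'⟩ ⟨hs', hr'⟩ h
  simp only [mem_Ioi] at hs hs'
  have h1 := planePolar_sq k (s, r)
  rw [h, planePolar_sq] at h1
  have h2 : s = s' := (pow_left_inj₀ hs.le hs'.le two_ne_zero).1 h1.symm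
  subst h2
  simp only [planePolar, Prod.mk.injEq] at h
  exact Prod.ext rfl
    (eq_of_cs_eq_of_sn_eq hr hr' (mul_left_cancel₀ hs.ne' h.1) (mul_left_cancel₀ hs.ne' h.2))

lemma image_planePolar (k : ℝ) : planePolar k '' (Ioi 0 ×ˢ radii k) = planeCone k := by
  ext ⟨t, ρ⟩
  constructor
  · rintro ⟨⟨s, r⟩, ⟨hs, hr⟩, h⟩
    simp only [mem_Ioi] at hs hr
    have h1 := planePolar_sq k (s, r)
    rw [h] at h1
    refine ⟨?_, by rw [h1]; exact pow_pos hs 2, fun hk => ?_⟩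
    · rw [← h]; exact mul_pos hs (sn_pos hr)
    · rw [← h]
      refine mul_pos hs ?_
      rw [cs_eq_half]
      nlinarith [sq_nonneg (sn k (r / 2))]
  · rintro ⟨h1, h2, h3⟩
    simp only at h1 h2 h3
    set s := √(t ^ 2 + k * ρ ^ 2) with hs
    have hs0 : 0 < s := Real.sqrt_pos.2 h2
    have hs2 : s ^ 2 = t ^ 2 + k * ρ ^ 2 := Real.sq_sqrt h2.le
    obtain ⟨r, hr, hc, hn⟩ := exists_cs_sn (k := k) (t := t / s) (ρ := ρ / s) (by positivity)
      (by field_simp; linarith) (fun hk => div_pos (h3 hk) hs0)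
    refine ⟨(s, r), ⟨hs0, hr⟩, ?_⟩
    simp only [planePolar, hc, hn]
    refine Prod.ext ?_ ?_ <;> simp only <;> field_simp

/-- The derivative of `planePolar`. -/
def fderivPlanePolar (k : ℝ) (z : ℝ × ℝ) : ℝ × ℝ →L[ℝ] ℝ × ℝ :=
  (Matrix.toLin (.finTwoProd ℝ) (.finTwoProd ℝ)
    !![cs k z.2, -k * z.1 * sn k z.2; sn k z.2, z.1 * cs k z.2]).toContinuousLinearMap

lemma hasFDerivAt_planePolar (k : ℝ) (z : ℝ × ℝ) :
    HasFDerivAt (planePolar k) (fderivPlanePolar k z) z := by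
  unfold fderivPlanePolar
  rw [Matrix.toLin_finTwoProd_toContinuousLinearMap]
  have h1 := (hasFDerivAt_fst (𝕜 := ℝ) (p := z)).mul
    ((hasDerivAt_cs k z.2).comp_hasFDerivAt z hasFDerivAt_snd)
  have h2 := (hasFDerivAt_fst (𝕜 := ℝ) (p := z)).mul
    ((hasDerivAt_sn k z.2).comp_hasFDerivAt z hasFDerivAt_snd)
  refine (h1.prodMk h2).congr_fderiv ?_
  ext <;> simp; ring

lemma det_fderivPlanePolar (k : ℝ) (z : ℝ × ℝ) : (fderivPlanePolar k z).det = z.1 := by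
  have := cs_sq_add k z.2
  rw [fderivPlanePolar, LinearMap.det_toContinuousLinearMap, LinearMap.det_toLin,
    Matrix.det_fin_two_of]
  linear_combination z.1 * this

lemma integral_planeCone {F : Type*} [NormedAddCommGroup F] [NormedSpace ℝ F] (k : ℝ)
    (g : ℝ × ℝ → F) :
    ∫ z in planeCone k, g z = ∫ z in Ioi 0 ×ˢ radii k, z.1 • g (planePolar k z) := by
  have hm : MeasurableSet (Ioi (0 : ℝ) ×ˢ radii k) :=
    measurableSet_Ioi.prod (isOpen_radii k).measurableSet
  rw [← image_planePolar, integral_image_eq_integral_abs_det_fderiv_smul volume hm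
    (fun z _ => (hasFDerivAt_planePolar k z).hasFDerivWithinAt) (injOn_planePolar k)]
  refine setIntegral_congr_fun hm fun z hz => ?_
  simp only [det_fderivPlanePolar, abs_of_pos (show 0 < z.1 from hz.1)]

end PlanePolar

/-! ### Cylindrical coordinates on ℝ × ℝⁿ -/

section Cylinder

variable {n : ℕ}

lemma measurePreserving_smul_sphere (hn : 1 ≤ n) :
    MeasurePreserving (fun z : Metric.sphere (0 : E n) 1 × Ioi (0 : ℝ) => z.2.1 • z.1.1)
      ((volume : Measure (E n)).toSphere.prod (Measure.volumeIoiPow (n - 1))) volume := by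
  have : Nonempty (Fin n) := ⟨⟨0, hn⟩⟩
  have h := (volume : Measure (E n)).measurePreserving_homeomorphUnitSphereProd
  rw [finrank_euclideanSpace_fin] at h
  have h1 : MeasurePreserving (homeomorphUnitSphereProd (E n)).symm _ _ :=
    MeasurePreserving.symm (homeomorphUnitSphereProd (E n)).toMeasurableEquiv h
  have h2 : MeasurePreserving (Subtype.val : ({0}ᶜ : Set (E n)) → E n)
      (Measure.comap Subtype.val volume) volume := by
    refine ⟨measurable_subtype_coe, ?_⟩
    rw [map_comap_subtype_coe (measurableSet_singleton 0).compl, restrict_compl_singleton]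
  convert h2.comp h1 using 1
  ext z : 1
  simp

lemma measurePreserving_cylinder (hn : 1 ≤ n) :
    MeasurePreserving
      (fun z : (ℝ × Ioi (0 : ℝ)) × Metric.sphere (0 : E n) 1 => (z.1.1, z.1.2.1 • z.2.1))
      ((volume.prod (Measure.volumeIoiPow (n - 1))).prod (volume : Measure (E n)).toSphere)
      (volume : Measure (V n)) := by
  have h1 := (MeasurePreserving.id (volume : Measure ℝ)).prod (measurePreserving_smul_sphere hn)
  have h2 := (MeasurePreserving.id (volume : Measure ℝ)).prod
    (Measure.measurePreserving_swap (μ := Measure.volumeIoiPow (n - 1))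
      (ν := (volume : Measure (E n)).toSphere))
  have h3 := measurePreserving_prodAssoc (volume : Measure ℝ) (Measure.volumeIoiPow (n - 1))
    (volume : Measure (E n)).toSphere
  exact h1.comp (h2.comp h3)

lemma integral_prod_volumeIoiPow {F : Type*} [NormedAddCommGroup F] [NormedSpace ℝ F] (m : ℕ)
    (g : ℝ × ℝ → F) :
    ∫ z : ℝ × Ioi (0 : ℝ), g (z.1, z.2.1) ∂(volume.prod (Measure.volumeIoiPow m)) =
      ∫ z in univ ×ˢ Ioi (0 : ℝ), z.2 ^ m • g z := by
  -- `volumeIoiPow 0` has density 1, so it is this measure and supplies the instance.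
  have : SFinite (Measure.comap (Subtype.val : Ioi (0 : ℝ) → ℝ) volume) := by
    have h : Measure.volumeIoiPow 0 = Measure.comap (Subtype.val : Ioi (0 : ℝ) → ℝ) volume := by
      simp [Measure.volumeIoiPow]
    rw [← h]; infer_instance
  have hm : MeasurableEmbedding (Prod.map id Subtype.val : ℝ × Ioi (0 : ℝ) → ℝ × ℝ) :=
    MeasurableEmbedding.id.prodMap (MeasurableEmbedding.subtype_coe measurableSet_Ioi)
  have hmap : Measure.map (Prod.map id Subtype.val : ℝ × Ioi (0 : ℝ) → ℝ × ℝ)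
      (volume.prod (Measure.comap Subtype.val volume)) =
        (volume : Measure (ℝ × ℝ)).restrict (univ ×ˢ Ioi 0) := by
    rw [← Measure.map_prod_map _ _ measurable_id measurable_subtype_coe,
      map_comap_subtype_coe measurableSet_Ioi, Measure.map_id, Measure.volume_eq_prod,
      ← Measure.prod_restrict, Measure.restrict_univ]
  rw [Measure.volumeIoiPow, prod_withDensity_right (by fun_prop),
    integral_withDensity_eq_integral_toReal_smul (by fun_prop) (by simp), ← hmap, hm.integral_map]
  refine integral_congr_ae (.of_forall fun z => ?_)
  have : (0 : ℝ) < z.2.1 := z.2.2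
  simp only [Prod.map_snd]
  rw [ENNReal.toReal_ofReal (by positivity)]
  rfl

lemma integral_cylinder {F : Type*} [NormedAddCommGroup F] [NormedSpace ℝ F] (hn : 1 ≤ n)
    {H : V n → F} (hH : Integrable H) :
    ∫ p, H p = ∫ z in univ ×ˢ Ioi (0 : ℝ), z.2 ^ (n - 1) •
      ∫ θ : Metric.sphere (0 : E n) 1, H (z.1, z.2 • θ.1) ∂(volume : Measure (E n)).toSphere := by
  have hp := measurePreserving_cylinder hn
  have h := integral_prod _ (hp.integrable_comp_of_integrable hH)
  simp only [Function.comp_def] at h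
  rw [← integral_prod_volumeIoiPow (n - 1) fun z : ℝ × ℝ =>
    ∫ θ : Metric.sphere (0 : E n) 1, H (z.1, z.2 • θ.1) ∂(volume : Measure (E n)).toSphere,
    ← h, ← hp.map_eq,
    integral_map hp.measurable.aemeasurable (hp.map_eq ▸ hH.aestronglyMeasurable)]

end Cylinder

/-! ### The solid cone and its linear isometries -/

section Cone

variable {n : ℕ} {k : ℝ}

/-- The open solid cone over the space form. -/
def cone (n : ℕ) (k : ℝ) : Set (V n) := {p | 0 < bil k p p ∧ (k ≤ 0 → 0 < p.1)}

lemma mem_cone_of_mem {x : V n} (hx : x ∈ M n k) : x ∈ cone n k :=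
  ⟨by rw [bil_self_of_mem hx]; exact one_pos, hx.2⟩

lemma exists_smul_eq_of_mem_cone {p : V n} (hp : p ∈ cone n k) :
    ∃ s > (0 : ℝ), ∃ y ∈ M n k, p = s • y := by
  have h : 0 < √(bil k p p) := Real.sqrt_pos.2 hp.1
  refine ⟨√(bil k p p), h, (√(bil k p p))⁻¹ • p, mem_M_iff.2 ⟨?_, fun hk => ?_⟩, ?_⟩
  · rw [bil_smul_left, bil_smul_right, ← mul_assoc, ← mul_inv, Real.mul_self_sqrt hp.1.le,
      inv_mul_cancel₀ hp.1.ne']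
  · have := hp.2 hk
    simp only [Prod.smul_fst, smul_eq_mul]; positivity
  · rw [smul_inv_smul₀ h.ne']

/-- The linear isometry of the ambient space which maps the base point `(1,0)` to `x`. -/
def boost (k : ℝ) (x : V n) : V n →ₗ[ℝ] V n :=
  (LinearMap.fst ℝ ℝ (E n)).smulRight x + (frameL k (chartAt x) x).toLinearMap ∘ₗ
    LinearMap.snd ℝ ℝ (E n)

lemma boost_apply (x p : V n) : boost k x p = p.1 • x + frame k (chartAt x) x p.2 := by
  simp [boost, frameL_apply]

lemma bil_boost (hn : 1 ≤ n) {x : V n} (hx : x ∈ M n k) (p : V n) :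
    bil k (boost k x p) (boost k x p) = bil k p p := by
  have hc := mem_chartDomain_chartAt hx
  have h1 : bil k x (frame k (chartAt x) x p.2) = 0 := frame_mem_tangent hc _
  have h2 := mul_metric_tangent hx (frame_mem_tangent hc p.2) (frame k (chartAt x) x p.2)
  rw [metric_frame hn hc] at h2
  rw [boost_apply, bil_add_left, bil_add_right, bil_add_right, bil_smul_left, bil_smul_right,
    bil_smul_left, bil_smul_right, bil_comm (frame _ _ _ _) x, h1, ← h2, bil_self_of_mem hx, bil]
  ring

lemma bil_boost_left {x : V n} (hx : x ∈ M n k) (p : V n) : bil k x (boost k x p) = p.1 := by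
  have h1 : bil k x (frame k (chartAt x) x p.2) = 0 :=
    frame_mem_tangent (mem_chartDomain_chartAt hx) _
  rw [boost_apply, bil_add_right, bil_smul_right, h1, bil_self_of_mem hx]
  ring

/-- The first coordinate of p is `bil` of x with its image, hence positive by `bil_pos_of_nonpos`
when k ≤ 0. -/
lemma mem_cone_of_boost (hn : 1 ≤ n) {x p : V n} (hx : x ∈ M n k) (hp : boost k x p ∈ cone n k) :
    p ∈ cone n k := by
  refine ⟨bil_boost hn hx p ▸ hp.1, fun hk => ?_⟩
  obtain ⟨s, hs, y, hy, h⟩ := exists_smul_eq_of_mem_cone hp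
  rw [← bil_boost_left hx, h, bil_smul_right]
  exact mul_pos hs (bil_pos_of_nonpos hk hx hy)

lemma abs_det_of_comp_self {W : Type*} [AddCommGroup W] [Module ℝ W] {f : W →ₗ[ℝ] W}
    (h : f ∘ₗ f = LinearMap.id) : |LinearMap.det f| = 1 := by
  have h1 := congrArg LinearMap.det h
  rw [LinearMap.det_comp, LinearMap.det_id] at h1
  rw [← abs_mul_abs_self] at h1
  nlinarith [abs_nonneg (LinearMap.det f)]

/-- Composed with the reflection y ↦ -y, the north boost is an involution, and an involution has
determinant ±1. Outside the north chart x is the point (-1,0), where the boost itself is an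
involution. -/
lemma abs_det_boost (hn : 1 ≤ n) {x : V n} (hx : x ∈ M n k) :
    |LinearMap.det (boost k x)| = 1 := by
  by_cases h : -1 < x.1
  · set ρ : V n →ₗ[ℝ] V n := (LinearMap.fst ℝ ℝ (E n)).prod (-LinearMap.snd ℝ ℝ (E n)) with hρ
    have hρ2 : ρ ∘ₗ ρ = LinearMap.id := by
      ext p <;> simp [hρ]
    have hρa (p : V n) : ρ p = (p.1, -p.2) := rfl
    have hc : (ρ ∘ₗ boost k x) ∘ₗ (ρ ∘ₗ boost k x) = LinearMap.id := by
      refine LinearMap.ext fun p => ?_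
      have hx1 := hx.1
      have hx0 : 1 + x.1 ≠ 0 := by linarith
      simp only [LinearMap.comp_apply, boost_apply, chartAt_of_lt h, frame, LinearMap.id_apply, hρa,
        Prod.fst_add, Prod.snd_add, Prod.smul_fst, Prod.smul_snd, smul_eq_mul]
      refine Prod.ext ?_ ?_
      · simp only [inner_neg_right, inner_add_right, inner_sub_right, real_inner_smul_right,
          real_inner_self_eq_norm_sq]
        field_simp
        grind
      · simp only [inner_neg_right, inner_add_right, inner_sub_right, real_inner_smul_right,
          real_inner_self_eq_norm_sq]
        match_scalars
        · field_simp
          grind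
        · ring
    have h1 := abs_det_of_comp_self hρ2
    have h2 := abs_det_of_comp_self hc
    rwa [LinearMap.det_comp, abs_mul, h1, one_mul] at h2
  · have h1 := hx.1
    have hk : 0 < k := by
      by_contra hk
      linarith [hx.2 (not_lt.1 hk)]
    have h2 : x.2 = 0 := by
      have : k * ‖x.2‖ ^ 2 ≤ 0 := by nlinarith
      have : ‖x.2‖ ^ 2 ≤ 0 := nonpos_of_mul_nonpos_right this hk
      exact norm_eq_zero.1 (pow_eq_zero_iff two_ne_zero |>.1 (le_antisymm this (sq_nonneg _)))
    have h3 : x.1 = -1 := by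
      rw [h2] at h1
      simp only [norm_zero] at h1
      nlinarith
    refine abs_det_of_comp_self (LinearMap.ext fun p => ?_)
    simp only [LinearMap.comp_apply, boost_apply, chartAt_of_not_lt h, frame, h2, h3,
      LinearMap.id_apply]
    refine Prod.ext (by simp [h3]) (by simp [h2, flip_flip hn])

instance : (volume : Measure (V n)).IsAddHaarMeasure :=
  inferInstanceAs (((volume : Measure ℝ).prod (volume : Measure (E n))).IsAddHaarMeasure)

lemma integral_comp_boost {F : Type*} [NormedAddCommGroup F] [NormedSpace ℝ F] (hn : 1 ≤ n)
    {x : V n} (hx : x ∈ M n k) {H : V n → F} (hH : Integrable H) :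
    Integrable (H ∘ boost k x) ∧ ∫ p, H (boost k x p) = ∫ p, H p := by
  have hd := abs_det_boost hn hx
  have h0 : LinearMap.det (boost k x) ≠ 0 := fun h => by simp [h] at hd
  have hp : MeasurePreserving (boost k x) (volume : Measure (V n)) volume := by
    refine ⟨(LinearMap.continuous_of_finiteDimensional _).measurable, ?_⟩
    rw [Measure.map_linearMap_addHaar_eq_smul_addHaar _ h0, abs_inv, hd]
    simp
  refine ⟨hp.integrable_comp_of_integrable hH, ?_⟩
  conv_rhs => rw [← hp.map_eq]
  rw [integral_map hp.measurable.aemeasurable (hp.map_eq.symm ▸ hH.aestronglyMeasurable)]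

/-- Integration over the cone in polar coordinates around an arbitrary point `x`. -/
lemma integral_cone {F : Type*} [NormedAddCommGroup F] [NormedSpace ℝ F] (hn : 1 ≤ n)
    {x : V n} (hx : x ∈ M n k) {H G : V n → F} {w : ℝ → ℝ} (hH : Integrable H)
    (h0 : ∀ p ∉ cone n k, H p = 0) (h1 : ∀ s > (0 : ℝ), ∀ y ∈ M n k, H (s • y) = w s • G y) :
    ∫ p, H p = (∫ s in Ioi (0 : ℝ), s ^ n * w s) • ∫ r in radii k, sn k r ^ (n - 1) •
      ∫ θ : Metric.sphere (0 : E n) 1, G (polar k x r (frame k (chartAt x) x θ))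
        ∂(volume : Measure (E n)).toSphere := by
  obtain ⟨hi, he⟩ := integral_comp_boost hn hx hH
  rw [← he]
  have hcyl := integral_cylinder hn hi
  simp only [Function.comp_apply] at hcyl
  rw [hcyl]
  have hsub : planeCone k ⊆ univ ×ˢ Ioi 0 := fun z hz => ⟨mem_univ _, hz.1⟩
  have hm : MeasurableSet (univ ×ˢ Ioi (0 : ℝ) : Set (ℝ × ℝ)) :=
    MeasurableSet.univ.prod measurableSet_Ioi
  rw [setIntegral_eq_of_subset_of_forall_sdiff_eq_zero hm hsub, integral_planeCone]
  · rw [← integral_prod_smul, Measure.prod_restrict, ← Measure.volume_eq_prod]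
    refine setIntegral_congr_fun (measurableSet_Ioi.prod (isOpen_radii k).measurableSet) ?_
    rintro ⟨s, r⟩ ⟨hs, hr⟩
    simp only [mem_Ioi] at hs hr
    have hG (θ : Metric.sphere (0 : E n) 1) :
        H (boost k x ((planePolar k (s, r)).1, (planePolar k (s, r)).2 • θ.1)) =
          w s • G (polar k x r (frame k (chartAt x) x θ)) := by
      rw [← h1 s hs _ (polar_mem hx (frame_mem_tangent (mem_chartDomain_chartAt hx) _)
        (unit_frame hn hx (θ := θ.1) (by simp)) hr.1), boost_apply]
      simp only [planePolar, frame_smul, polar, smul_add, smul_smul]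
    simp only [hG, integral_smul, smul_smul]
    congr 1
    simp only [planePolar]
    -- The power sⁿ collects s from the Jacobian of `planePolar` and sⁿ⁻¹ from (s sn r)ⁿ⁻¹.
    obtain ⟨m, rfl⟩ : ∃ m, n = m + 1 := ⟨n - 1, by omega⟩
    simp only [Nat.add_sub_cancel]
    ring
  · rintro ⟨t, ρ⟩ ⟨⟨-, hρ⟩, hz⟩
    simp only [mem_Ioi] at hρ
    have hG (θ : Metric.sphere (0 : E n) 1) : H (boost k x (t, ρ • θ.1)) = 0 := by
      refine h0 _ fun hc => hz ?_
      have h2 := mem_cone_of_boost hn hx hc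
      refine ⟨hρ, ?_, h2.2⟩
      have h3 := h2.1
      have hθ : ‖θ.1‖ = 1 := by simp
      simp only [bil, real_inner_self_eq_norm_sq, norm_smul, hθ, mul_one, Real.norm_eq_abs,
        sq_abs] at h3
      simpa [sq] using h3
    simp [hG]

end Cone

end

section

/-! ## Integrals depending on a parameter -/

section Parametric

variable {P G F : Type*} [NormedAddCommGroup P] [NormedSpace ℝ P] [NormedAddCommGroup G]
  [NormedSpace ℝ G] [FiniteDimensional ℝ G] [MeasurableSpace G] [BorelSpace G]
  [NormedAddCommGroup F] [NormedSpace ℝ F] {μ : Measure G} [μ.IsAddHaarMeasure]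
  {g : P → G → F} {s : Set P} {K : Set G}

/-- Writing a parametric integral as a convolution with the constant 1, taken at 0, gives access to
the differentiation theorems for convolutions with a parameter. -/
lemma convolution_one_eq (g : G → F) :
    convolution (fun _ : G => (1 : ℝ)) g (ContinuousLinearMap.lsmul ℝ ℝ) μ 0 = ∫ p, g p ∂μ := by
  simp only [convolution_def, ContinuousLinearMap.lsmul_apply, one_smul, zero_sub]
  exact integral_neg_eq_self g μ

lemma contDiffOn_integral_param (hg : ContDiff ℝ ∞ (Function.uncurry g)) (hs : IsOpen s)
    (hK : IsCompact K) (h0 : ∀ x ∈ s, ∀ p ∉ K, g x p = 0) :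
    ContDiffOn ℝ ∞ (fun x => ∫ p, g x p ∂μ) s := by
  have h := contDiffOn_convolution_right_with_param_comp (n := ⊤) (μ := μ)
    (f := fun _ : G => (1 : ℝ)) (ContinuousLinearMap.lsmul ℝ ℝ) (v := fun _ : P => (0 : G))
    contDiffOn_const hs hK (fun x p hx hp => h0 x hx p hp) (locallyIntegrable_const 1)
    hg.contDiffOn
  exact h.congr fun x _ => (convolution_one_eq (g x)).symm

lemma fderiv_integral_param (hg : ContDiff ℝ ∞ (Function.uncurry g)) (hs : IsOpen s)
    (hK : IsCompact K) (h0 : ∀ x ∈ s, ∀ p ∉ K, g x p = 0) {x : P} (hx : x ∈ s) {X : P}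
    {g' : G → F} (hg' : ∀ p, HasDerivAt (fun t : ℝ => g (x + t • X) p) (g' p) 0) :
    Integrable g' μ ∧ fderiv ℝ (fun x => ∫ p, g x p ∂μ) x X = ∫ p, g' p ∂μ := by
  set D : G → P × G →L[ℝ] F := fun p => fderiv ℝ (Function.uncurry g) (x, p) with hD
  have hDc : Continuous D := (hg.continuous_fderiv (by simp)).comp (by fun_prop)
  have hD0 : ∀ p ∉ K, D p = 0 := fun p hp => by
    refine (hasFDerivAt_zero_of_eventually_const 0 ?_).fderiv
    rw [nhds_prod_eq]
    filter_upwards [Filter.prod_mem_prod (hs.mem_nhds hx) (hK.isClosed.isOpen_compl.mem_nhds hp)]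
    rintro ⟨y, q⟩ ⟨hy, hq⟩
    exact h0 y hy q hq
  have hDi : Integrable D μ := hDc.integrable_of_hasCompactSupport (.intro hK hD0)
  have hDg (p : G) : D p (X, 0) = g' p := by
    have h1 : HasFDerivAt (Function.uncurry g) (D p) (x + (0 : ℝ) • X, p) := by
      simpa using (hg.differentiable (by simp) (x, p)).hasFDerivAt
    have h2 : HasDerivAt (fun t : ℝ => (x + t • X, p)) (X, (0 : G)) 0 := by
      have := ((hasDerivAt_id (0 : ℝ)).smul_const X).const_add x
      simpa using this.prodMk (hasDerivAt_const (0 : ℝ) p)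
    have h3 := h1.comp_hasDerivAt (0 : ℝ) h2
    exact h3.unique (hg' p)
  refine ⟨(hDi.apply_continuousLinearMap (X, 0)).congr (.of_forall hDg), ?_⟩
  have h := hasFDerivAt_convolution_right_with_param (μ := μ) (f := fun _ : G => (1 : ℝ))
    (ContinuousLinearMap.lsmul ℝ ℝ) hs hK (fun x p hx hp => h0 x hx p hp)
    (locallyIntegrable_const 1) (hg.of_le (by simp)).contDiffOn (x, 0) hx
  have h1 := h.comp x ((hasFDerivAt_id (𝕜 := ℝ) x).prodMk (hasFDerivAt_const (0 : G) x))
  have h2 : (fun x => ∫ p, g x p ∂μ) =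
      (fun q : P × G => convolution (fun _ : G => (1 : ℝ)) (g q.1)
        (ContinuousLinearMap.lsmul ℝ ℝ) μ q.2) ∘ fun y => (id y, 0) := by
    funext y
    exact (convolution_one_eq (g y)).symm
  rw [h2, h1.fderiv]
  have h3 : convolution (fun _ : G => (1 : ℝ)) D
      ((ContinuousLinearMap.lsmul ℝ ℝ).precompR (P × G)) μ 0 = ∫ p, D p ∂μ := by
    rw [convolution_def, ← integral_neg_eq_self D μ]
    refine integral_congr_ae (.of_forall fun p => ?_)
    refine ContinuousLinearMap.ext fun v => ?_
    simp [ContinuousLinearMap.precompR_apply]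
  simp only [ContinuousLinearMap.comp_apply]
  change (convolution (fun _ : G => (1 : ℝ)) D
      ((ContinuousLinearMap.lsmul ℝ ℝ).precompR (P × G)) μ 0) (X, 0) = _
  rw [h3, ContinuousLinearMap.integral_apply hDi]
  exact integral_congr_ae (.of_forall hDg)

end Parametric

/-! ## The cutoff and the radial projection -/

section Cutoff

variable {n : ℕ} {k : ℝ}

lemma contDiff_bil (k : ℝ) : ContDiff ℝ ∞ fun p : V n => bil k p p := by
  unfold bil
  exact (contDiff_fst.mul contDiff_fst).add
    (contDiff_const.mul (contDiff_snd.inner ℝ contDiff_snd))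

lemma isOpen_cone (n : ℕ) (k : ℝ) : IsOpen (cone n k) := by
  have h : cone n k = {p | 0 < bil k p p} ∩ {p | k ≤ 0 → 0 < p.1} := rfl
  rw [h]
  refine (isOpen_lt continuous_const (contDiff_bil k).continuous).inter ?_
  by_cases hk : k ≤ 0
  · simpa [hk] using isOpen_lt continuous_const continuous_fst
  · simp [hk]

/-- The radial projection of the cone onto the space form. -/
def proj (k : ℝ) (p : V n) : V n := (√(bil k p p))⁻¹ • p

lemma proj_smul {s : ℝ} (hs : 0 < s) {y : V n} (hy : y ∈ M n k) : proj k (s • y) = y := by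
  rw [proj, bil_smul_left, bil_smul_right, bil_self_of_mem hy, mul_one, Real.sqrt_mul_self hs.le,
    inv_smul_smul₀ hs.ne']

lemma proj_mem {p : V n} (hp : p ∈ cone n k) : proj k p ∈ M n k := by
  obtain ⟨s, hs, y, hy, rfl⟩ := exists_smul_eq_of_mem_cone hp
  rwa [proj_smul hs hy]

lemma contDiffAt_proj {p : V n} (hp : p ∈ cone n k) : ContDiffAt ℝ ∞ (proj k) p := by
  have h : ContDiffAt ℝ ∞ (fun p : V n => √(bil k p p)) p :=
    (contDiff_bil k).contDiffAt.sqrt hp.1.ne'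
  exact (h.inv (Real.sqrt_pos.2 hp.1).ne').smul contDiffAt_id

/-- A smooth bump function with support in `[1,3]`. -/
def bump : ContDiffBump (2 : ℝ) := ⟨1 / 2, 1, by norm_num, by norm_num⟩

lemma bump_eq_zero {t : ℝ} (ht : t ∉ Ioo (1 : ℝ) 3) : bump t = 0 := by
  refine bump.zero_of_le_dist ?_
  rw [Real.dist_eq]
  by_contra! h
  have := abs_lt.1 (show |t - 2| < 1 from h)
  exact ht ⟨by linarith, by linarith⟩

open Classical in
/-- A smooth weight on the cone. -/
def weight (k : ℝ) (p : V n) : ℝ := if p ∈ cone n k then bump (bil k p p) else 0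

lemma weight_smul {s : ℝ} (hs : 0 < s) {y : V n} (hy : y ∈ M n k) :
    weight k (s • y) = bump (s ^ 2) := by
  have h1 : bil k (s • y) (s • y) = s ^ 2 := by
    rw [bil_smul_left, bil_smul_right, bil_self_of_mem hy]; ring
  rw [weight, if_pos, h1]
  exact ⟨by rw [h1]; positivity, fun hk => mul_pos hs (hy.2 hk)⟩

lemma weight_of_notMem {p : V n} (hp : p ∉ cone n k) : weight k p = 0 := if_neg hp

/-- The bump lives where `bil` lies between 1 and 3, away from the boundary of the cone: for k ≤ 0
the hyperplane t = 0 has `bil` nonpositive. Hence the extension of the weight by zero is smooth. -/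
lemma eventually_weight_eq_zero {p : V n} (hp : p ∉ cone n k) : ∀ᶠ q in nhds p, weight k q = 0 := by
  have h : {q : V n | bil k q q < 1 ∨ (k ≤ 0 ∧ q.1 < 0)} ∈ nhds p := by
    refine IsOpen.mem_nhds ?_ ?_
    · refine (isOpen_lt (contDiff_bil k).continuous continuous_const).union ?_
      exact isOpen_const.inter (isOpen_lt continuous_fst continuous_const)
    · by_contra h
      simp only [mem_ofPred_eq, not_or, not_lt, not_and] at h
      refine hp ⟨by linarith [h.1], fun hk => lt_of_le_of_ne (h.2 hk) fun h0 => ?_⟩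
      have h1 := h.1
      simp only [bil, ← h0, real_inner_self_eq_norm_sq] at h1
      nlinarith [sq_nonneg ‖p.2‖]
  filter_upwards [h] with q hq
  by_cases hc : q ∈ cone n k
  · rw [weight, if_pos hc]
    refine bump_eq_zero fun h => ?_
    rcases hq with hq | hq
    · linarith [h.1]
    · linarith [hc.2 hq.1]
  · exact weight_of_notMem hc

lemma contDiffAt_weight {p : V n} (hp : p ∈ cone n k) : ContDiffAt ℝ ∞ (weight k) p := by
  have h : ContDiffAt ℝ ∞ (fun p : V n => bump (bil k p p)) p :=
    bump.contDiff.contDiffAt.comp p (contDiff_bil k).contDiffAt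
  refine h.congr_of_eventuallyEq ?_
  filter_upwards [(isOpen_cone n k).mem_nhds hp] with q hq using if_pos hq

/-- The total mass of the weight on a ray. -/
def mass (n : ℕ) : ℝ := ∫ s in Ioi (0 : ℝ), s ^ n * bump (s ^ 2)

lemma mass_pos (n : ℕ) : 0 < mass n := by
  have hc : Continuous fun s : ℝ => s ^ n * bump (s ^ 2) :=
    (continuous_pow n).mul (bump.continuous.comp (continuous_pow 2))
  have hi : Integrable fun s : ℝ => s ^ n * bump (s ^ 2) := by
    refine hc.integrable_of_hasCompactSupport (.intro (isCompact_Icc (a := -2) (b := 2)) ?_)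
    intro s hs
    rw [bump_eq_zero, mul_zero]
    rintro ⟨-, h⟩
    exact hs ⟨by nlinarith, by nlinarith⟩
  have h0 : 0 ≤ᵐ[volume.restrict (Ioi (0 : ℝ))] fun s => s ^ n * bump (s ^ 2) := by
    filter_upwards [ae_restrict_mem measurableSet_Ioi] with s hs
    exact mul_nonneg (pow_nonneg (le_of_lt hs) n) bump.nonneg
  rw [mass, setIntegral_pos_iff_support_of_nonneg_ae h0 hi.integrableOn]
  -- On this interval s² stays strictly between 1 and 3, where the bump is positive.
  refine lt_of_lt_of_le ?_ (measure_mono (show Ioo (1.3 : ℝ) 1.5 ⊆ _ from ?_))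
  · simp; norm_num
  · rintro s ⟨h1, h2⟩
    have hs : 0 < s := by linarith
    refine ⟨(mul_pos (pow_pos hs n) ?_).ne', hs⟩
    refine bump.pos_of_mem_ball ?_
    rw [Metric.mem_ball, Real.dist_eq, abs_lt]
    exact ⟨show -1 < _ by nlinarith, show _ < 1 by nlinarith⟩

/-- Points of the space form at bounded chordal distance from a fixed point are bounded, locally
uniformly in that point. -/
lemma exists_bound_of_chord_le {x₀ : V n} (hx₀ : x₀ ∈ cone n k) (Q : ℝ) :
    ∃ s, IsOpen s ∧ x₀ ∈ s ∧ ∃ R, ∀ x ∈ s, ∀ y ∈ M n k, chord k x y ≤ Q → ‖y‖ ≤ R := by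
  rcases lt_trichotomy k 0 with hk | rfl | hk
  -- For k < 0, δ is positive inside the light cone and bil(x,y) ≥ δ(x) y.1 on the upper sheet. A
  -- bound on the chord bounds `bil`, hence y.1, as long as δ(x) stays bounded below.
  · set δ : V n → ℝ := fun x => x.1 - √(-k) * ‖x.2‖ with hδ
    have hδc : Continuous δ := by fun_prop
    have hk2 : √(-k) ^ 2 = -k := Real.sq_sqrt (by linarith)
    have hk0 : 0 < √(-k) := Real.sqrt_pos.2 (by linarith)
    have hδ0 : 0 < δ x₀ := by
      have h1 := hx₀.1
      have h2 := hx₀.2 hk.le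
      simp only [bil, real_inner_self_eq_norm_sq] at h1
      have h3 : (√(-k) * ‖x₀.2‖) ^ 2 < x₀.1 ^ 2 := by rw [mul_pow, hk2]; linarith
      have h4 := lt_of_pow_lt_pow_left₀ 2 h2.le h3
      simp only [hδ]; linarith
    refine ⟨{x | δ x₀ / 2 < δ x} ∩ {x | bil k x x < bil k x₀ x₀ + 1}, ?_, ?_, ?_⟩
    · exact (isOpen_lt continuous_const hδc).inter
        (isOpen_lt (contDiff_bil k).continuous continuous_const)
    · exact ⟨by simp only [mem_ofPred_eq]; linarith, by simp⟩
    · set T := (bil k x₀ x₀ + 2 - k * Q) / δ x₀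
      refine ⟨max T (T / √(-k)), fun x hx y hy hq => ?_⟩
      have hy0 := hy.2 hk.le
      have hy1 := hy.1
      have hyn : √(-k) * ‖y.2‖ ≤ y.1 := by
        refine le_of_sq_le_sq ?_ hy0.le
        rw [mul_pow, hk2]; linarith
      have h1 : k * chord k x y = bil k x x - 2 * bil k x y + 1 := by
        rw [chord, mul_metric hk.ne, bil_sub_left, bil_sub_right, bil_sub_right,
          bil_self_of_mem hy, bil_comm y x]
        ring
      have h2 : δ x * y.1 ≤ bil k x y := by
        have h3 := real_inner_le_norm x.2 y.2
        have h4 : √(-k) * ‖x.2‖ * (√(-k) * ‖y.2‖) ≤ √(-k) * ‖x.2‖ * y.1 :=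
          mul_le_mul_of_nonneg_left hyn (by positivity)
        have h5 : √(-k) * ‖x.2‖ * (√(-k) * ‖y.2‖) = -k * (‖x.2‖ * ‖y.2‖) := by
          linear_combination ‖x.2‖ * ‖y.2‖ * hk2
        simp only [hδ, bil]
        nlinarith
      have hxs := hx.1
      have hxb := hx.2
      simp only [mem_ofPred_eq] at hxs hxb
      have h6 : y.1 ≤ T := by
        rw [le_div_iff₀ hδ0]
        nlinarith
      rw [Prod.norm_def]
      refine max_le_max ?_ ?_
      · rw [Real.norm_eq_abs, abs_of_pos hy0]; exact h6
      · rw [le_div_iff₀ hk0]; linarith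
  · refine ⟨{x | ‖x.2‖ < ‖x₀.2‖ + 1}, isOpen_lt (by fun_prop) continuous_const, by simp,
      max 1 (‖x₀.2‖ + 1 + √Q), fun x hx y hy hq => ?_⟩
    simp only [mem_ofPred_eq] at hx
    rw [Prod.norm_def]
    refine max_le_max (by simp [fst_eq_one hy]) ?_
    have h1 : ‖x.2 - y.2‖ ≤ √Q := by
      refine Real.le_sqrt_of_sq_le ?_
      simpa [chord, metric, real_inner_self_eq_norm_sq] using hq
    have h2 : ‖y.2‖ ≤ ‖x.2‖ + ‖x.2 - y.2‖ := by
      have := norm_sub_le x.2 (x.2 - y.2)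
      simpa using this
    linarith
  · refine ⟨univ, isOpen_univ, mem_univ _, max 1 (√(1 / k)), fun x _ y hy _ => ?_⟩
    have hy1 := hy.1
    have hy2 : 0 ≤ k * ‖y.2‖ ^ 2 := by positivity
    rw [Prod.norm_def]
    refine max_le_max ?_ ?_
    · rw [Real.norm_eq_abs, abs_le_one_iff_mul_self_le_one]; nlinarith
    · refine Real.le_sqrt_of_sq_le ?_
      rw [le_div_iff₀ hk]
      nlinarith

end Cutoff

end

section

variable {n : ℕ} {k : ℝ} {S : Type*} [NormedAddCommGroup S] [NormedSpace ℂ S]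
  [FiniteDimensional ℂ S] (c : Cl n →ₐ[ℝ] Module.End ℂ S)

/-! ## Integral operators with kernel `ker` -/

lemma contDiff_chord (k : ℝ) : ContDiff ℝ ∞ fun z : V n × V n => chord k z.1 z.2 := by
  unfold chord metric
  have h : ContDiff ℝ ∞ fun z : V n × V n => z.1 - z.2 := contDiff_fst.sub contDiff_snd
  exact ((h.fst.mul h.fst).div_const k).add (h.snd.inner ℝ h.snd)

lemma contDiff_rot : ContDiff ℝ ∞ fun z : V n × V n => rot c k z.1 z.2 := by
  unfold rot
  have h1 : ContDiff ℝ ∞ fun z : V n × V n => gam c z.1.2 :=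
    (gam c).contDiff.comp (contDiff_snd.comp contDiff_fst)
  have h2 : ContDiff ℝ ∞ fun z : V n × V n => gam c z.2.2 :=
    (gam c).contDiff.comp (contDiff_snd.comp contDiff_snd)
  have h3 : ContDiff ℝ ∞ fun z : V n × V n => z.2.1 := contDiff_fst.comp contDiff_snd
  have h4 : ContDiff ℝ ∞ fun z : V n × V n => z.1.1 := contDiff_fst.comp contDiff_fst
  exact ((h3.smul h1).sub (h4.smul h2)).sub (((h1.mul h2).sub (h2.mul h1)).const_smul _)

lemma contDiff_ker {A B : ℝ → ℂ} (hA : ContDiff ℝ ∞ A) (hB : ContDiff ℝ ∞ B) :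
    ContDiff ℝ ∞ fun z : V n × V n => ker c k A B z.1 z.2 := by
  unfold ker
  have hq := contDiff_chord (n := n) k
  have hR := contDiff_rot (k := k) c
  refine ContDiff.add ?_ ?_
  · exact (hA.comp hq).smul ((((contDiff_const.sub ((contDiff_const.mul hq).div_const 2))).smul
      contDiff_const).add (hR.const_smul _))
  · exact (hB.comp hq).smul (hR.add (hq.smul contDiff_const))

/-- Extending the section constantly along rays makes it an ambient smooth function on the open
cone, so ordinary derivatives can be used. -/
lemma contDiffAt_glob_proj (hn : 1 ≤ n) {ψ : V n → S} (hψ : IsSmoothSpinor k c ψ) {p : V n}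
    (hp : p ∈ cone n k) : ContDiffAt ℝ ∞ (fun p => glob c k ψ (proj k p)) p := by
  set α := chartAt (proj k p)
  have hc : proj k p ∈ chartDomain n k α := mem_chartDomain_chartAt (proj_mem hp)
  have hpr := contDiffAt_proj hp
  have hU : proj k ⁻¹' chartDomain n k α ∈ nhds p := by
    have hfst := hpr.continuousAt.fst
    have hcone := (isOpen_cone n k).mem_nhds hp
    revert hc
    cases α <;> intro hc
    · filter_upwards [hcone, hfst.eventually (lt_mem_nhds hc.2)] with q hq h using ⟨proj_mem hq, h⟩
    · filter_upwards [hcone, hfst.eventually (gt_mem_nhds hc.2)] with q hq h using ⟨proj_mem hq, h⟩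
  have h1 : ContDiffAt ℝ ∞ (fun q => localRep c α ψ (proj k q)) p :=
    (((hψ α) _ hc).comp p hpr.contDiffWithinAt (mapsTo_preimage _ _)).contDiffAt hU
  have h2 := contDiffAt_apply ((contDiffAt_tau c hc).comp p hpr) h1
  refine h2.congr_of_eventuallyEq ?_
  filter_upwards [hU] with q hq using glob_eq_localRep c hn hq ψ

/-- The integrand of `kerInt`. -/
def kerIntegrand (k : ℝ) (A B : ℝ → ℂ) (φ : V n → S) (x p : V n) : S :=
  weight k p • ker c k A B x (proj k p) (φ (proj k p))

/-- The integral operator with kernel `ker`, written as an integral over the cone. -/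
def kerInt (k : ℝ) (A B : ℝ → ℂ) (φ : V n → S) (x : V n) : S :=
  (mass n)⁻¹ • ∫ p, kerIntegrand c k A B φ x p

/-- Profiles of kernels: smooth functions with compact support. -/
def IsProfile (A : ℝ → ℂ) : Prop := ContDiff ℝ ∞ A ∧ HasCompactSupport A

variable {A B : ℝ → ℂ} {φ : V n → S}

lemma contDiff_kerIntegrand (hA : IsProfile A) (hB : IsProfile B)
    (hφ : ∀ p ∈ cone n k, ContDiffAt ℝ ∞ (fun p => φ (proj k p)) p) :
    ContDiff ℝ ∞ (Function.uncurry (kerIntegrand c k A B φ)) := by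
  refine contDiff_iff_contDiffAt.2 fun ⟨x, p⟩ => ?_
  by_cases hp : p ∈ cone n k
  · have hs : ContDiffAt ℝ ∞ (Prod.snd : V n × V n → V n) (x, p) := contDiffAt_snd
    have hw : ContDiffAt ℝ ∞ (fun z : V n × V n => weight k z.2) (x, p) :=
      ContDiffAt.comp (g := weight k) (x, p) (contDiffAt_weight hp) hs
    have hpr : ContDiffAt ℝ ∞ (fun z : V n × V n => proj k z.2) (x, p) :=
      ContDiffAt.comp (g := proj k) (x, p) (contDiffAt_proj hp) hs
    have hφ' : ContDiffAt ℝ ∞ (fun z : V n × V n => φ (proj k z.2)) (x, p) :=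
      ContDiffAt.comp (g := fun p => φ (proj k p)) (x, p) (hφ p hp) hs
    have hk : ContDiffAt ℝ ∞ (fun z : V n × V n => ker c k A B z.1 (proj k z.2)) (x, p) :=
      ContDiffAt.comp (g := fun z : V n × V n => ker c k A B z.1 z.2)
        (f := fun z : V n × V n => (z.1, proj k z.2)) (x, p)
        (contDiff_ker c hA.1 hB.1).contDiffAt (contDiffAt_fst.prodMk hpr)
    exact hw.smul (contDiffAt_apply hk hφ')
  · refine (contDiffAt_const (c := (0 : S))).congr_of_eventuallyEq ?_
    have h := (continuous_snd (X := V n) (Y := V n)).continuousAt.eventually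
      (eventually_weight_eq_zero (k := k) (p := ((x, p) : V n × V n).2) hp)
    filter_upwards [h] with z hz
    simp [Function.uncurry, kerIntegrand, hz]

/-- The profiles bound the chord, hence the projected point, locally uniformly in x; the weight
bounds the radial coordinate by 2. -/
lemma exists_support_kerIntegrand (hA : IsProfile A) (hB : IsProfile B) (φ : V n → S) {x₀ : V n}
    (hx₀ : x₀ ∈ cone n k) :
    ∃ s, IsOpen s ∧ x₀ ∈ s ∧ ∃ K, IsCompact K ∧
      ∀ x ∈ s, ∀ p ∉ K, kerIntegrand c k A B φ x p = 0 := by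
  obtain ⟨Q, hQ⟩ := (hA.2.isCompact.union hB.2.isCompact).bddAbove
  obtain ⟨s, hs, hxs, R, hR⟩ := exists_bound_of_chord_le hx₀ Q
  refine ⟨s, hs, hxs, Metric.closedBall 0 (2 * R), isCompact_closedBall _ _, fun x hx p hp => ?_⟩
  by_contra h0
  refine hp ?_
  have hpc : p ∈ cone n k := by
    by_contra hpc
    simp [kerIntegrand, weight_of_notMem hpc] at h0
  obtain ⟨σ, hσ, y, hy, rfl⟩ := exists_smul_eq_of_mem_cone hpc
  rw [kerIntegrand, weight_smul hσ hy, proj_smul hσ hy] at h0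
  have hσ2 : σ ≤ 2 := by
    by_contra h
    refine h0 ?_
    rw [bump_eq_zero, zero_smul]
    rintro ⟨-, h3⟩
    nlinarith
  have hq : chord k x y ≤ Q := by
    by_contra h
    refine h0 ?_
    have hA0 : A (chord k x y) = 0 :=
      image_eq_zero_of_notMem_tsupport fun hm => h (hQ (Or.inl hm))
    have hB0 : B (chord k x y) = 0 :=
      image_eq_zero_of_notMem_tsupport fun hm => h (hQ (Or.inr hm))
    simp [ker, hA0, hB0]
  have := hR x hx y hy hq
  rw [mem_closedBall_zero_iff, norm_smul, Real.norm_eq_abs, abs_of_pos hσ]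
  exact mul_le_mul hσ2 this (norm_nonneg _) (by norm_num)

lemma integrable_kerIntegrand (hA : IsProfile A) (hB : IsProfile B)
    (hφ : ∀ p ∈ cone n k, ContDiffAt ℝ ∞ (fun p => φ (proj k p)) p) {x : V n} (hx : x ∈ cone n k) :
    Integrable (kerIntegrand c k A B φ x) := by
  obtain ⟨s, hs, hxs, K, hK, h0⟩ := exists_support_kerIntegrand c hA hB φ hx
  have h : Continuous (kerIntegrand c k A B φ x) :=
    (contDiff_kerIntegrand c hA hB hφ).continuous.comp (by fun_prop : Continuous fun p => (x, p))
  exact h.integrable_of_hasCompactSupport (.intro hK (h0 x hxs))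

lemma contDiffAt_kerInt (hA : IsProfile A) (hB : IsProfile B)
    (hφ : ∀ p ∈ cone n k, ContDiffAt ℝ ∞ (fun p => φ (proj k p)) p) {x : V n} (hx : x ∈ cone n k) :
    ContDiffAt ℝ ∞ (kerInt c k A B φ) x := by
  have := FiniteDimensional.complete ℂ S
  obtain ⟨s, hs, hxs, K, hK, h0⟩ := exists_support_kerIntegrand c hA hB φ hx
  have h := contDiffOn_integral_param (μ := volume) (contDiff_kerIntegrand c hA hB hφ) hs hK h0
  exact (h.contDiffAt (hs.mem_nhds hxs)).const_smul _

lemma fderiv_kerInt (hA : IsProfile A) (hB : IsProfile B)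
    (hφ : ∀ p ∈ cone n k, ContDiffAt ℝ ∞ (fun p => φ (proj k p)) p) {x : V n} (hx : x ∈ cone n k)
    (X : V n) :
    Integrable (fun p => weight k p • dker c k A B x (proj k p) X (φ (proj k p))) ∧
    fderiv ℝ (kerInt c k A B φ) x X =
      (mass n)⁻¹ • ∫ p, weight k p • dker c k A B x (proj k p) X (φ (proj k p)) := by
  have := FiniteDimensional.complete ℂ S
  obtain ⟨s, hs, hxs, K, hK, h0⟩ := exists_support_kerIntegrand c hA hB φ hx
  have hl : HasDerivAt (fun t : ℝ => x + t • X) X 0 := by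
    simpa using ((hasDerivAt_id (0 : ℝ)).smul_const X).const_add x
  have hd (p : V n) : HasDerivAt (fun t : ℝ => kerIntegrand c k A B φ (x + t • X) p)
      (weight k p • dker c k A B x (proj k p) X (φ (proj k p))) 0 := by
    have h := hasDerivAt_ker (k := k) c (hA.1.differentiable (by simp))
      (hB.1.differentiable (by simp)) hl (proj k p)
    simp only [zero_smul, add_zero] at h
    have h2 := ((ContinuousLinearMap.apply ℂ S (φ (proj k p))).restrictScalars
      ℝ).hasFDerivAt.comp_hasDerivAt (0 : ℝ) h
    exact h2.const_smul (weight k p)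
  obtain ⟨h1, h2⟩ := fderiv_integral_param (μ := volume) (contDiff_kerIntegrand c hA hB hφ) hs hK h0
    hxs hd
  refine ⟨h1, ?_⟩
  have hdiff : DifferentiableAt ℝ (fun x => ∫ p, kerIntegrand c k A B φ x p) x :=
    ((contDiffOn_integral_param (μ := volume) (contDiff_kerIntegrand c hA hB hφ) hs hK
      h0).contDiffAt (hs.mem_nhds hxs)).differentiableAt (by simp)
  rw [← h2]
  unfold kerInt
  rw [fderiv_fun_const_smul hdiff]
  rfl

/-- The action of the Dirac operator on the profiles of kernels. -/
lemma dirac_kerInt (hn : 1 ≤ n) (hA : IsProfile A) (hB : IsProfile B)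
    (hφ : ∀ p ∈ cone n k, ContDiffAt ℝ ∞ (fun p => φ (proj k p)) p) {x : V n} (hx : x ∈ M n k) :
    ∑ i, rot c k (frame k (chartAt x) x (basisVec i)) x
        (fderiv ℝ (kerInt c k A B φ) x (frame k (chartAt x) x (basisVec i))) -
      ((n : ℂ) * sig k / 2) • kerInt c k A B φ x =
    kerInt c k (fun q => n / 2 * B q + q * deriv B q)
      (fun q => (4 - k * q) * deriv A q - n * k / 2 * A q) φ x := by
  have := FiniteDimensional.complete ℂ S
  have hxc := mem_cone_of_mem hx
  have hF := fun i => fderiv_kerInt c hA hB hφ hxc (frame k (chartAt x) x (basisVec i))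
  have hI := integrable_kerIntegrand c hA hB hφ hxc
  have hR := fun i =>
    (rot c k (frame k (chartAt x) x (basisVec i)) x).integrable_comp (hF i).1
  simp only [fun i => (hF i).2, ContinuousLinearMap.map_smul_of_tower]
  simp only [fun i => ((rot c k (frame k (chartAt x) x (basisVec i)) x).integral_comp_comm
    (hF i).1).symm]
  rw [kerInt, kerInt, smul_comm, ← Finset.smul_sum, ← smul_sub, ← integral_smul,
    ← integral_finsetSum _ fun i _ => hR i,
    ← integral_sub (integrable_finsetSum _ fun i _ => hR i)
      (f := fun p => ∑ i, rot c k (frame k (chartAt x) x (basisVec i)) x (weight k p •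
        dker c k A B x (proj k p) (frame k (chartAt x) x (basisVec i)) (φ (proj k p))))
      (g := fun p => ((n : ℂ) * sig k / 2) • kerIntegrand c k A B φ x p) (hI.smul _)]
  congr 1
  refine integral_congr_ae (.of_forall fun p => ?_)
  simp only [kerIntegrand]
  by_cases hp : p ∈ cone n k
  · rw [← dirac_ker c hn A B (mem_chartDomain_chartAt hx) (proj_mem hp)]
    simp only [ContinuousLinearMap.map_smul_of_tower, sub_apply, sum_apply, smul_apply, smul_sub,
      Finset.smul_sum, clm_mul_apply]
    rw [smul_comm]
  · simp [weight_of_notMem hp]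

end

section

/-! ## Radial functions and profiles -/

section Radial

variable {n : ℕ} {k : ℝ} {f A B : ℝ → ℂ}

lemma continuous_two_arcsn (k : ℝ) : Continuous fun q : ℝ => 2 * arcsn k (√q / 2) :=
  continuous_const.mul ((continuous_arcsn k).comp (Real.continuous_sqrt.div_const 2))

/-- The inverse r = 2 arcsn(√q/2) is singular at the ends of the range of q, but there the composite
with f vanishes locally. So h need be smooth only where 0 < q and kq < 4. -/
lemma isProfile_of_radialTest (hf : IsRadialTest k f) {h : ℝ → ℂ}
    (hh : ∀ q : ℝ, 0 < q → 0 < 4 - k * q → ContDiffAt ℝ ∞ h q) :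
    IsProfile fun q => f (2 * arcsn k (√q / 2)) * h q := by
  have hq2 {q : ℝ} (hq : 0 < q) : (√q / 2) ^ 2 = q / 4 := by
    rw [div_pow, Real.sq_sqrt hq.le]; norm_num
  constructor
  · refine contDiff_iff_contDiffAt.2 fun q => ?_
    by_cases hm : 2 * arcsn k (√q / 2) ∈ tsupport f
    · obtain ⟨h0, h1⟩ := of_two_arcsn_mem_radii (hf.2.2 hm)
      have hz : 0 < 1 - k * (√q / 2) ^ 2 := by rw [hq2 h0]; linarith
      have h2 : ContDiffAt ℝ ∞ (fun q : ℝ => √q / 2) q :=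
        (contDiffAt_id.sqrt h0.ne').div_const 2
      have h3 : ContDiffAt ℝ ∞ (fun q : ℝ => 2 * arcsn k (√q / 2)) q :=
        contDiffAt_const.mul (ContDiffAt.comp (g := arcsn k) q (contDiffAt_arcsn hz) h2)
      exact (ContDiffAt.comp (g := f) q hf.1.contDiffAt h3).mul (hh q h0 h1)
    · refine (contDiffAt_const (c := (0 : ℂ))).congr_of_eventuallyEq ?_
      have h := (continuous_two_arcsn k).continuousAt.eventually
        ((isClosed_tsupport f).isOpen_compl.mem_nhds hm)
      filter_upwards [h] with y hy
      rw [image_eq_zero_of_notMem_tsupport hy, zero_mul]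
  · have hK : IsCompact ((fun r => 4 * sn k (r / 2) ^ 2) '' tsupport f) :=
      hf.2.1.isCompact.image (continuous_const.mul
        (((continuous_sn k).comp (continuous_id.div_const 2)).pow 2))
    refine .intro hK fun q hq => ?_
    by_cases hm : 2 * arcsn k (√q / 2) ∈ tsupport f
    · refine absurd ⟨_, hm, ?_⟩ hq
      obtain ⟨h0, h1⟩ := of_two_arcsn_mem_radii (hf.2.2 hm)
      have hz : 0 ≤ 1 - k * (√q / 2) ^ 2 := by rw [hq2 h0]; linarith
      simp only
      rw [mul_div_cancel_left₀ _ two_ne_zero, sn_arcsn hz, hq2 h0]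
      ring
    · rw [image_eq_zero_of_notMem_tsupport hm, zero_mul]

lemma two_arcsn_sqrt {r : ℝ} (hr : r ∈ radii k) : 2 * arcsn k (√(4 * sn k (r / 2) ^ 2) / 2) = r := by
  have h : √(4 * sn k (r / 2) ^ 2) / 2 = sn k (r / 2) := by
    rw [show 4 * sn k (r / 2) ^ 2 = (2 * sn k (r / 2)) ^ 2 by ring,
      Real.sqrt_sq (by linarith [sn_half_pos hr])]
    ring
  rw [h, arcsn_sn_half hr.1.le fun hk => (hr.2 hk).le]

/-- The factor to be divided out is 2cs(r/2) = 2√(1 - kq/4). -/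
lemma exists_profile (hf : IsRadialTest k f) :
    ∃ A, IsProfile A ∧ ∀ r ∈ radii k, f r = 2 * cs k (r / 2) * A (4 * sn k (r / 2) ^ 2) := by
  refine ⟨_, isProfile_of_radialTest hf (h := fun q => (((2 * √(1 - k * q / 4))⁻¹ : ℝ) : ℂ)) ?_, ?_⟩
  · intro q _ hq
    have h1 : 0 < 1 - k * q / 4 := by linarith
    have h2 : ContDiffAt ℝ ∞ (fun q : ℝ => 1 - k * q / 4) q := by fun_prop
    refine Complex.ofRealCLM.contDiff.contDiffAt.comp q ?_
    exact (contDiffAt_const.mul (h2.sqrt h1.ne')).inv (by positivity)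
  · intro r hr
    have hc := cs_half_pos hr
    have h1 : 1 - k * (4 * sn k (r / 2) ^ 2) / 4 = cs k (r / 2) ^ 2 := by
      linarith [cs_sq_add k (r / 2)]
    simp only [two_arcsn_sqrt hr, h1, Real.sqrt_sq hc.le]
    have : (cs k (r / 2) : ℂ) ≠ 0 := by exact_mod_cast hc.ne'
    push_cast
    field_simp

lemma exists_profile_hat (hf : IsRadialTest k f) :
    ∃ B, IsProfile B ∧ ∀ r ∈ radii k, f r = 2 * sn k (r / 2) * B (4 * sn k (r / 2) ^ 2) := by
  refine ⟨_, isProfile_of_radialTest hf (h := fun q => (((√q)⁻¹ : ℝ) : ℂ)) ?_, ?_⟩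
  · intro q hq _
    refine Complex.ofRealCLM.contDiff.contDiffAt.comp q ?_
    exact (contDiffAt_id.sqrt hq.ne').inv (by positivity)
  · intro r hr
    have hs := sn_half_pos hr
    have h1 : √(4 * sn k (r / 2) ^ 2) = 2 * sn k (r / 2) := by
      rw [show 4 * sn k (r / 2) ^ 2 = (2 * sn k (r / 2)) ^ 2 by ring, Real.sqrt_sq (by linarith)]
    rw [two_arcsn_sqrt hr, h1]
    have : (sn k (r / 2) : ℂ) ≠ 0 := by exact_mod_cast hs.ne'
    push_cast
    field_simp

lemma isProfile_deriv (hA : IsProfile A) : IsProfile (deriv A) :=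
  ⟨(contDiff_infty_iff_deriv.1 hA.1).2, hA.2.deriv⟩

lemma IsProfile.add (hA : IsProfile A) (hB : IsProfile B) : IsProfile fun q => A q + B q :=
  ⟨hA.1.add hB.1, hA.2.add hB.2⟩

lemma IsProfile.mul_left {h : ℝ → ℂ} (hh : ContDiff ℝ ∞ h) (hA : IsProfile A) :
    IsProfile fun q => h q * A q :=
  ⟨hh.mul hA.1, hA.2.mul_left⟩

lemma contDiff_ofReal : ContDiff ℝ ∞ fun q : ℝ => (q : ℂ) := Complex.ofRealCLM.contDiff

/-- The profile of the first kernel after an application of the Dirac operator. -/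
def diracFst (n : ℕ) (B : ℝ → ℂ) (q : ℝ) : ℂ := n / 2 * B q + q * deriv B q

/-- The profile of the second kernel after an application of the Dirac operator. -/
def diracSnd (n : ℕ) (k : ℝ) (A : ℝ → ℂ) (q : ℝ) : ℂ :=
  (4 - k * q) * deriv A q - n * k / 2 * A q

lemma isProfile_diracFst (hB : IsProfile B) : IsProfile (diracFst n B) :=
  (hB.mul_left contDiff_const).add ((isProfile_deriv hB).mul_left contDiff_ofReal)

lemma isProfile_diracSnd (hA : IsProfile A) : IsProfile (diracSnd n k A) := by
  have := ((isProfile_deriv hA).mul_left (h := fun q => 4 - (k : ℂ) * q)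
    (contDiff_const.sub (contDiff_const.mul contDiff_ofReal))).add
    (hA.mul_left (h := fun _ => -((n : ℂ) * k / 2)) contDiff_const)
  unfold diracSnd
  simpa only [neg_mul, ← sub_eq_add_neg] using this

lemma IsProfile.hasDerivAt (hA : IsProfile A) (q : ℝ) : HasDerivAt A (deriv A q) q :=
  (hA.1.differentiable (by simp) q).hasDerivAt

lemma hasDerivAt_sn_half (k r : ℝ) :
    HasDerivAt (fun r => (sn k (r / 2) : ℂ)) ((cs k (r / 2) : ℂ) / 2) r := by
  have := ((hasDerivAt_sn k (r / 2)).comp r ((hasDerivAt_id r).div_const 2)).ofReal_comp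
  refine this.congr_deriv ?_
  push_cast; ring

lemma hasDerivAt_cs_half (k r : ℝ) :
    HasDerivAt (fun r => (cs k (r / 2) : ℂ)) (-k * (sn k (r / 2) : ℂ) / 2) r := by
  have := ((hasDerivAt_cs k (r / 2)).comp r ((hasDerivAt_id r).div_const 2)).ofReal_comp
  refine this.congr_deriv ?_
  push_cast; ring

lemma IsProfile.hasDerivAt_comp (hA : IsProfile A) (k r : ℝ) :
    HasDerivAt (fun r => A (4 * sn k (r / 2) ^ 2))
      (4 * sn k (r / 2) * cs k (r / 2) * deriv A (4 * sn k (r / 2) ^ 2)) r := by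
  have h1 := (((hasDerivAt_sn k (r / 2)).comp r ((hasDerivAt_id r).div_const 2)).pow 2).const_mul 4
  have h2 := (hA.hasDerivAt (4 * sn k (r / 2) ^ 2)).scomp r h1
  refine h2.congr_deriv ?_
  simp only [Complex.real_smul, Function.comp_apply, id]
  push_cast; ring

lemma hasDerivAt_ofReal (q : ℝ) : HasDerivAt (fun q : ℝ => (q : ℂ)) 1 q :=
  (hasDerivAt_id q).ofReal_comp

lemma deriv_diracFst (hB : IsProfile B) (q : ℝ) :
    deriv (diracFst n B) q = (n / 2 + 1) * deriv B q + q * deriv (deriv B) q := by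
  have h : HasDerivAt (diracFst n B) _ q := ((hB.hasDerivAt q).const_mul ((n : ℂ) / 2)).add
    ((hasDerivAt_ofReal q).mul ((isProfile_deriv hB).hasDerivAt q))
  refine h.deriv.trans ?_
  ring

lemma deriv_diracSnd (hA : IsProfile A) (q : ℝ) :
    deriv (diracSnd n k A) q = (4 - k * q) * deriv (deriv A) q - (n / 2 + 1) * k * deriv A q := by
  have h : HasDerivAt (diracSnd n k A) _ q :=
    ((((hasDerivAt_ofReal q).const_mul (k : ℂ)).const_sub 4).mul
      ((isProfile_deriv hA).hasDerivAt q)).sub ((hA.hasDerivAt q).const_mul ((n : ℂ) * k / 2))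
  refine h.deriv.trans ?_
  ring

/-- The substitution q = 4 sn(r/2)² is differentiated twice on the open set of radii. After the
double angles are expanded, the identity is rational in cs(r/2) and sn(r/2) and holds modulo cs² + k
sn² = 1. -/
lemma T_eq (hA : IsProfile A)
    (hf : ∀ r ∈ radii k, f r = 2 * cs k (r / 2) * A (4 * sn k (r / 2) ^ 2)) {r : ℝ}
    (hr : r ∈ radii k) :
    T n k f r = 2 * cs k (r / 2) * diracFst n (diracSnd n k A) (4 * sn k (r / 2) ^ 2) := by
  have hU {r : ℝ} (hr : r ∈ radii k) := (isOpen_radii k).mem_nhds hr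
  have h1 (r : ℝ) (hr : r ∈ radii k) : deriv f r = -k * sn k (r / 2) * A (4 * sn k (r / 2) ^ 2) +
      8 * sn k (r / 2) * cs k (r / 2) ^ 2 * deriv A (4 * sn k (r / 2) ^ 2) := by
    have h := (((hasDerivAt_cs_half k r).const_mul 2).mul
      (hA.hasDerivAt_comp k r)).congr_of_eventuallyEq (Filter.eventually_of_mem (hU hr) hf)
    rw [h.deriv]; ring
  have h2 := ((((hasDerivAt_sn_half k r).const_mul (-(k : ℂ))).mul (hA.hasDerivAt_comp k r)).add
    ((((hasDerivAt_sn_half k r).const_mul 8).mul ((hasDerivAt_cs_half k r).pow 2)).mul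
      ((isProfile_deriv hA).hasDerivAt_comp k r))).congr_of_eventuallyEq
        (Filter.eventually_of_mem (hU hr) h1)
  rw [T, h2.deriv, h1 r hr, hf r hr, diracFst, deriv_diracSnd hA, diracSnd, cs_eq_half k r,
    sn_eq_half k r]
  have hc : (cs k (r / 2) : ℂ) ≠ 0 := by exact_mod_cast (cs_half_pos hr).ne'
  have hs : (sn k (r / 2) : ℂ) ≠ 0 := by exact_mod_cast (sn_half_pos hr).ne'
  have hcs : (cs k (r / 2) : ℂ) ^ 2 + k * (sn k (r / 2) : ℂ) ^ 2 = 1 := by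
    exact_mod_cast cs_sq_add k (r / 2)
  clear h1 h2 hf hU
  simp only [Complex.real_smul, Pi.mul_apply, Pi.pow_apply]
  push_cast
  generalize (cs k (r / 2) : ℂ) = C at *
  generalize (sn k (r / 2) : ℂ) = s at *
  generalize deriv (deriv A) _ = A2
  generalize deriv A _ = A1
  generalize A _ = A0
  field_simp
  grind

lemma That_eq (hB : IsProfile B)
    (hf : ∀ r ∈ radii k, f r = 2 * sn k (r / 2) * B (4 * sn k (r / 2) ^ 2)) {r : ℝ}
    (hr : r ∈ radii k) :
    That n k f r = 2 * sn k (r / 2) * diracSnd n k (diracFst n B) (4 * sn k (r / 2) ^ 2) := by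
  have hU {r : ℝ} (hr : r ∈ radii k) := (isOpen_radii k).mem_nhds hr
  have h1 (r : ℝ) (hr : r ∈ radii k) : deriv f r = cs k (r / 2) * B (4 * sn k (r / 2) ^ 2) +
      8 * cs k (r / 2) * sn k (r / 2) ^ 2 * deriv B (4 * sn k (r / 2) ^ 2) := by
    have h := (((hasDerivAt_sn_half k r).const_mul 2).mul
      (hB.hasDerivAt_comp k r)).congr_of_eventuallyEq (Filter.eventually_of_mem (hU hr) hf)
    rw [h.deriv]; ring
  have h2 := (((hasDerivAt_cs_half k r).mul (hB.hasDerivAt_comp k r)).add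
    ((((hasDerivAt_cs_half k r).const_mul 8).mul ((hasDerivAt_sn_half k r).pow 2)).mul
      ((isProfile_deriv hB).hasDerivAt_comp k r))).congr_of_eventuallyEq
        (Filter.eventually_of_mem (hU hr) h1)
  rw [That, h2.deriv, h1 r hr, hf r hr, diracSnd, deriv_diracFst hB, diracFst, cs_eq_half k r,
    sn_eq_half k r]
  have hc : (cs k (r / 2) : ℂ) ≠ 0 := by exact_mod_cast (cs_half_pos hr).ne'
  have hs : (sn k (r / 2) : ℂ) ≠ 0 := by exact_mod_cast (sn_half_pos hr).ne'
  have hcs : (cs k (r / 2) : ℂ) ^ 2 + k * (sn k (r / 2) : ℂ) ^ 2 = 1 := by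
    exact_mod_cast cs_sq_add k (r / 2)
  clear h1 h2 hf hU
  simp only [Complex.real_smul, Pi.mul_apply, Pi.pow_apply]
  push_cast
  generalize (cs k (r / 2) : ℂ) = C at *
  generalize (sn k (r / 2) : ℂ) = s at *
  generalize deriv (deriv B) _ = B2
  generalize deriv B _ = B1
  generalize B _ = B0
  field_simp
  grind

lemma deriv_eq_zero_of_notMem_tsupport {r : ℝ} (hr : r ∉ tsupport f) : deriv f r = 0 :=
  image_eq_zero_of_notMem_tsupport fun h => hr (closure_minimal support_deriv_subset
    (isClosed_tsupport f) h)

lemma deriv_deriv_eq_zero_of_notMem_tsupport {r : ℝ} (hr : r ∉ tsupport f) :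
    deriv (deriv f) r = 0 :=
  deriv_eq_zero_of_notMem_tsupport fun h => hr (closure_minimal support_deriv_subset
    (isClosed_tsupport f) h)

/-- Outside the admissible radii the coefficients take meaningless default values, but they multiply
f and its derivative, which vanish there. -/
lemma T_eq_zero (hf : IsRadialTest k f) {r : ℝ} (hr : r ∉ radii k) : T n k f r = 0 := by
  have h : r ∉ tsupport f := fun h => hr (hf.2.2 h)
  simp [T, deriv_deriv_eq_zero_of_notMem_tsupport h, deriv_eq_zero_of_notMem_tsupport h,
    image_eq_zero_of_notMem_tsupport h]

lemma That_eq_zero (hf : IsRadialTest k f) {r : ℝ} (hr : r ∉ radii k) : That n k f r = 0 := by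
  have h : r ∉ tsupport f := fun h => hr (hf.2.2 h)
  simp [That, deriv_deriv_eq_zero_of_notMem_tsupport h, deriv_eq_zero_of_notMem_tsupport h,
    image_eq_zero_of_notMem_tsupport h]

end Radial

end

section

variable {n : ℕ} {k : ℝ} {S : Type*} [NormedAddCommGroup S] [NormedSpace ℂ S]
  [FiniteDimensional ℂ S] (c : Cl n →ₐ[ℝ] Module.End ℂ S)

/-! ## Superpositions of spherical means -/

/-- The trivialization `tau` as an isomorphism. -/
def tauEquiv (hn : 1 ≤ n) {x : V n} (hx : x ∈ M n k) : S ≃L[ℂ] S :=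
  .equivOfInverse (tau c k (chartAt x) x) (tauInv c k (chartAt x) x)
    (tauInv_tau c hn (mem_chartDomain_chartAt hx)) (tau_tauInv c hn (mem_chartDomain_chartAt hx))

lemma tauEquiv_apply (hn : 1 ≤ n) {x : V n} (hx : x ∈ M n k) (v : S) :
    tauEquiv c hn hx v = tau c k (chartAt x) x v := rfl

lemma area_pos (hn : 1 ≤ n) {r : ℝ} (hr : r ∈ radii k) : 0 < area n k r := by
  have : Nonempty (Fin n) := ⟨⟨0, hn⟩⟩
  have h : (volume : Measure (E n)).toSphere univ ≠ 0 := by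
    rw [Ne, Measure.measure_univ_eq_zero]
    exact Measure.toSphere_ne_zero _
  refine mul_pos ?_ (pow_pos (sn_pos hr) _)
  exact ENNReal.toReal_pos h (measure_ne_top _ _)

lemma continuous_ker_polar {A B : ℝ → ℂ} {φ : V n → S} (hA : IsProfile A) (hB : IsProfile B)
    (hφ : ∀ p ∈ cone n k, ContDiffAt ℝ ∞ (fun p => φ (proj k p)) p) (hn : 1 ≤ n) {x : V n}
    (hx : x ∈ M n k) {r : ℝ} (hr : r ∈ radii k) :
    Continuous fun θ : Metric.sphere (0 : E n) 1 =>
      ker c k A B x (polar k x r (frame k (chartAt x) x θ))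
        (φ (polar k x r (frame k (chartAt x) x θ))) := by
  have hp : Continuous fun θ : Metric.sphere (0 : E n) 1 =>
      polar k x r (frame k (chartAt x) x θ) := by
    have := (frameL k (chartAt x) x).continuous.comp
      (continuous_subtype_val (p := (· ∈ Metric.sphere (0 : E n) 1)))
    exact continuous_const.add (this.const_smul (sn k r))
  have hM (θ : Metric.sphere (0 : E n) 1) : polar k x r (frame k (chartAt x) x θ) ∈ M n k :=
    polar_mem hx (frame_mem_tangent (mem_chartDomain_chartAt hx) _)
      (unit_frame hn hx (θ := θ.1) (by simp)) hr.1
  have hpr {y : V n} (hy : y ∈ M n k) : proj k y = y := by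
    simpa using proj_smul one_pos hy
  have h1 : Continuous fun θ : Metric.sphere (0 : E n) 1 =>
      φ (polar k x r (frame k (chartAt x) x θ)) := by
    refine continuous_iff_continuousAt.2 fun θ => ?_
    have h := ContinuousAt.comp (g := fun p => φ (proj k p)) (x := θ)
      (f := fun θ : Metric.sphere (0 : E n) 1 => polar k x r (frame k (chartAt x) x θ))
      (hφ _ (mem_cone_of_mem (hM θ))).continuousAt hp.continuousAt
    exact h.congr (.of_forall fun θ' => by simp only [Function.comp_apply, hpr (hM θ')])
  exact ((contDiff_ker c hA.1 hB.1).continuous.comp (continuous_const.prodMk hp)).clm_apply h1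

lemma ker_add (A B : ℝ → ℂ) (x y : V n) :
    ker c k A B x y = ker c k A (fun _ => 0) x y + ker c k (fun _ => 0) B x y := by
  simp [ker]

lemma isProfile_zero : IsProfile fun _ => 0 := ⟨contDiff_const, HasCompactSupport.zero⟩

/-- The integrand of a superposition of spherical means in the global trivialization. -/
lemma tau_mean {f fhat A B : ℝ → ℂ} (hn : 1 ≤ n) {ψ : V n → S} (hψ : IsSmoothSpinor k c ψ)
    (hA : IsProfile A) (hB : IsProfile B) {r : ℝ} (hr : r ∈ radii k)
    (hf : f r = 2 * cs k (r / 2) * A (4 * sn k (r / 2) ^ 2))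
    (hfhat : fhat r = 2 * sn k (r / 2) * B (4 * sn k (r / 2) ^ 2)) {x : V n} (hx : x ∈ M n k) :
    tauEquiv c hn hx (area n k r • (f r • mean k c r ψ x + fhat r • meanHat k c r ψ x)) =
      sn k r ^ (n - 1) • ∫ θ : Metric.sphere (0 : E n) 1,
        ker c k A B x (polar k x r (frame k (chartAt x) x θ))
          (glob c k ψ (polar k x r (frame k (chartAt x) x θ)))
            ∂(volume : Measure (E n)).toSphere := by
  have hφ := fun p (hp : p ∈ cone n k) => contDiffAt_glob_proj c hn hψ hp
  have ha := (area_pos hn hr).ne'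
  have hi1 := (continuous_ker_polar c hA isProfile_zero hφ hn hx hr).integrable_of_hasCompactSupport
    (μ := (volume : Measure (E n)).toSphere) (HasCompactSupport.of_compactSpace _)
  have hi2 := (continuous_ker_polar c isProfile_zero hB hφ hn hx hr).integrable_of_hasCompactSupport
    (μ := (volume : Measure (E n)).toSphere) (HasCompactSupport.of_compactSpace _)
  have h1 (θ : Metric.sphere (0 : E n) 1) : tauEquiv c hn hx (f r • transport k c x
      (polar k x r (frame k (chartAt x) x θ)) (ψ (polar k x r (frame k (chartAt x) x θ)))) =
      ker c k A (fun _ => 0) x (polar k x r (frame k (chartAt x) x θ))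
          (glob c k ψ (polar k x r (frame k (chartAt x) x θ))) := by
    have h := glob_transport_ker c hn hx (θ := θ.1) (by simp) hr A (fun _ => 0)
      (ψ (polar k x r (frame k (chartAt x) x θ))) rfl
    rw [mul_zero, zero_smul, add_zero, ← hf] at h
    exact h
  have h2 (θ : Metric.sphere (0 : E n) 1) : tauEquiv c hn hx (fhat r • cliff k c x
      (nu k x (polar k x r (frame k (chartAt x) x θ))) (transport k c x
      (polar k x r (frame k (chartAt x) x θ)) (ψ (polar k x r (frame k (chartAt x) x θ))))) =
      ker c k (fun _ => 0) B x (polar k x r (frame k (chartAt x) x θ))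
          (glob c k ψ (polar k x r (frame k (chartAt x) x θ))) := by
    have h := glob_transport_ker c hn hx (θ := θ.1) (by simp) hr (fun _ => 0) B
      (ψ (polar k x r (frame k (chartAt x) x θ))) rfl
    rw [mul_zero, zero_smul, zero_add, ← hfhat] at h
    exact h
  -- The area in dμ cancels the normalization of the mean; only the Jacobian sn(r)ⁿ⁻¹ of the sphere
  -- remains.
  have h3 (z : ℂ) (g : V n → S) :
      area n k r • z • (1 / area n k r) • ∫ x' in gsphere k x r, g x' ∂(surfMeasure k x r) =
        sn k r ^ (n - 1) • ∫ θ : Metric.sphere (0 : E n) 1,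
          z • g (polar k x r (frame k (chartAt x) x θ)) ∂(volume : Measure (E n)).toSphere := by
    rw [integral_gsphere hn hx hr, smul_comm z, smul_smul, mul_one_div_cancel ha, one_smul,
      smul_comm z, integral_smul]
  have h4 (v : S) (a : ℝ) : tauEquiv c hn hx (a • v) = a • tauEquiv c hn hx v :=
    ContinuousLinearMap.map_smul_of_tower (tauEquiv c hn hx : S →L[ℂ] S) a v
  rw [smul_add, mean, meanHat, h3, h3, ← smul_add, h4, map_add,
    ← ContinuousLinearEquiv.integral_comp_comm, ← ContinuousLinearEquiv.integral_comp_comm]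
  simp only [h1, h2]
  rw [← integral_add hi1 hi2]
  congr 2
  funext θ
  rw [ker_add c A B, add_apply]

/-- A superposition of spherical means is an integral operator with kernel `ker`. -/
lemma glob_superpose {f fhat A B : ℝ → ℂ} (hn : 1 ≤ n) {ψ : V n → S} (hψ : IsSmoothSpinor k c ψ)
    (hA : IsProfile A) (hB : IsProfile B) (hf0 : ∀ r ∉ radii k, f r = 0)
    (hfhat0 : ∀ r ∉ radii k, fhat r = 0)
    (hf : ∀ r ∈ radii k, f r = 2 * cs k (r / 2) * A (4 * sn k (r / 2) ^ 2))
    (hfhat : ∀ r ∈ radii k, fhat r = 2 * sn k (r / 2) * B (4 * sn k (r / 2) ^ 2)) {x : V n}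
    (hx : x ∈ M n k) :
    glob c k (superpose k c f fhat ψ) x = kerInt c k A B (glob c k ψ) x := by
  have hφ := fun p (hp : p ∈ cone n k) => contDiffAt_glob_proj c hn hψ hp
  have hm := (isOpen_radii k).measurableSet
  have hsub : radii k ⊆ Ioi 0 := fun r hr => hr.1
  rw [glob, ← tauEquiv_apply c hn hx, superpose,
    setIntegral_eq_of_subset_of_forall_sdiff_eq_zero measurableSet_Ioi hsub
      (fun r hr => by rw [hf0 r hr.2, hfhat0 r hr.2]; simp),
    ← ContinuousLinearEquiv.integral_comp_comm,
    setIntegral_congr_fun hm fun r hr => tau_mean c hn hψ hA hB hr (hf r hr) (hfhat r hr) hx,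
    kerInt, integral_cone hn hx (w := fun s => bump (s ^ 2))
      (G := fun y => ker c k A B x y (glob c k ψ y))
      (integrable_kerIntegrand c hA hB hφ (mem_cone_of_mem hx))]
  -- The integral along rays contributes the factor `mass n`, which the normalization of `kerInt`
  -- removes.
  · exact (inv_smul_smul₀ (mass_pos n).ne' _).symm
  · intro p hp
    simp [kerIntegrand, weight_of_notMem hp]
  · intro s hs y hy
    simp only [kerIntegrand, weight_smul hs hy, proj_smul hs hy]

/-- The result is again a `kerInt` with the same φ, and χ enters only through its values on M; this
is what allows a second application. -/
lemma glob_dirac_kerInt {A B : ℝ → ℂ} {φ χ : V n → S} (hn : 1 ≤ n) (hA : IsProfile A)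
    (hB : IsProfile B) (hφ : ∀ p ∈ cone n k, ContDiffAt ℝ ∞ (fun p => φ (proj k p)) p)
    (hχ : ∀ x ∈ M n k, glob c k χ x = kerInt c k A B φ x) {x : V n} (hx : x ∈ M n k) :
    glob c k (dirac k c χ) x = kerInt c k (diracFst n B) (diracSnd n k A) φ x := by
  rw [glob_dirac c hn hχ hx
    ((contDiffAt_kerInt c hA hB hφ (mem_cone_of_mem hx)).differentiableAt (by simp))]
  exact dirac_kerInt c hn hA hB hφ hx

lemma isSmoothSpinor_of_glob {φ χ : V n → S} (hn : 1 ≤ n)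
    (hφ : ∀ x ∈ M n k, ContDiffAt ℝ ∞ φ x) (hχ : ∀ x ∈ M n k, glob c k χ x = φ x) :
    IsSmoothSpinor k c χ := by
  intro α
  have h : ContDiffOn ℝ ∞ (fun x => tauInv c k α x (φ x)) (chartDomain n k α) := fun x hx =>
    (contDiffAt_apply (contDiffAt_tauInv c hx)
      (hφ x (mem_M_of_mem_chartDomain hx))).contDiffWithinAt
  refine h.congr fun x hx => ?_
  rw [localRep_eq c hn hx, hχ x (mem_M_of_mem_chartDomain hx)]

/-- The square of the Dirac operator on superpositions of spherical means. -/
theorem dirac_dirac_superpose (hn : 1 ≤ n) {f fhat : ℝ → ℂ} (hf : IsRadialTest k f)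
    (hfhat : IsRadialTest k fhat) {ψ : V n → S} (hψ : IsSmoothSpinor k c ψ) :
    IsSmoothSpinor k c (superpose k c f fhat ψ) ∧ ∀ x ∈ M n k,
      dirac k c (dirac k c (superpose k c f fhat ψ)) x =
        superpose k c (T n k f) (That n k fhat) ψ x := by
  have hφ := fun p (hp : p ∈ cone n k) => contDiffAt_glob_proj c hn hψ hp
  obtain ⟨A, hA, hfA⟩ := exists_profile hf
  obtain ⟨B, hB, hfB⟩ := exists_profile_hat hfhat
  have h0 {g : ℝ → ℂ} (hg : IsRadialTest k g) (r : ℝ) (hr : r ∉ radii k) : g r = 0 :=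
    image_eq_zero_of_notMem_tsupport fun h => hr (hg.2.2 h)
  have hsup := fun x (hx : x ∈ M n k) =>
    glob_superpose c hn hψ hA hB (h0 hf) (h0 hfhat) hfA hfB hx
  refine ⟨isSmoothSpinor_of_glob c hn
    (fun x hx => contDiffAt_kerInt c hA hB hφ (mem_cone_of_mem hx)) hsup, fun x hx => ?_⟩
  have hD := fun x (hx : x ∈ M n k) => glob_dirac_kerInt c hn hA hB hφ hsup hx
  have hDD := glob_dirac_kerInt c hn (isProfile_diracFst hB) (isProfile_diracSnd hA) hφ hD hx
  have hT := glob_superpose c hn hψ (isProfile_diracFst (isProfile_diracSnd hA))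
    (isProfile_diracSnd (isProfile_diracFst hB)) (fun r hr => T_eq_zero (n := n) hf hr)
    (fun r hr => That_eq_zero (n := n) hfhat hr) (fun r hr => T_eq hA hfA hr)
    (fun r hr => That_eq hB hfB hr) hx
  -- Both sides have the same kernel representation in the trivialization, which is injective on
  -- each fibre.
  exact (tauEquiv c hn hx).injective (hDD.trans hT.symm)

end

end SpaceForm

end

theorem lemma2p2 {n : ℕ} (hn : 2 ≤ n) (k : ℝ)
    {S : Type*} [NormedAddCommGroup S] [NormedSpace ℂ S] [FiniteDimensional ℂ S]
    (c : SpaceForm.Cl n →ₐ[ℝ] Module.End ℂ S)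
    (f fhat : ℝ → ℂ) (hf : SpaceForm.IsRadialTest k f) (hfhat : SpaceForm.IsRadialTest k fhat)
    (ψ : SpaceForm.V n → S) (hψ : SpaceForm.IsSmoothSpinor k c ψ) :
    SpaceForm.IsSmoothSpinor k c (SpaceForm.superpose k c f fhat ψ) ∧
    ∀ x ∈ SpaceForm.M n k,
      SpaceForm.dirac k c (SpaceForm.dirac k c (SpaceForm.superpose k c f fhat ψ)) x =
        SpaceForm.superpose k c (SpaceForm.T n k f) (SpaceForm.That n k fhat) ψ x :=
  SpaceForm.dirac_dirac_superpose c (by omega) hf hfhat hψ
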